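/- Let $(\Sigma_1,g_1)$ and $(\Sigma_2,g_2)$ be compact connected oriented smooth Riemannian surfaces without boundary, of constant Gauss curvatures $c_1$ and $c_2$ with $c_1\neq c_2$. Let $\omega_1,\omega_2$ be their Kähler (area) forms, and let $\Sigma_1\times\Sigma_2$ carry the product Kähler structure, with Kähler form $\omega=\pi_1^*\omega_1+\pi_2^*\omega_2$, where $\pi_i$ is the projection onto $\Sigma_i$. Let $\Sigma$ be a compact oriented smooth surface without boundary and let $\Phi=(\phi,\psi):\Sigma\to\Sigma_1\times\Sigma_2$ be a smooth Lagrangian immersion, that is, an immersion with $\Phi^*\omega=0$. Then the degrees of the component maps $\phi:\Sigma\to\Sigma_1$ and $\psi:\Sigma\to\Sigma_2$ satisfy \[ \deg(\phi)=\deg(\psi)=0 . \] -/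

import Mathlib

open scoped Manifold ContDiff

noncomputable section

/-- The Euclidean plane, on which smooth surfaces are modelled. -/
abbrev Plane : Type := EuclideanSpace ℝ (Fin 2)

/-! ### Orientations -/

/-- The sign (`1`, `-1` or `0`) of an ordered pair of vectors of an oriented real plane: it is `1` on
positive bases, `-1` on negative bases and `0` on linearly dependent pairs. The orientation is a ray
of alternating forms, and the sign does not depend on the representative. -/
def orientationSign {V : Type*} [AddCommGroup V] [Module ℝ V] (o : Orientation ℝ V (Fin 2))
    (v w : V) : SignType :=
  SignType.sign (Module.Ray.someVector o ![v, w])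

/-- The `i`-th coordinate vector field of a chart `e`, at the point with coordinates `u`. -/
def coordVector {M : Type*} [TopologicalSpace M] [ChartedSpace Plane M]
    (e : OpenPartialHomeomorph M Plane) (u : Plane) (i : Fin 2) :
    TangentSpace (𝓡 2) (e.symm u) :=
  mfderiv (𝓡 2) (𝓡 2) e.symm u (EuclideanSpace.single i (1 : ℝ) : Plane)

/-- An orientation of a smooth surface: an orientation of every tangent plane such that around each
point there is a smooth chart whose coordinate frame is everywhere positive. -/
structure SurfaceOrientation (M : Type*) [TopologicalSpace M] [ChartedSpace Plane M] where
  /-- The orientation of the tangent plane at a point. -/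
  orient (x : M) : Orientation ℝ (TangentSpace (𝓡 2) x) (Fin 2)
  exists_positive_chart (x : M) : ∃ e ∈ IsManifold.maximalAtlas (𝓡 2) ∞ M, x ∈ e.source ∧
    ∀ u ∈ e.target,
      orientationSign (orient (e.symm u)) (coordVector e u 0) (coordVector e u 1) = 1

/-! ### Riemannian metrics, area forms and Gauss curvature -/

/-- Smooth Riemannian metrics on a smooth surface. -/
abbrev SurfaceMetric (M : Type*) [TopologicalSpace M] [ChartedSpace Plane M]
    [IsManifold (𝓡 2) ∞ M] : Type _ :=
  Bundle.ContMDiffRiemannianMetric (𝓡 2) ∞ Plane (fun x : M ↦ TangentSpace (𝓡 2) x)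

section Surface

variable {M : Type*} [TopologicalSpace M] [ChartedSpace Plane M] [IsManifold (𝓡 2) ∞ M]

/-- The area form of an oriented Riemannian surface, which is also its Kähler form: its value on
`(v, w)` is the signed area of the parallelogram spanned by `v` and `w`, so that it is `1` on
positive orthonormal bases. -/
def areaForm (g : SurfaceMetric M) (o : SurfaceOrientation M) (x : M)
    (v w : TangentSpace (𝓡 2) x) : ℝ :=
  (orientationSign (o.orient x) v w : ℝ) *
    √(g.inner x v v * g.inner x w w - g.inner x v w ^ 2)

/-- The matrix `(g_ij)` of a metric in a chart, as a function of the coordinates. -/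
def metricMatrix (g : SurfaceMetric M) (e : OpenPartialHomeomorph M Plane) (u : Plane) :
    Matrix (Fin 2) (Fin 2) ℝ :=
  Matrix.of fun i j ↦ g.inner (e.symm u) (coordVector e u i) (coordVector e u j)

/-- The `i`-th partial derivative of a function on the plane. -/
def partialDeriv (i : Fin 2) (f : Plane → ℝ) (u : Plane) : ℝ :=
  fderiv ℝ f u (EuclideanSpace.single i (1 : ℝ))

/-- The Christoffel symbol `Γ^k_ij` of the Levi-Civita connection in a chart. -/
def christoffel (g : SurfaceMetric M) (e : OpenPartialHomeomorph M Plane) (k i j : Fin 2)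
    (u : Plane) : ℝ :=
  (1 / 2) * ∑ l, (metricMatrix g e u)⁻¹ k l *
    (partialDeriv i (fun u' ↦ metricMatrix g e u' j l) u
      + partialDeriv j (fun u' ↦ metricMatrix g e u' i l) u
      - partialDeriv l (fun u' ↦ metricMatrix g e u' i j) u)

/-- The component along `∂_l` of `R(∂_i, ∂_j) ∂_k = ∇_i ∇_j ∂_k - ∇_j ∇_i ∂_k` in a chart. -/
def riemannCoeff (g : SurfaceMetric M) (e : OpenPartialHomeomorph M Plane) (l i j k : Fin 2)
    (u : Plane) : ℝ :=
  partialDeriv i (christoffel g e l j k) u - partialDeriv j (christoffel g e l i k) u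
    + ∑ m, (christoffel g e m j k u * christoffel g e l i m u
      - christoffel g e m i k u * christoffel g e l j m u)

/-- The Gauss curvature `⟨R(∂_0, ∂_1) ∂_1, ∂_0⟩ / det (g_ij)` at the point with coordinates `u` in
a chart. -/
def gaussCurvature (g : SurfaceMetric M) (e : OpenPartialHomeomorph M Plane) (u : Plane) : ℝ :=
  (∑ l, riemannCoeff g e l 0 1 1 u * metricMatrix g e u l 0) / (metricMatrix g e u).det

/-- The metric has constant Gauss curvature `c` (computed in every smooth chart). -/
def HasConstantGaussCurvature (g : SurfaceMetric M) (c : ℝ) : Prop :=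
  ∀ e ∈ IsManifold.maximalAtlas (𝓡 2) ∞ M, ∀ u ∈ e.target, gaussCurvature g e u = c

end Surface

/-! ### Lagrangian immersions into a product of two surfaces -/

section Lagrangian

variable {S M₁ M₂ : Type*} [TopologicalSpace S] [ChartedSpace Plane S]
  [TopologicalSpace M₁] [ChartedSpace Plane M₁] [IsManifold (𝓡 2) ∞ M₁]
  [TopologicalSpace M₂] [ChartedSpace Plane M₂] [IsManifold (𝓡 2) ∞ M₂]

/-- The Kähler form `π₁^* ω₁ + π₂^* ω₂` of the product of two oriented Riemannian surfaces. -/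
def productKahlerForm (g₁ : SurfaceMetric M₁) (o₁ : SurfaceOrientation M₁)
    (g₂ : SurfaceMetric M₂) (o₂ : SurfaceOrientation M₂) (p : M₁ × M₂)
    (v w : TangentSpace ((𝓡 2).prod (𝓡 2)) p) : ℝ :=
  areaForm g₁ o₁ p.1 (mfderiv ((𝓡 2).prod (𝓡 2)) (𝓡 2) Prod.fst p v)
      (mfderiv ((𝓡 2).prod (𝓡 2)) (𝓡 2) Prod.fst p w)
    + areaForm g₂ o₂ p.2 (mfderiv ((𝓡 2).prod (𝓡 2)) (𝓡 2) Prod.snd p v)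
      (mfderiv ((𝓡 2).prod (𝓡 2)) (𝓡 2) Prod.snd p w)

/-- `Φ` is a smooth Lagrangian immersion: its differential is injective at every point and it pulls
the Kähler form of the product back to `0`. -/
structure IsLagrangianImmersion (g₁ : SurfaceMetric M₁) (o₁ : SurfaceOrientation M₁)
    (g₂ : SurfaceMetric M₂) (o₂ : SurfaceOrientation M₂) (Φ : S → M₁ × M₂) : Prop where
  contMDiff : ContMDiff (𝓡 2) ((𝓡 2).prod (𝓡 2)) ∞ Φ
  injective_mfderiv (x : S) :
    Function.Injective (mfderiv (𝓡 2) ((𝓡 2).prod (𝓡 2)) Φ x)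
  pullback_eq_zero (x : S) (v w : TangentSpace (𝓡 2) x) :
    productKahlerForm g₁ o₁ g₂ o₂ (Φ x) (mfderiv (𝓡 2) ((𝓡 2).prod (𝓡 2)) Φ x v)
      (mfderiv (𝓡 2) ((𝓡 2).prod (𝓡 2)) Φ x w) = 0

end Lagrangian

/-! ### The degree of a map between oriented surfaces -/

section Degree

variable {M N : Type*} [TopologicalSpace M] [ChartedSpace Plane M]
  [TopologicalSpace N] [ChartedSpace Plane N]

/-- `y` is a regular value of `f`: the differential of `f` is onto at every point over `y`. -/
def IsRegularValue (f : M → N) (y : N) : Prop :=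
  ∀ x, f x = y → Function.Surjective (mfderiv (𝓡 2) (𝓡 2) f x)

open Classical in
/-- The sign with which a regular point `x` of `f` is counted: `1` if the differential of `f` at `x`
preserves orientation and `-1` if it reverses it. -/
def localDegree (oM : SurfaceOrientation M) (oN : SurfaceOrientation N) (f : M → N) (x : M) : ℤ :=
  if ∀ v w : TangentSpace (𝓡 2) x,
      orientationSign (oN.orient (f x)) (mfderiv (𝓡 2) (𝓡 2) f x v) (mfderiv (𝓡 2) (𝓡 2) f x w)
        = orientationSign (oM.orient x) v w
  then 1 else -1

/-- `f` has degree `d`: it has a regular value, and over each regular value there are finitely many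
points, whose number counted with signs is `d`. (For a smooth map from a compact oriented surface to
a connected oriented surface there is exactly one such `d`.) -/
structure HasDegree (oM : SurfaceOrientation M) (oN : SurfaceOrientation N) (f : M → N) (d : ℤ) :
    Prop where
  exists_regularValue : ∃ y, IsRegularValue f y
  finite_fiber (y : N) : IsRegularValue f y → (f ⁻¹' {y}).Finite
  count_eq (y : N) : IsRegularValue f y → ∑ᶠ x ∈ f ⁻¹' {y}, localDegree oM oN f x = d

end Degree

end

/-!
The Lagrangian condition says that the differential of `Φ`, extended complex linearly, identifies the
complexified tangent bundle of `S` with `Φ^* T(M₁ × M₂)`. The determinant line of the left-hand side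
is the complexification of a real line bundle; the determinant line of the right-hand side carries
the Levi-Civita connection, whose curvature is the Ricci form `c₁ ω₁ + c₂ ω₂`. The imaginary part of
the connection form in a real frame does not depend on the real frame, so it is a global one-form
on `S`, and it is a primitive of the pulled back Ricci form, up to sign. As `φ^* ω₁ = -ψ^* ω₂`, it
is a primitive of `-(c₁ - c₂) φ^* ω₁`; hence `φ^* ω₁` and `ψ^* ω₂` have integral zero by Stokes'
theorem, and a map for which the pullback of the area form integrates to zero has degree zero.

Tangent vectors of a surface are vectors of the model plane, so a one-form is a function with values
in `Plane →L[ℝ] ℝ` and a two-form is encoded by its value on the standard basis; `rep₁ e` and `rep₂ e`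
are their coordinate expressions in a chart `e`. In these terms:

* On an oriented Riemannian surface, a positive chart `e` has an orthonormal coframe
  `ε = coframe g e`, a `ℂ`-valued one-form, with the structure equations `dε = -i θ ∧ ε`
  (`curl_coframe`) and `dθ = -K dA` (`curl_connForm`), where `θ = connForm g e` is expressed by the
  Christoffel symbols. Another positive chart multiplies `ε` by a unit complex function `z` and
  subtracts `Im (dz / z)` from `θ` (`pull_coframe`, `pull_connForm`).
* The coframes of the two factors pull back to a pair of `ℂ`-valued one-forms on a chart of `S`,
  and their determinant `p` has no zero because `Φ` is a Lagrangian immersion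
  (`complexDet_ne_zero`). The form `Im (dp / p) + φ^* θ₁ + ψ^* θ₂` (`traceForm`) does not depend on
  the coframes, in which the gauge terms cancel (`traceForm_congr`), and under a change of the chart
  of `S` the function `p` is multiplied by a real Jacobian determinant, so that the form transforms
  as a one-form (`traceForm_transition`). This is the global form `primitive`, and `extd_primitive`
  computes its exterior derivative.
* Stokes' theorem is `surfaceIntegral_extd`, proved with a partition of unity.
* For the degree, let the pullback of a positive two-form `η` have integral zero
  (`hasDegree_zero`). Near a point of the target, a two-form with support in a small square is a
  multiple of a fixed one up to an exact form, by the Poincaré lemma with compact supports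
  (`exists_curl_eq`); so the integral of its pullback is a constant times its own integral
  (`exists_local_degree`). The constant is locally constant, hence constant on the connected target,
  and equals zero by the hypothesis on `η`. Over a regular value, a bump form concentrated near that
  value shows that the constant is the number of preimages counted with signs. That there is a
  regular value follows from Sard's theorem in equal dimensions.
-/

noncomputable section

namespace LagrangianDegree

open Set Filter Topology IsManifold MeasureTheory

section

/-! ### Differential forms on the plane -/

/-- The `i`-th standard basis vector of the plane. -/
abbrev stdVec (i : Fin 2) : Plane := EuclideanSpace.single i (1 : ℝ)

theorem eq_add_stdVec (v : Plane) : v = v 0 • stdVec 0 + v 1 • stdVec 1 := by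
  ext i
  fin_cases i <;> simp

theorem det_eq (L : Plane →L[ℝ] Plane) :
    L.det = L (stdVec 0) 0 * L (stdVec 1) 1 - L (stdVec 1) 0 * L (stdVec 0) 1 := by
  rw [ContinuousLinearMap.det,
    ← LinearMap.det_toMatrix (EuclideanSpace.basisFun (Fin 2) ℝ).toBasis, Matrix.det_fin_two]
  simp [LinearMap.toMatrix_apply]

theorem det_comp (L L' : Plane →L[ℝ] Plane) : (L.comp L').det = L.det * L'.det := by
  simp [ContinuousLinearMap.det]

theorem det_id : (ContinuousLinearMap.id ℝ Plane).det = 1 := by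
  simp [ContinuousLinearMap.det]

theorem continuous_det : Continuous fun L : Plane →L[ℝ] Plane ↦ L.det := by
  simp only [det_eq]
  fun_prop

variable {F : Type*} [NormedAddCommGroup F] [NormedSpace ℝ F]

/-- An antisymmetric bilinear form on the plane is multiplied by the determinant when it is pulled
back by a linear map. -/
theorem antisymm_comp (B : Plane →L[ℝ] Plane →L[ℝ] F) (L : Plane →L[ℝ] Plane) :
    B (L (stdVec 0)) (L (stdVec 1)) - B (L (stdVec 1)) (L (stdVec 0))
      = L.det • (B (stdVec 0) (stdVec 1) - B (stdVec 1) (stdVec 0)) := by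
  rw [det_eq]
  conv_lhs => rw [eq_add_stdVec (L (stdVec 0)), eq_add_stdVec (L (stdVec 1))]
  simp only [map_add, map_smul, add_apply, smul_apply]
  module

/-- The coefficient of `du₀ ∧ du₁` in the exterior derivative of a one-form on the plane. -/
def curl (a : Plane → Plane →L[ℝ] F) (u : Plane) : F :=
  fderiv ℝ a u (stdVec 0) (stdVec 1) - fderiv ℝ a u (stdVec 1) (stdVec 0)

/-- The pullback of a one-form on the plane by a map. -/
def pull (T : Plane → Plane) (a : Plane → Plane →L[ℝ] F) (u : Plane) : Plane →L[ℝ] F :=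
  (a (T u)).comp (fderiv ℝ T u)

theorem curl_congr {a b : Plane → Plane →L[ℝ] F} {u : Plane} (h : a =ᶠ[nhds u] b) :
    curl a u = curl b u := by
  simp only [curl, h.fderiv_eq]

theorem curl_pull {T : Plane → Plane} {a : Plane → Plane →L[ℝ] F} {u : Plane}
    (hT : ContDiffAt ℝ 2 T u) (ha : DifferentiableAt ℝ a (T u)) :
    curl (pull T a) u = (fderiv ℝ T u).det • curl a (T u) := by
  have hT1 : DifferentiableAt ℝ T u := hT.differentiableAt (by norm_num)
  have hT2 : DifferentiableAt ℝ (fderiv ℝ T) u :=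
    (hT.fderiv_right (m := 1) (by norm_num)).differentiableAt (by norm_num)
  have hsymm : IsSymmSndFDerivAt ℝ T u := hT.isSymmSndFDerivAt (by simp)
  have hd : HasFDerivAt (pull T a) _ u :=
    (ha.hasFDerivAt.comp u hT1.hasFDerivAt).clm_comp hT2.hasFDerivAt
  have hs := hsymm (stdVec 0) (stdVec 1)
  rw [curl, hd.fderiv, curl, ← antisymm_comp]
  simp [hs]

theorem contDiffAt_pull {T : Plane → Plane} {a : Plane → Plane →L[ℝ] F} {u : Plane}
    {m n : WithTop ℕ∞} (hT : ContDiffAt ℝ n T u) (ha : ContDiffAt ℝ m a (T u)) (hmn : m + 1 ≤ n) :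
    ContDiffAt ℝ m (pull T a) u :=
  (ha.comp u (hT.of_le (le_self_add.trans hmn))).clm_comp (hT.fderiv_right hmn)

theorem curl_add {a b : Plane → Plane →L[ℝ] F} {u : Plane} (ha : DifferentiableAt ℝ a u)
    (hb : DifferentiableAt ℝ b u) : curl (fun u ↦ a u + b u) u = curl a u + curl b u := by
  simp only [curl, fderiv_fun_add ha hb, add_apply]
  abel

theorem curl_sum {ι : Type*} {s : Finset ι} {a : ι → Plane → Plane →L[ℝ] F} {u : Plane}
    (ha : ∀ i ∈ s, DifferentiableAt ℝ (a i) u) :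
    curl (fun u ↦ ∑ i ∈ s, a i u) u = ∑ i ∈ s, curl (a i) u := by
  simp only [curl, fderiv_fun_sum ha, sum_apply, Finset.sum_sub_distrib]

theorem integral_fderiv_eq_zero {f : Plane → ℝ} (hf : ContDiff ℝ 1 f) (hc : HasCompactSupport f)
    (v : Plane) : ∫ u, fderiv ℝ f u v = 0 := by
  have h := integral_mul_fderiv_eq_neg_fderiv_mul_of_integrable (μ := MeasureTheory.volume)
    (f := fun _ : Plane ↦ (1 : ℝ)) (g := f) (v := v) (by simp)
    (by
      simp only [one_mul]
      exact ((hf.continuous_fderiv (by norm_num)).clm_apply continuous_const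
        ).integrable_of_hasCompactSupport (hc.fderiv_apply (𝕜 := ℝ) v))
    (by simpa using hf.continuous.integrable_of_hasCompactSupport hc)
    (fun _ _ ↦ differentiableAt_const _) (fun _ _ ↦ hf.differentiable (by norm_num) _)
  simpa using h

/-- Stokes' theorem for compactly supported one-forms on the plane. -/
theorem integral_curl_eq_zero {a : Plane → Plane →L[ℝ] ℝ} (ha : ContDiff ℝ 1 a)
    (hc : HasCompactSupport a) : ∫ u, curl a u = 0 := by
  have h (i : Fin 2) : ContDiff ℝ 1 fun u ↦ a u (stdVec i) := by fun_prop
  have hs (i : Fin 2) : HasCompactSupport fun u ↦ a u (stdVec i) :=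
    hc.comp_left (g := fun L : Plane →L[ℝ] ℝ ↦ L (stdVec i)) (by simp)
  have hd (u : Plane) (i : Fin 2) (v : Plane) :
      fderiv ℝ (fun u ↦ a u (stdVec i)) u v = fderiv ℝ a u v (stdVec i) := by
    rw [fderiv_clm_apply (ha.differentiable (by norm_num) u) (differentiableAt_const _)]
    simp
  have hi (i : Fin 2) (v : Plane) :
      MeasureTheory.Integrable fun u ↦ fderiv ℝ (fun u ↦ a u (stdVec i)) u v :=
    (((h i).continuous_fderiv (by norm_num)).clm_apply continuous_const
        ).integrable_of_hasCompactSupport ((hs i).fderiv_apply (𝕜 := ℝ) v)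
  simp only [curl, ← hd]
  rw [MeasureTheory.integral_sub (hi _ _) (hi _ _), integral_fderiv_eq_zero (h _) (hs _),
    integral_fderiv_eq_zero (h _) (hs _), sub_zero]

end

section

/-! ### Differential forms on a surface -/

variable {M N : Type*} [TopologicalSpace M] [ChartedSpace Plane M]
  [TopologicalSpace N] [ChartedSpace Plane N]

/-- The differential of a map between surfaces. All tangent spaces are by definition copies of the
model plane, so that it is an endomorphism of the plane. -/
def mder (f : M → N) (x : M) : Plane →L[ℝ] Plane := mfderiv (𝓡 2) (𝓡 2) f x

/-- A map between surfaces, written in charts. -/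
def inCharts (e : OpenPartialHomeomorph M Plane) (e' : OpenPartialHomeomorph N Plane) (f : M → N) :
    Plane → Plane :=
  e' ∘ f ∘ e.symm

/-- The pullback of a one-form on a surface by a map. -/
def pullback₁ (f : M → N) (β : N → Plane →L[ℝ] ℝ) (x : M) : Plane →L[ℝ] ℝ :=
  (β (f x)).comp (mder f x)

/-- The pullback of a two-form on a surface by a map. A two-form is encoded by its values on the
standard basis of the model plane, which is every tangent space. -/
def pullback₂ (f : M → N) (W : N → ℝ) (x : M) : ℝ :=
  W (f x) * (mder f x).det

/-- A one-form on a surface, written in a chart. -/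
def rep₁ (e : OpenPartialHomeomorph M Plane) (α : M → Plane →L[ℝ] ℝ) (u : Plane) :
    Plane →L[ℝ] ℝ :=
  (α (e.symm u)).comp (mder e.symm u)

/-- The coefficient of a two-form on a surface in a chart. -/
def rep₂ (e : OpenPartialHomeomorph M Plane) (W : M → ℝ) (u : Plane) : ℝ :=
  W (e.symm u) * (mder e.symm u).det

/-- A one-form of class `C¹` on a surface. -/
def IsC1Form (α : M → Plane →L[ℝ] ℝ) : Prop :=
  ∀ e ∈ maximalAtlas (𝓡 2) ∞ M, ∀ u ∈ e.target, ContDiffAt ℝ 1 (rep₁ e α) u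

/-- A continuous two-form on a surface. -/
def IsContForm (W : M → ℝ) : Prop :=
  ∀ e ∈ maximalAtlas (𝓡 2) ∞ M, ContinuousOn (rep₂ e W) e.target

/-- The exterior derivative of a one-form on a surface, computed at each point in the preferred
chart there. -/
def extd (α : M → Plane →L[ℝ] ℝ) (x : M) : ℝ :=
  curl (rep₁ (chartAt Plane x) α) (chartAt Plane x x) * (mder (chartAt Plane x) x).det

theorem mder_id (x : M) : mder (id : M → M) x = ContinuousLinearMap.id ℝ Plane :=
  mfderiv_id

theorem pullback₁_id (α : M → Plane →L[ℝ] ℝ) : pullback₁ id α = α := by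
  ext x : 1
  simp [pullback₁, mder_id]

theorem pullback₂_id (W : M → ℝ) : pullback₂ id W = W := by
  ext x : 1
  simp [pullback₂, mder_id, det_id]

section Charts

variable {e : OpenPartialHomeomorph M Plane} (he : e ∈ maximalAtlas (𝓡 2) ∞ M)
include he

theorem mdifferentiableAt_chart {x : M} (hx : x ∈ e.source) :
    MDifferentiableAt (𝓡 2) (𝓡 2) e x :=
  ((contMDiffOn_of_mem_maximalAtlas he).contMDiffAt (e.open_source.mem_nhds hx)).mdifferentiableAt
    (by simp)

theorem mdifferentiableAt_chart_symm {u : Plane} (hu : u ∈ e.target) :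
    MDifferentiableAt (𝓡 2) (𝓡 2) e.symm u :=
  ((contMDiffOn_symm_of_mem_maximalAtlas he).contMDiffAt
    (e.open_target.mem_nhds hu)).mdifferentiableAt (by simp)

theorem mder_symm_comp_mder {x : M} (hx : x ∈ e.source) :
    (mder e.symm (e x)).comp (mder e x) = ContinuousLinearMap.id ℝ Plane := by
  have h := mfderiv_comp x (mdifferentiableAt_chart_symm he (e.map_source hx))
    (mdifferentiableAt_chart he hx)
  have h2 : mfderiv (𝓡 2) (𝓡 2) (e.symm ∘ e) x = ContinuousLinearMap.id ℝ _ := by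
    rw [← mfderiv_id]
    exact Filter.EventuallyEq.mfderiv_eq (e.eventually_left_inverse hx)
  exact h.symm.trans h2

theorem mder_comp_mder_symm {u : Plane} (hu : u ∈ e.target) :
    (mder e (e.symm u)).comp (mder e.symm u) = ContinuousLinearMap.id ℝ Plane := by
  have h := mfderiv_comp u (mdifferentiableAt_chart he (e.map_target hu))
    (mdifferentiableAt_chart_symm he hu)
  have h2 : mfderiv (𝓡 2) (𝓡 2) (e ∘ e.symm) u = ContinuousLinearMap.id ℝ _ := by
    rw [← mfderiv_id]
    exact Filter.EventuallyEq.mfderiv_eq (e.eventually_right_inverse hu)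
  exact h.symm.trans h2

theorem det_mder_symm_ne_zero {u : Plane} (hu : u ∈ e.target) : (mder e.symm u).det ≠ 0 := by
  have h := congrArg ContinuousLinearMap.det (mder_comp_mder_symm he hu)
  rw [det_comp, det_id] at h
  exact right_ne_zero_of_mul_eq_one h

variable {e' : OpenPartialHomeomorph N Plane} (he' : e' ∈ maximalAtlas (𝓡 2) ∞ N) {f : M → N}
  (hf : ContMDiff (𝓡 2) (𝓡 2) ∞ f)
include he' hf

theorem contDiffAt_inCharts {u : Plane} (hu : u ∈ e.target) (hu' : f (e.symm u) ∈ e'.source) :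
    ContDiffAt ℝ ∞ (inCharts e e' f) u := by
  rw [← contMDiffAt_iff_contDiffAt]
  exact ((contMDiffOn_of_mem_maximalAtlas he').contMDiffAt (e'.open_source.mem_nhds hu')).comp u
    ((hf _).comp u ((contMDiffOn_symm_of_mem_maximalAtlas he).contMDiffAt
      (e.open_target.mem_nhds hu)))

omit he he' in
theorem eventually_mem_charts {u : Plane} (hu : u ∈ e.target) (hu' : f (e.symm u) ∈ e'.source) :
    ∀ᶠ v in 𝓝 u, v ∈ e.target ∧ f (e.symm v) ∈ e'.source :=
  Filter.Eventually.and (e.open_target.mem_nhds hu)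
    ((hf.continuous.continuousAt.comp (e.continuousAt_symm hu)).preimage_mem_nhds
      (e'.open_source.mem_nhds hu'))

theorem fderiv_inCharts {u : Plane} (hu : u ∈ e.target) (hu' : f (e.symm u) ∈ e'.source) :
    fderiv ℝ (inCharts e e' f) u
      = (mder e' (f (e.symm u))).comp ((mder f (e.symm u)).comp (mder e.symm u)) := by
  rw [← mfderiv_eq_fderiv]
  have hf' : MDifferentiableAt (𝓡 2) (𝓡 2) f (e.symm u) := (hf _).mdifferentiableAt (by simp)
  have h1 := mdifferentiableAt_chart_symm he hu
  have h2 := mfderiv_comp u (mdifferentiableAt_chart he' hu') (hf'.comp u h1)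
  have h3 := mfderiv_comp u hf' h1
  rw [h3] at h2
  exact h2

theorem mder_symm_comp_fderiv_inCharts {u : Plane} (hu : u ∈ e.target)
    (hu' : f (e.symm u) ∈ e'.source) :
    (mder e'.symm (inCharts e e' f u)).comp (fderiv ℝ (inCharts e e' f) u)
      = (mder f (e.symm u)).comp (mder e.symm u) := by
  have h := mder_symm_comp_mder he' hu'
  rw [fderiv_inCharts he he' hf hu hu', ← ContinuousLinearMap.comp_assoc]
  change ((mder e'.symm (e' (f (e.symm u)))).comp _).comp _ = _
  rw [h, ContinuousLinearMap.id_comp]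

theorem rep₁_pullback₁ (β : N → Plane →L[ℝ] ℝ) {u : Plane} (hu : u ∈ e.target)
    (hu' : f (e.symm u) ∈ e'.source) :
    rep₁ e (pullback₁ f β) u = pull (inCharts e e' f) (rep₁ e' β) u := by
  have h := mder_symm_comp_fderiv_inCharts he he' hf hu hu'
  have h2 : e'.symm (inCharts e e' f u) = f (e.symm u) := e'.left_inv hu'
  rw [pull, rep₁, rep₁, ContinuousLinearMap.comp_assoc, h, h2]
  rfl

theorem rep₂_pullback₂ (W : N → ℝ) {u : Plane} (hu : u ∈ e.target)
    (hu' : f (e.symm u) ∈ e'.source) :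
    rep₂ e (pullback₂ f W) u
      = (fderiv ℝ (inCharts e e' f) u).det * rep₂ e' W (inCharts e e' f u) := by
  have h := congrArg ContinuousLinearMap.det (mder_symm_comp_fderiv_inCharts he he' hf hu hu')
  have h2 : e'.symm (inCharts e e' f u) = f (e.symm u) := e'.left_inv hu'
  rw [det_comp, det_comp] at h
  rw [rep₂, pullback₂, rep₂, h2, mul_assoc, ← h]
  ring

theorem rep₁_pullback₁_eventuallyEq (β : N → Plane →L[ℝ] ℝ) {u : Plane} (hu : u ∈ e.target)
    (hu' : f (e.symm u) ∈ e'.source) :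
    rep₁ e (pullback₁ f β) =ᶠ[𝓝 u] pull (inCharts e e' f) (rep₁ e' β) := by
  filter_upwards [eventually_mem_charts hf hu hu'] with v hv
  exact rep₁_pullback₁ he he' hf β hv.1 hv.2

end Charts

section Transition

variable {e e' : OpenPartialHomeomorph M Plane} (he : e ∈ maximalAtlas (𝓡 2) ∞ M)
  (he' : e' ∈ maximalAtlas (𝓡 2) ∞ M)
include he he'

theorem rep₁_transition (α : M → Plane →L[ℝ] ℝ) {u : Plane} (hu : u ∈ e.target)
    (hu' : e.symm u ∈ e'.source) :
    rep₁ e α =ᶠ[𝓝 u] pull (inCharts e e' id) (rep₁ e' α) := by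
  have h := rep₁_pullback₁_eventuallyEq he he' contMDiff_id α hu hu'
  rwa [pullback₁_id] at h

theorem rep₂_transition (W : M → ℝ) {u : Plane} (hu : u ∈ e.target)
    (hu' : e.symm u ∈ e'.source) :
    rep₂ e W u = (fderiv ℝ (inCharts e e' id) u).det * rep₂ e' W (inCharts e e' id u) := by
  have h := rep₂_pullback₂ he he' contMDiff_id W hu hu'
  rwa [pullback₂_id] at h

end Transition

theorem isC1Form_of_local {α : M → Plane →L[ℝ] ℝ}
    (h : ∀ x, ∃ e ∈ maximalAtlas (𝓡 2) ∞ M, x ∈ e.source ∧ ContDiffAt ℝ 1 (rep₁ e α) (e x)) :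
    IsC1Form α := by
  intro e he u hu
  obtain ⟨e', he', hx, hc⟩ := h (e.symm u)
  refine ContDiffAt.congr_of_eventuallyEq ?_ (rep₁_transition he he' α hu hx)
  exact contDiffAt_pull (contDiffAt_inCharts he he' contMDiff_id hu hx) hc (by norm_cast)

theorem isContForm_of_local {W : M → ℝ}
    (h : ∀ x, ∃ e ∈ maximalAtlas (𝓡 2) ∞ M, x ∈ e.source ∧ ContinuousAt (rep₂ e W) (e x)) :
    IsContForm W := by
  intro e he u hu
  obtain ⟨e', he', hx, hc⟩ := h (e.symm u)
  refine ContinuousAt.continuousWithinAt ?_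
  have hT := contDiffAt_inCharts he he' contMDiff_id hu hx
  have hev : rep₂ e W =ᶠ[𝓝 u] fun v ↦
      (fderiv ℝ (inCharts e e' id) v).det * rep₂ e' W (inCharts e e' id v) := by
    filter_upwards [eventually_mem_charts contMDiff_id hu hx] with v hv
    exact rep₂_transition he he' W hv.1 hv.2
  refine ContinuousAt.congr ?_ hev.symm
  refine ContinuousAt.mul ?_ (ContinuousAt.comp (f := inCharts e e' id) hc hT.continuousAt)
  exact continuous_det.continuousAt.comp (hT.continuousAt_fderiv (by simp))

theorem eq_of_rep₂_eq {W W' : M → ℝ} {x : M} {e : OpenPartialHomeomorph M Plane}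
    (he : e ∈ maximalAtlas (𝓡 2) ∞ M) (hx : x ∈ e.source)
    (h : rep₂ e W (e x) = rep₂ e W' (e x)) : W x = W' x := by
  simp only [rep₂, e.left_inv hx] at h
  exact mul_right_cancel₀ (det_mder_symm_ne_zero he (e.map_source hx)) h

variable [IsManifold (𝓡 2) ∞ M] [IsManifold (𝓡 2) ∞ N]

/-- The exterior derivative may be computed in any chart. -/
theorem rep₂_extd {α : M → Plane →L[ℝ] ℝ} (hα : IsC1Form α) {e : OpenPartialHomeomorph M Plane}
    (he : e ∈ maximalAtlas (𝓡 2) ∞ M) {u : Plane} (hu : u ∈ e.target) :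
    rep₂ e (extd α) u = curl (rep₁ e α) u := by
  set x := e.symm u with hx
  set e' := chartAt Plane x
  have he' : e' ∈ maximalAtlas (𝓡 2) ∞ M := chart_mem_maximalAtlas x
  have hxe : x ∈ e'.source := mem_chart_source Plane x
  have hT := contDiffAt_inCharts he he' contMDiff_id hu hxe
  rw [curl_congr (rep₁_transition he he' α hu hxe), curl_pull (hT.of_le (by norm_cast))
    ((hα e' he' _ (e'.map_source hxe)).differentiableAt (by norm_num)),
    fderiv_inCharts he he' contMDiff_id hu hxe, mder_id, ContinuousLinearMap.id_comp, det_comp,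
    rep₂, extd]
  change curl (rep₁ e' α) (e' x) * (mder e' x).det * _ = _ • curl (rep₁ e' α) (e' x)
  rw [smul_eq_mul, id, ← hx]
  ring

theorem isContForm_extd {α : M → Plane →L[ℝ] ℝ} (hα : IsC1Form α) : IsContForm (extd α) := by
  intro e he
  have h : ContinuousOn (curl (rep₁ e α)) e.target := by
    intro u hu
    have := ((hα e he u hu).continuousAt_fderiv (by norm_num))
    exact (((this.clm_apply continuousAt_const).clm_apply continuousAt_const).sub
      ((this.clm_apply continuousAt_const).clm_apply continuousAt_const)).continuousWithinAt
  exact h.congr fun u hu ↦ rep₂_extd hα he hu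

theorem isC1Form_pullback₁ {f : M → N} (hf : ContMDiff (𝓡 2) (𝓡 2) ∞ f) {β : N → Plane →L[ℝ] ℝ}
    (hβ : IsC1Form β) : IsC1Form (pullback₁ f β) := by
  refine isC1Form_of_local fun x ↦ ⟨chartAt Plane x, chart_mem_maximalAtlas x,
    mem_chart_source Plane x, ?_⟩
  set e := chartAt Plane x
  have he : e ∈ maximalAtlas (𝓡 2) ∞ M := chart_mem_maximalAtlas x
  have hu : e x ∈ e.target := e.map_source (mem_chart_source Plane x)
  set e' := chartAt Plane (f x)
  have he' : e' ∈ maximalAtlas (𝓡 2) ∞ N := chart_mem_maximalAtlas _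
  have hx : e.symm (e x) = x := e.left_inv (mem_chart_source Plane x)
  have hu' : f (e.symm (e x)) ∈ e'.source := by rw [hx]; exact mem_chart_source Plane _
  refine ContDiffAt.congr_of_eventuallyEq ?_ (rep₁_pullback₁_eventuallyEq he he' hf β hu hu')
  exact contDiffAt_pull (contDiffAt_inCharts he he' hf hu hu')
    (hβ e' he' _ (e'.map_source hu')) (by norm_cast)

theorem extd_pullback₁ {f : M → N} (hf : ContMDiff (𝓡 2) (𝓡 2) ∞ f) {β : N → Plane →L[ℝ] ℝ}
    (hβ : IsC1Form β) : extd (pullback₁ f β) = pullback₂ f (extd β) := by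
  ext x
  set e := chartAt Plane x
  have he : e ∈ maximalAtlas (𝓡 2) ∞ M := chart_mem_maximalAtlas x
  have hu : e x ∈ e.target := e.map_source (mem_chart_source Plane x)
  set e' := chartAt Plane (f x)
  have he' : e' ∈ maximalAtlas (𝓡 2) ∞ N := chart_mem_maximalAtlas _
  have hx : e.symm (e x) = x := e.left_inv (mem_chart_source Plane x)
  have hu' : f (e.symm (e x)) ∈ e'.source := by rw [hx]; exact mem_chart_source Plane _
  have hT := contDiffAt_inCharts he he' hf hu hu'
  refine eq_of_rep₂_eq he (mem_chart_source Plane x) ?_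
  have ht : inCharts e e' f (e x) ∈ e'.target := e'.map_source hu'
  rw [rep₂_extd (isC1Form_pullback₁ hf hβ) he hu,
    curl_congr (rep₁_pullback₁_eventuallyEq he he' hf β hu hu'),
    curl_pull (hT.of_le (by norm_cast)) ((hβ e' he' _ ht).differentiableAt (by norm_num)),
    rep₂_pullback₂ he he' hf _ hu hu', rep₂_extd hβ he' ht, smul_eq_mul]

theorem isContForm_pullback₂ {f : M → N} (hf : ContMDiff (𝓡 2) (𝓡 2) ∞ f) {W : N → ℝ}
    (hW : IsContForm W) : IsContForm (pullback₂ f W) := by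
  refine isContForm_of_local fun x ↦ ⟨chartAt Plane x, chart_mem_maximalAtlas x,
    mem_chart_source Plane x, ?_⟩
  set e := chartAt Plane x
  have he : e ∈ maximalAtlas (𝓡 2) ∞ M := chart_mem_maximalAtlas x
  have hu : e x ∈ e.target := e.map_source (mem_chart_source Plane x)
  set e' := chartAt Plane (f x)
  have he' : e' ∈ maximalAtlas (𝓡 2) ∞ N := chart_mem_maximalAtlas _
  have hx : e.symm (e x) = x := e.left_inv (mem_chart_source Plane x)
  have hu' : f (e.symm (e x)) ∈ e'.source := by rw [hx]; exact mem_chart_source Plane _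
  have hT := contDiffAt_inCharts he he' hf hu hu'
  have hev : rep₂ e (pullback₂ f W) =ᶠ[𝓝 (e x)] fun v ↦
      (fderiv ℝ (inCharts e e' f) v).det * rep₂ e' W (inCharts e e' f v) := by
    filter_upwards [eventually_mem_charts hf hu hu'] with v hv
    exact rep₂_pullback₂ he he' hf W hv.1 hv.2
  refine ContinuousAt.congr ?_ hev.symm
  have hc : ContinuousAt (rep₂ e' W) (inCharts e e' f (e x)) :=
    (hW e' he').continuousAt (e'.open_target.mem_nhds (e'.map_source hu'))
  refine ContinuousAt.mul ?_ (ContinuousAt.comp (f := inCharts e e' f) hc hT.continuousAt)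
  exact continuous_det.continuousAt.comp (hT.continuousAt_fderiv (by simp))

end

section

/-! ### Positive charts and integration of two-forms -/

theorem orientationSign_comp (o : Orientation ℝ Plane (Fin 2)) (L : Plane →L[ℝ] Plane)
    (v w : Plane) :
    orientationSign o (L v) (L w) = SignType.sign L.det * orientationSign o v w := by
  set b := (EuclideanSpace.basisFun (Fin 2) ℝ).toBasis
  have h : Module.Ray.someVector o = Module.Ray.someVector o b • b.det :=
    AlternatingMap.eq_smul_basis_det b _
  have h2 : (![L v, L w] : Fin 2 → Plane) = (L : Plane →ₗ[ℝ] Plane) ∘ ![v, w] := by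
    ext i : 1
    fin_cases i <;> rfl
  unfold orientationSign
  rw [h, h2, ← sign_mul]
  simp only [AlternatingMap.smul_apply, smul_eq_mul, Module.Basis.det_comp]
  rw [ContinuousLinearMap.det]
  congr 1
  ring

theorem orientationSign_ne_zero (o : Orientation ℝ Plane (Fin 2)) :
    orientationSign o (stdVec 0) (stdVec 1) ≠ 0 := by
  set b := (EuclideanSpace.basisFun (Fin 2) ℝ).toBasis
  have h : Module.Ray.someVector o = Module.Ray.someVector o b • b.det :=
    AlternatingMap.eq_smul_basis_det b _
  have h2 : (b : Fin 2 → Plane) = ![stdVec 0, stdVec 1] := by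
    ext i : 1
    fin_cases i <;> simp [b]
  unfold orientationSign
  rw [sign_ne_zero, ← h2]
  intro h3
  exact Module.Ray.someVector_ne_zero o (by rw [h, h3, zero_smul])

variable {M : Type*} [TopologicalSpace M] [ChartedSpace Plane M]

/-- The sign of the standard basis of the tangent plane at a point. -/
def stdSign (o : SurfaceOrientation M) (x : M) : SignType :=
  orientationSign (V := Plane) (o.orient x) (stdVec 0) (stdVec 1)

theorem stdSign_ne_zero (o : SurfaceOrientation M) (x : M) : stdSign o x ≠ 0 :=
  orientationSign_ne_zero _

/-- A smooth chart whose coordinate frame is everywhere positive. -/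
structure IsPositiveChart (o : SurfaceOrientation M) (e : OpenPartialHomeomorph M Plane) :
    Prop where
  mem : e ∈ maximalAtlas (𝓡 2) ∞ M
  sign_eq (u : Plane) : u ∈ e.target →
    SignType.sign (mder e.symm u).det * stdSign o (e.symm u) = 1

/-- A positive chart around a point. -/
def posChart (o : SurfaceOrientation M) (x : M) : OpenPartialHomeomorph M Plane :=
  (o.exists_positive_chart x).choose

theorem mem_posChart (o : SurfaceOrientation M) (x : M) : x ∈ (posChart o x).source :=
  (o.exists_positive_chart x).choose_spec.2.1

theorem isPositiveChart_posChart (o : SurfaceOrientation M) (x : M) :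
    IsPositiveChart o (posChart o x) := by
  obtain ⟨h1, -, h3⟩ := (o.exists_positive_chart x).choose_spec
  refine ⟨h1, fun u hu ↦ ?_⟩
  exact (orientationSign_comp (o.orient _) _ _ _).symm.trans (h3 u hu)

theorem signType_mul_self {s : SignType} (h : s ≠ 0) : s * s = 1 := by
  revert h
  cases s <;> decide

section Sign

variable {N : Type*} [TopologicalSpace N] [ChartedSpace Plane N]
  {o : SurfaceOrientation M} {o' : SurfaceOrientation N}
  {e : OpenPartialHomeomorph M Plane} {e' : OpenPartialHomeomorph N Plane}

theorem IsPositiveChart.sign_det (he : IsPositiveChart o e) {u : Plane} (hu : u ∈ e.target) :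
    SignType.sign (mder e.symm u).det = stdSign o (e.symm u) := by
  have h := he.sign_eq u hu
  have h2 := signType_mul_self (stdSign_ne_zero o (e.symm u))
  calc _ = SignType.sign (mder e.symm u).det * (stdSign o (e.symm u) * stdSign o (e.symm u)) := by
        rw [h2, mul_one]
    _ = _ := by rw [← mul_assoc, h, one_mul]

/-- In positive charts, the sign of the Jacobian determinant of a map is the sign of its
differential with respect to the orientations. -/
theorem IsPositiveChart.sign_det_fderiv (he : IsPositiveChart o e) (he' : IsPositiveChart o' e')
    {f : M → N} (hf : ContMDiff (𝓡 2) (𝓡 2) ∞ f) {u : Plane} (hu : u ∈ e.target)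
    (hu' : f (e.symm u) ∈ e'.source) :
    SignType.sign (fderiv ℝ (inCharts e e' f) u).det
      = stdSign o' (f (e.symm u)) * SignType.sign (mder f (e.symm u)).det
        * stdSign o (e.symm u) := by
  have h := congrArg ContinuousLinearMap.det
    (mder_symm_comp_fderiv_inCharts he.mem he'.mem hf hu hu')
  have h2 := congrArg SignType.sign h
  have ht : inCharts e e' f u ∈ e'.target := e'.map_source hu'
  have hx : e'.symm (inCharts e e' f u) = f (e.symm u) := e'.left_inv hu'
  rw [det_comp, det_comp, sign_mul, sign_mul, he.sign_det hu, he'.sign_det ht, hx] at h2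
  rw [mul_assoc, ← h2, ← mul_assoc, signType_mul_self (stdSign_ne_zero _ _), one_mul]

theorem IsPositiveChart.det_transition_pos {e e' : OpenPartialHomeomorph M Plane}
    (he : IsPositiveChart o e) (he' : IsPositiveChart o e') {u : Plane} (hu : u ∈ e.target)
    (hu' : e.symm u ∈ e'.source) : 0 < (fderiv ℝ (inCharts e e' id) u).det := by
  have h := he.sign_det_fderiv he' contMDiff_id hu hu'
  rw [mder_id, det_id, id, sign_one, mul_one, signType_mul_self (stdSign_ne_zero _ _)] at h
  exact sign_eq_one_iff.1 h

end Sign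

section Integral

/-- Change of variables: the integral of a two-form does not depend on the positive chart in which
it is computed. -/
theorem setIntegral_rep₂_eq {o : SurfaceOrientation M} {e e' : OpenPartialHomeomorph M Plane}
    (he : IsPositiveChart o e) (he' : IsPositiveChart o e') {W : M → ℝ}
    (hW : ∀ x, W x ≠ 0 → x ∈ e.source ∧ x ∈ e'.source) :
    ∫ u in e.target, rep₂ e W u = ∫ u in e'.target, rep₂ e' W u := by
  set A : Set Plane := e.target ∩ e.symm ⁻¹' e'.source
  set A' : Set Plane := e'.target ∩ e'.symm ⁻¹' e.source
  have hA : IsOpen A := e.isOpen_inter_preimage_symm e'.open_source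
  have h1 : ∫ u in e.target, rep₂ e W u = ∫ u in A, rep₂ e W u := by
    refine (setIntegral_eq_of_subset_of_forall_sdiff_eq_zero e.open_target.measurableSet
      inter_subset_left fun u hu ↦ ?_)
    by_contra h
    exact hu.2 ⟨hu.1, (hW _ (left_ne_zero_of_mul h)).2⟩
  have h2 : ∫ u in e'.target, rep₂ e' W u = ∫ u in A', rep₂ e' W u := by
    refine (setIntegral_eq_of_subset_of_forall_sdiff_eq_zero e'.open_target.measurableSet
      inter_subset_left fun u hu ↦ ?_)
    by_contra h
    exact hu.2 ⟨hu.1, (hW _ (left_ne_zero_of_mul h)).1⟩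
  have h3 : inCharts e e' id '' A = A' := by
    ext v
    constructor
    · rintro ⟨u, hu, rfl⟩
      refine ⟨e'.map_source hu.2, ?_⟩
      change e'.symm (e' (e.symm u)) ∈ e.source
      rw [e'.left_inv hu.2]
      exact e.map_target hu.1
    · intro hv
      refine ⟨e (e'.symm v), ⟨e.map_source hv.2, ?_⟩, ?_⟩
      · change e.symm (e (e'.symm v)) ∈ e'.source
        rw [e.left_inv hv.2]
        exact e'.map_target hv.1
      · change e' (e.symm (e (e'.symm v))) = v
        rw [e.left_inv hv.2, e'.right_inv hv.1]
  have h4 : InjOn (inCharts e e' id) A := by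
    intro u hu v hv huv
    exact e.symm.injOn hu.1 hv.1 (e'.injOn hu.2 hv.2 huv)
  rw [h1, h2, ← h3, integral_image_eq_integral_abs_det_fderiv_smul _ hA.measurableSet
    (f' := fderiv ℝ (inCharts e e' id)) _ h4]
  · refine setIntegral_congr_fun hA.measurableSet fun u hu ↦ ?_
    rw [rep₂_transition he.mem he'.mem W hu.1 hu.2, smul_eq_mul,
      abs_of_pos (he.det_transition_pos he' hu.1 hu.2)]
  · intro u hu
    exact ((contDiffAt_inCharts he.mem he'.mem contMDiff_id hu.1 hu.2).differentiableAt
      (by simp)).hasFDerivAt.hasFDerivWithinAt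

theorem integrableOn_rep₂ {e : OpenPartialHomeomorph M Plane}
    (he : e ∈ maximalAtlas (𝓡 2) ∞ M) {W : M → ℝ} (hW : IsContForm W) {K : Set M}
    (hK : IsCompact K) (hKe : K ⊆ e.source) (hWK : ∀ x, W x ≠ 0 → x ∈ K) :
    IntegrableOn (rep₂ e W) e.target := by
  have hK' : IsCompact (e '' K) := hK.image_of_continuousOn (e.continuousOn.mono hKe)
  have hsub : e '' K ⊆ e.target := by
    rintro _ ⟨x, hx, rfl⟩
    exact e.map_source (hKe hx)
  have h := ((hW e he).mono hsub).integrableOn_compact hK' (μ := volume)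
  refine h.of_forall_sdiff_eq_zero e.open_target.measurableSet fun u hu ↦ ?_
  by_contra h0
  exact hu.2 ⟨e.symm u, hWK _ (left_ne_zero_of_mul h0), e.right_inv hu.1⟩

theorem rep₂_mul (e : OpenPartialHomeomorph M Plane) (ρ W : M → ℝ) (u : Plane) :
    rep₂ e (fun x ↦ ρ x * W x) u = ρ (e.symm u) * rep₂ e W u := by
  simp [rep₂, mul_assoc]

theorem IsContForm.mul {ρ : M → ℝ} (hρ : Continuous ρ) {W : M → ℝ} (hW : IsContForm W) :
    IsContForm fun x ↦ ρ x * W x := fun e he ↦ by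
  simp only [funext (rep₂_mul e ρ W)]
  exact (hρ.comp_continuousOn e.continuousOn_symm).mul (hW e he)

theorem rep₂_sum {ι : Type*} (s : Finset ι) (e : OpenPartialHomeomorph M Plane) (W : ι → M → ℝ)
    (u : Plane) : rep₂ e (fun x ↦ ∑ i ∈ s, W i x) u = ∑ i ∈ s, rep₂ e (W i) u := by
  simp [rep₂, Finset.sum_mul]

theorem rep₁_smul (e : OpenPartialHomeomorph M Plane) (ρ : M → ℝ) (α : M → Plane →L[ℝ] ℝ)
    (u : Plane) : rep₁ e (fun x ↦ ρ x • α x) u = ρ (e.symm u) • rep₁ e α u := by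
  simp [rep₁]

theorem contDiffAt_comp_symm {e : OpenPartialHomeomorph M Plane}
    (he : e ∈ maximalAtlas (𝓡 2) ∞ M) {ρ : M → ℝ} (hρ : ContMDiff (𝓡 2) 𝓘(ℝ, ℝ) ∞ ρ) {u : Plane}
    (hu : u ∈ e.target) : ContDiffAt ℝ ∞ (fun u ↦ ρ (e.symm u)) u := by
  rw [← contMDiffAt_iff_contDiffAt]
  exact (hρ _).comp u ((contMDiffOn_symm_of_mem_maximalAtlas he).contMDiffAt
      (e.open_target.mem_nhds hu))

theorem IsC1Form.smul {ρ : M → ℝ} (hρ : ContMDiff (𝓡 2) 𝓘(ℝ, ℝ) ∞ ρ) {α : M → Plane →L[ℝ] ℝ}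
    (hα : IsC1Form α) : IsC1Form fun x ↦ ρ x • α x := fun e he u hu ↦ by
  simp only [funext (rep₁_smul e ρ α)]
  exact ((contDiffAt_comp_symm he hρ hu).of_le (by norm_cast)).smul (hα e he u hu)

theorem rep₁_eventuallyEq_zero {α : M → Plane →L[ℝ] ℝ} {x : M} (h : ∀ᶠ y in 𝓝 x, α y = 0)
    {e : OpenPartialHomeomorph M Plane} (hx : x ∈ e.source) : rep₁ e α =ᶠ[𝓝 (e x)] fun _ ↦ 0 := by
  have hc := e.continuousAt_symm (e.map_source hx)
  rw [ContinuousAt, e.left_inv hx] at hc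
  filter_upwards [hc.eventually h] with v hv
  rw [rep₁, hv, ContinuousLinearMap.zero_comp]

theorem extd_eq_zero_of_eventually {α : M → Plane →L[ℝ] ℝ} {x : M}
    (h : ∀ᶠ y in 𝓝 x, α y = 0) : extd α x = 0 := by
  rw [extd, curl_congr (rep₁_eventuallyEq_zero h (mem_chart_source Plane x))]
  simp [curl]

variable [IsManifold (𝓡 2) ∞ M] [T2Space M] [CompactSpace M]

/-- On a compact surface, every cover by open neighbourhoods of the points has a finite smooth
partition of unity subordinate to it. -/
theorem exists_finite_partition (U : M → Set M) (hU : ∀ x, IsOpen (U x)) (hx : ∀ x, x ∈ U x) :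
    ∃ (s : Finset M) (ρ : M → M → ℝ), (∀ x, ContMDiff (𝓡 2) 𝓘(ℝ, ℝ) ∞ (ρ x)) ∧
      (∀ x, tsupport (ρ x) ⊆ U x) ∧ (∀ x y, 0 ≤ ρ x y) ∧ ∀ y, ∑ x ∈ s, ρ x y = 1 := by
  obtain ⟨ρ, hρ⟩ := SmoothPartitionOfUnity.exists_isSubordinate (𝓡 2) (s := univ) isClosed_univ U
    hU fun x _ ↦ mem_iUnion.2 ⟨x, hx x⟩
  have hfin := ρ.locallyFinite.finite_nonempty_of_compact
  refine ⟨hfin.toFinset, fun x ↦ ρ x, fun x ↦ (ρ x).contMDiff, hρ, fun x y ↦ ρ.nonneg x y,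
    fun y ↦ ?_⟩
  rw [← ρ.sum_eq_one (mem_univ y)]
  refine (finsum_eq_sum_of_support_subset _ fun x h ↦ ?_).symm
  simp only [Finite.coe_toFinset, mem_ofPred_eq]
  exact ⟨y, h⟩

/-- The index set of a finite partition of unity subordinate to the positive charts `posChart`. -/
def partIndex (o : SurfaceOrientation M) : Finset M :=
  (exists_finite_partition (fun x ↦ (posChart o x).source) (fun x ↦ (posChart o x).open_source)
    (mem_posChart o)).choose

/-- A finite partition of unity subordinate to the positive charts `posChart`. -/
def part (o : SurfaceOrientation M) : M → M → ℝ :=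
  (exists_finite_partition (fun x ↦ (posChart o x).source) (fun x ↦ (posChart o x).open_source)
    (mem_posChart o)).choose_spec.choose

theorem part_spec (o : SurfaceOrientation M) :
    (∀ x, ContMDiff (𝓡 2) 𝓘(ℝ, ℝ) ∞ (part o x)) ∧
      (∀ x, tsupport (part o x) ⊆ (posChart o x).source) ∧ (∀ x y, 0 ≤ part o x y) ∧
      ∀ y, ∑ x ∈ partIndex o, part o x y = 1 :=
  (exists_finite_partition (fun x ↦ (posChart o x).source) (fun x ↦ (posChart o x).open_source)
    (mem_posChart o)).choose_spec.choose_spec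

/-- The integral of a two-form over a compact oriented surface, computed with a partition of
unity. -/
def surfaceIntegral (o : SurfaceOrientation M) (W : M → ℝ) : ℝ :=
  ∑ x ∈ partIndex o,
    ∫ u in (posChart o x).target, rep₂ (posChart o x) (fun y ↦ part o x y * W y) u

theorem surfaceIntegral_sum (o : SurfaceOrientation M) {ι : Type*} (s : Finset ι) {W : ι → M → ℝ}
    (hW : ∀ i ∈ s, IsContForm (W i)) :
    surfaceIntegral o (fun x ↦ ∑ i ∈ s, W i x) = ∑ i ∈ s, surfaceIntegral o (W i) := by
  obtain ⟨h1, h2, -, -⟩ := part_spec o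
  simp only [surfaceIntegral]
  rw [Finset.sum_comm]
  refine Finset.sum_congr rfl fun x _ ↦ ?_
  simp only [Finset.mul_sum, rep₂_sum]
  refine integral_finsetSum s fun i hi ↦ ?_
  refine integrableOn_rep₂ (isPositiveChart_posChart o x).mem ((hW i hi).mul (h1 x).continuous)
    (isClosed_tsupport (part o x)).isCompact (h2 x) fun y hy ↦ ?_
  exact subset_tsupport _ (left_ne_zero_of_mul hy)

theorem surfaceIntegral_const_mul (o : SurfaceOrientation M) (c : ℝ) (W : M → ℝ) :
    surfaceIntegral o (fun x ↦ c * W x) = c * surfaceIntegral o W := by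
  simp only [surfaceIntegral, Finset.mul_sum]
  refine Finset.sum_congr rfl fun x _ ↦ ?_
  rw [← integral_const_mul]
  congr 1
  ext u
  simp only [rep₂]
  ring

theorem surfaceIntegral_eq_setIntegral {o : SurfaceOrientation M}
    {e : OpenPartialHomeomorph M Plane} (he : IsPositiveChart o e) {W : M → ℝ}
    (hW : IsContForm W) {K : Set M} (hK : IsCompact K) (hKe : K ⊆ e.source)
    (hWK : ∀ x, W x ≠ 0 → x ∈ K) :
    surfaceIntegral o W = ∫ u in e.target, rep₂ e W u := by
  obtain ⟨h1, h2, -, h4⟩ := part_spec o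
  have h (x : M) : ∫ u in (posChart o x).target, rep₂ (posChart o x) (fun y ↦ part o x y * W y) u
      = ∫ u in e.target, rep₂ e (fun y ↦ part o x y * W y) u := by
    refine setIntegral_rep₂_eq (isPositiveChart_posChart o x) he fun y hy ↦ ⟨?_, ?_⟩
    · exact h2 x (subset_tsupport _ (left_ne_zero_of_mul hy))
    · exact hKe (hWK _ (right_ne_zero_of_mul hy))
  simp only [surfaceIntegral, h]
  rw [← integral_finsetSum]
  · congr 1
    ext u
    rw [← rep₂_sum]
    simp only [← Finset.sum_mul, h4, one_mul]
  · intro x _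
    exact integrableOn_rep₂ he.mem (hW.mul (h1 x).continuous) hK hKe
      fun y hy ↦ hWK _ (right_ne_zero_of_mul hy)

/-- Stokes' theorem for a one-form supported in a chart. -/
theorem surfaceIntegral_extd_eq_zero_of_support {o : SurfaceOrientation M}
    {e : OpenPartialHomeomorph M Plane} (he : IsPositiveChart o e) {α : M → Plane →L[ℝ] ℝ}
    (hα : IsC1Form α) {K : Set M} (hK : IsCompact K) (hKe : K ⊆ e.source)
    (hαK : ∀ x, x ∉ K → α x = 0) : surfaceIntegral o (extd α) = 0 := by
  have hK' : IsCompact (e '' K) := hK.image_of_continuousOn (e.continuousOn.mono hKe)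
  have hsub : e '' K ⊆ e.target := by
    rintro _ ⟨x, hx, rfl⟩
    exact e.map_source (hKe hx)
  set a : Plane → Plane →L[ℝ] ℝ := e.target.indicator (rep₁ e α) with ha
  have ha0 (u : Plane) (hu : u ∉ e '' K) : a u = 0 := by
    by_cases hut : u ∈ e.target
    · rw [ha, indicator_of_mem hut, rep₁, hαK, ContinuousLinearMap.zero_comp]
      exact fun h ↦ hu ⟨_, h, e.right_inv hut⟩
    · exact indicator_of_notMem hut _
  have hat (u : Plane) (hu : u ∈ e.target) : a =ᶠ[𝓝 u] rep₁ e α := by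
    filter_upwards [e.open_target.mem_nhds hu] with v hv
    exact indicator_of_mem hv _
  have haz (u : Plane) (hu : u ∉ e '' K) : a =ᶠ[𝓝 u] fun _ ↦ 0 := by
    filter_upwards [hK'.isClosed.isOpen_compl.mem_nhds hu] with v hv
    exact ha0 v hv
  have hac : ContDiff ℝ 1 a := by
    rw [contDiff_iff_contDiffAt]
    intro u
    by_cases hu : u ∈ e '' K
    · exact (hα e he.mem u (hsub hu)).congr_of_eventuallyEq (hat u (hsub hu))
    · exact contDiffAt_const.congr_of_eventuallyEq (haz u hu)
  have has : HasCompactSupport a := HasCompactSupport.intro hK' fun u hu ↦ ha0 u hu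
  have hcurl0 (u : Plane) (hu : u ∉ e '' K) : curl a u = 0 := by
    rw [curl_congr (haz u hu)]
    simp [curl]
  have hcurl (u : Plane) (hu : u ∈ e.target) : rep₂ e (extd α) u = curl a u := by
    rw [rep₂_extd hα he.mem hu, curl_congr (hat u hu)]
  rw [surfaceIntegral_eq_setIntegral he (isContForm_extd hα) hK hKe,
    ← integral_curl_eq_zero hac has, setIntegral_congr_fun e.open_target.measurableSet hcurl]
  · refine setIntegral_eq_integral_of_forall_compl_eq_zero fun u hu ↦ hcurl0 u fun h ↦ hu (hsub h)
  · intro x hx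
    by_contra hxK
    refine hx (extd_eq_zero_of_eventually ?_)
    filter_upwards [hK.isClosed.isOpen_compl.mem_nhds hxK] with y hy
    exact hαK y hy

/-- Stokes' theorem on a compact oriented surface without boundary. -/
theorem surfaceIntegral_extd (o : SurfaceOrientation M) {α : M → Plane →L[ℝ] ℝ}
    (hα : IsC1Form α) : surfaceIntegral o (extd α) = 0 := by
  obtain ⟨h1, h2, -, h4⟩ := part_spec o
  have hC (i : M) : IsC1Form fun x ↦ part o i x • α x := hα.smul (h1 i)
  have h : extd α = fun x ↦ ∑ i ∈ partIndex o, extd (fun y ↦ part o i y • α y) x := by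
    ext x
    have hc := chart_mem_maximalAtlas (I := 𝓡 2) (n := ∞) x
    have ht : chartAt Plane x x ∈ (chartAt Plane x).target :=
      (chartAt Plane x).map_source (mem_chart_source Plane x)
    simp only [extd]
    rw [← Finset.sum_mul, ← curl_sum fun i _ ↦
      ((hC i _ hc _ ht).differentiableAt (by norm_num))]
    congr 2
    ext u : 1
    simp only [rep₁_smul]
    rw [← Finset.sum_smul, h4, one_smul]
  rw [h, surfaceIntegral_sum o _ fun i _ ↦ isContForm_extd (hC i)]
  refine Finset.sum_eq_zero fun i _ ↦ ?_
  refine surfaceIntegral_extd_eq_zero_of_support (isPositiveChart_posChart o i) (hC i)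
    (isClosed_tsupport (part o i)).isCompact (h2 i) fun x hx ↦ ?_
  rw [image_eq_zero_of_notMem_tsupport hx, zero_smul]

end Integral

end

section

/-! ### Compactly supported functions on a square modulo divergences -/

/-- The primitive `∫_{-∞}^x f (p, s) ds` of a function in its last variable. -/
def lastPrimitive (f : ℝ × ℝ → ℝ) (z : ℝ × ℝ) : ℝ := ∫ s in Iic z.2, f (z.1, s)

section Primitive

variable {f : ℝ × ℝ → ℝ} {l m : ℝ} (hf : ContDiff ℝ ∞ f)
  (hs : ∀ p x, x ∉ Icc l m → f (p, x) = 0)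
include hf hs

theorem integrable_slice (p : ℝ) : Integrable fun s ↦ f (p, s) := by
  have hc : Continuous fun s ↦ f (p, s) := hf.continuous.comp (by fun_prop)
  exact hc.integrable_of_hasCompactSupport
    (HasCompactSupport.intro (isCompact_Icc (a := l) (b := m)) fun x hx ↦ hs p x hx)

/-- The primitive is the convolution with the indicator function of the half-line, so that it is
smooth in both variables. -/
theorem contDiff_lastPrimitive : ContDiff ℝ ∞ (lastPrimitive f) := by
  have h := contDiffOn_convolution_right_with_param (𝕜 := ℝ) (μ := volume) (n := ⊤)
    (f := (Ici (0 : ℝ)).indicator fun _ ↦ (1 : ℝ)) (g := fun p x ↦ f (p, x)) (s := univ)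
    (ContinuousLinearMap.mul ℝ ℝ) isOpen_univ (isCompact_Icc (a := l) (b := m))
    (fun p x _ hx ↦ hs p x hx)
    ((locallyIntegrable_const (1 : ℝ)).indicator measurableSet_Ici)
    (hf.contDiffOn (s := univ ×ˢ univ))
  rw [univ_prod_univ, contDiffOn_univ] at h
  convert h using 1
  ext z
  rw [convolution_eq_swap, lastPrimitive, ← integral_indicator measurableSet_Iic]
  congr 1
  ext t
  by_cases ht : t ≤ z.2 <;> simp [indicator, ht]

theorem hasDerivAt_lastPrimitive (p x : ℝ) :
    HasDerivAt (fun x ↦ lastPrimitive f (p, x)) (f (p, x)) x := by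
  have hi := integrable_slice hf hs p
  have hc : Continuous fun s ↦ f (p, s) := hf.continuous.comp (by fun_prop)
  have h : (fun x ↦ lastPrimitive f (p, x))
      = fun x ↦ (∫ s in (0 : ℝ)..x, f (p, s)) + ∫ s in Iic (0 : ℝ), f (p, s) := by
    ext x
    rw [← intervalIntegral.integral_Iic_sub_Iic hi.integrableOn hi.integrableOn]
    simp [lastPrimitive]
  rw [h]
  exact (hc.integral_hasStrictDerivAt 0 x).hasDerivAt.add_const _

omit hf in
theorem lastPrimitive_eq_integral {p x : ℝ} (hx : m ≤ x) :
    lastPrimitive f (p, x) = ∫ s, f (p, s) := by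
  refine setIntegral_eq_integral_of_forall_compl_eq_zero fun s hs' ↦ hs p s fun h ↦ ?_
  exact hs' (h.2.trans hx)

omit hf in
theorem lastPrimitive_eq_zero (h0 : ∀ p, ∫ s, f (p, s) = 0) {p x : ℝ} (hx : x ∉ Icc l m) :
    lastPrimitive f (p, x) = 0 := by
  by_cases h : m ≤ x
  · rw [lastPrimitive_eq_integral hs h, h0]
  · refine setIntegral_eq_zero_of_forall_eq_zero fun s hs' ↦ hs p s fun h' ↦ hx ⟨?_, ?_⟩
    · exact h'.1.trans hs'
    · exact (not_le.1 h).le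

end Primitive

/-- A compactly supported function of two variables is, up to a multiple of a product bump function
`χ₁ ⊗ χ₂`, the divergence of a vector field supported in the same rectangle. -/
theorem exists_divergence {f : ℝ × ℝ → ℝ} {l₁ m₁ l₂ m₂ : ℝ} (hf : ContDiff ℝ ∞ f)
    (hs : ∀ x y, ¬(x ∈ Icc l₁ m₁ ∧ y ∈ Icc l₂ m₂) → f (x, y) = 0)
    {χ₁ χ₂ : ℝ → ℝ} (h₁ : ContDiff ℝ ∞ χ₁) (h₂ : ContDiff ℝ ∞ χ₂)
    (hs₁ : ∀ x, x ∉ Icc l₁ m₁ → χ₁ x = 0) (hs₂ : ∀ y, y ∉ Icc l₂ m₂ → χ₂ y = 0)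
    (hi₁ : ∫ x, χ₁ x = 1) (hi₂ : ∫ y, χ₂ y = 1) :
    ∃ a b : ℝ × ℝ → ℝ, ContDiff ℝ ∞ a ∧ ContDiff ℝ ∞ b ∧
      (∀ x y, ¬(x ∈ Icc l₁ m₁ ∧ y ∈ Icc l₂ m₂) → a (x, y) = 0) ∧
      (∀ x y, ¬(x ∈ Icc l₁ m₁ ∧ y ∈ Icc l₂ m₂) → b (x, y) = 0) ∧
      ∀ x y, ∃ a' b', HasDerivAt (fun x ↦ a (x, y)) a' x ∧ HasDerivAt (fun y ↦ b (x, y)) b' y ∧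
        f (x, y) = (∫ z, f z) * (χ₁ x * χ₂ y) + a' + b' := by
  -- `f` with the variables exchanged, so that `lastPrimitive` integrates in `x`
  set k : ℝ × ℝ → ℝ := fun z ↦ f (z.2, z.1) with hk
  have hkc : ContDiff ℝ ∞ k := hf.comp (contDiff_snd.prodMk contDiff_fst)
  have hks : ∀ y x, x ∉ Icc l₁ m₁ → k (y, x) = 0 := fun y x hx ↦ hs x y fun h ↦ hx h.1
  set h : ℝ → ℝ := fun y ↦ ∫ x, f (x, y) with hh
  have hhk : h = fun y ↦ lastPrimitive k (y, m₁) := by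
    ext y
    exact (lastPrimitive_eq_integral hks le_rfl).symm
  have hhc : ContDiff ℝ ∞ h := by
    rw [hhk]
    exact (contDiff_lastPrimitive hkc hks).comp (by fun_prop)
  have hhs : ∀ y, y ∉ Icc l₂ m₂ → h y = 0 := fun y hy ↦ by
    simp [hh, hs _ y fun h ↦ hy h.2]
  have hfi : Integrable f := hf.continuous.integrable_of_hasCompactSupport
    (HasCompactSupport.intro ((isCompact_Icc (a := l₁) (b := m₁)).prod
      (isCompact_Icc (a := l₂) (b := m₂))) fun z hz ↦ hs z.1 z.2 fun h ↦ hz h)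
  have hint : ∫ y, h y = ∫ z, f z := by
    rw [hh, Measure.volume_eq_prod, integral_prod_symm]
    rwa [← Measure.volume_eq_prod]
  have hi1 : Integrable χ₁ := h₁.continuous.integrable_of_hasCompactSupport
    (HasCompactSupport.intro (isCompact_Icc (a := l₁) (b := m₁)) hs₁)
  have hi2 : Integrable χ₂ := h₂.continuous.integrable_of_hasCompactSupport
    (HasCompactSupport.intro (isCompact_Icc (a := l₂) (b := m₂)) hs₂)
  have hih : Integrable h := hhc.continuous.integrable_of_hasCompactSupport
    (HasCompactSupport.intro (isCompact_Icc (a := l₂) (b := m₂)) hhs)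
  -- first subtract the part with the same integrals over horizontal lines
  set q : ℝ × ℝ → ℝ := fun z ↦ k z - h z.1 * χ₁ z.2 with hq
  have hqc : ContDiff ℝ ∞ q := hkc.sub ((hhc.comp contDiff_fst).mul (h₁.comp contDiff_snd))
  have hqs : ∀ y x, x ∉ Icc l₁ m₁ → q (y, x) = 0 := fun y x hx ↦ by
    simp [hq, hks y x hx, hs₁ x hx]
  have hq0 (y : ℝ) : ∫ x, q (y, x) = 0 := by
    simp only [hq]
    rw [integral_sub (integrable_slice hkc hks y) (hi1.const_mul _), integral_const_mul, hi₁,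
      mul_one, sub_eq_zero]
  -- then correct the remaining function of `y`
  set r : ℝ × ℝ → ℝ := fun z ↦ h z.2 - (∫ z, f z) * χ₂ z.2 with hr
  have hrc : ContDiff ℝ ∞ r :=
    (hhc.comp contDiff_snd).sub (contDiff_const.mul (h₂.comp contDiff_snd))
  have hrs : ∀ p y, y ∉ Icc l₂ m₂ → r (p, y) = 0 := fun p y hy ↦ by
    simp [hr, hhs y hy, hs₂ y hy]
  have hr0 (p : ℝ) : ∫ y, r (p, y) = 0 := by
    simp only [hr]
    rw [integral_sub hih (hi2.const_mul _), integral_const_mul, hi₂, mul_one, hint, sub_self]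
  refine ⟨fun z ↦ lastPrimitive q (z.2, z.1), fun z ↦ χ₁ z.1 * lastPrimitive r (0, z.2),
    (contDiff_lastPrimitive hqc hqs).comp (contDiff_snd.prodMk contDiff_fst),
    (h₁.comp contDiff_fst).mul ((contDiff_lastPrimitive hrc hrs).comp (by fun_prop)),
    fun x y hxy ↦ ?_, fun x y hxy ↦ ?_, fun x y ↦ ?_⟩
  · by_cases hx : x ∈ Icc l₁ m₁
    · have hy : y ∉ Icc l₂ m₂ := fun hy ↦ hxy ⟨hx, hy⟩
      have hz (s : ℝ) : q (y, s) = 0 := by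
        simp [hq, hk, hhs y hy, hs s y fun h ↦ hy h.2]
      simp [lastPrimitive, hz]
    · exact lastPrimitive_eq_zero hqs hq0 hx
  · by_cases hx : x ∈ Icc l₁ m₁
    · have hy : y ∉ Icc l₂ m₂ := fun hy ↦ hxy ⟨hx, hy⟩
      simp [lastPrimitive_eq_zero hrs hr0 hy]
    · simp [hs₁ x hx]
  · refine ⟨_, _, hasDerivAt_lastPrimitive hqc hqs y x,
      (hasDerivAt_lastPrimitive hrc hrs 0 y).const_mul (χ₁ x), ?_⟩
    simp only [hq, hr, hk]
    ring

/-- An open square with sides parallel to the axes. -/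
def square (c : Plane) (r : ℝ) : Set Plane := {u | |u 0 - c 0| < r ∧ |u 1 - c 1| < r}

theorem isOpen_square (c : Plane) (r : ℝ) : IsOpen (square c r) := by
  have h (i : Fin 2) : Continuous fun u : Plane ↦ |u i - c i| := by fun_prop
  exact (isOpen_lt (h 0) continuous_const).inter (isOpen_lt (h 1) continuous_const)

theorem mem_square {c : Plane} {r : ℝ} (hr : 0 < r) : c ∈ square c r := by
  simp [square, hr]

theorem exists_square_subset {U : Set Plane} (hU : IsOpen U) {c : Plane} (hc : c ∈ U) :
    ∃ r > 0, square c r ⊆ U := by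
  obtain ⟨ε, hε, h⟩ := Metric.isOpen_iff.1 hU c hc
  refine ⟨ε / 2, by positivity, fun u hu ↦ h ?_⟩
  rw [Metric.mem_ball, EuclideanSpace.dist_eq, Fin.sum_univ_two, Real.dist_eq, Real.dist_eq,
    Real.sqrt_lt' hε]
  nlinarith [hu.1, hu.2, abs_nonneg (u 0 - c 0), abs_nonneg (u 1 - c 1)]

theorem exists_lt_of_isCompact_subset_square {c : Plane} {r : ℝ} (hr : 0 < r) {K : Set Plane}
    (hK : IsCompact K) (hKr : K ⊆ square c r) :
    ∃ r', r / 2 ≤ r' ∧ r' < r ∧ ∀ u ∈ K, |u 0 - c 0| ≤ r' ∧ |u 1 - c 1| ≤ r' := by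
  rcases K.eq_empty_or_nonempty with rfl | hne
  · exact ⟨r / 2, le_rfl, by linarith, by simp⟩
  · obtain ⟨v, hv, hmax⟩ := hK.exists_isMaxOn hne
      (f := fun u : Plane ↦ max |u 0 - c 0| |u 1 - c 1|) (by fun_prop)
    refine ⟨max (max |v 0 - c 0| |v 1 - c 1|) (r / 2), le_max_right _ _,
      max_lt (max_lt (hKr hv).1 (hKr hv).2) (by linarith), fun u hu ↦ ?_⟩
    have h : max |u 0 - c 0| |u 1 - c 1| ≤ max |v 0 - c 0| |v 1 - c 1| := hmax hu
    exact ⟨((le_max_left _ _).trans h).trans (le_max_left _ _),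
      ((le_max_right _ _).trans h).trans (le_max_left _ _)⟩

theorem integral_plane (κ : Plane → ℝ) : ∫ u, κ u = ∫ z : ℝ × ℝ, κ (!₂[z.1, z.2]) := by
  rw [← (EuclideanSpace.volume_preserving_symm_measurableEquiv_toLp (Fin 2)).symm.integral_comp',
    ← (volume_preserving_finTwoArrow ℝ).symm.integral_comp']
  rfl

theorem exists_bump (c r : ℝ) (hr : 0 < r) :
    ∃ χ : ℝ → ℝ, ContDiff ℝ ∞ χ ∧ (∀ x, r < |x - c| → χ x = 0) ∧ ∫ x, χ x = 1 := by
  let f : ContDiffBump c := ⟨r / 2, r, by linarith, by linarith⟩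
  refine ⟨f.normed volume, f.contDiff_normed, fun x hx ↦ ?_, f.integral_normed⟩
  refine image_eq_zero_of_notMem_tsupport ?_
  rw [f.tsupport_normed_eq, Metric.mem_closedBall, Real.dist_eq]
  exact not_le.2 hx

theorem fderiv_apply_stdVec_zero {a : ℝ × ℝ → ℝ} (ha : ContDiff ℝ ∞ a) (u : Plane) {a' : ℝ}
    (h : HasDerivAt (fun x ↦ a (x, u 1)) a' (u 0)) :
    fderiv ℝ (fun u : Plane ↦ a (u 0, u 1)) u (stdVec 0) = a' := by
  have h1 : DifferentiableAt ℝ (fun u : Plane ↦ a (u 0, u 1)) u :=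
    ((ha.differentiable (by simp)).comp (by fun_prop)) u
  rw [← h1.lineDeriv_eq_fderiv, lineDeriv]
  have h2 : HasDerivAt (fun t : ℝ ↦ u 0 + t) 1 0 := by
    simpa using (hasDerivAt_id (0 : ℝ)).const_add _
  have h3 := HasDerivAt.comp (0 : ℝ) (h₂ := fun x ↦ a (x, u 1)) (by simpa using h) h2
  simpa [Function.comp_def] using h3.deriv

theorem fderiv_apply_stdVec_one {a : ℝ × ℝ → ℝ} (ha : ContDiff ℝ ∞ a) (u : Plane) {a' : ℝ}
    (h : HasDerivAt (fun y ↦ a (u 0, y)) a' (u 1)) :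
    fderiv ℝ (fun u : Plane ↦ a (u 0, u 1)) u (stdVec 1) = a' := by
  have h1 : DifferentiableAt ℝ (fun u : Plane ↦ a (u 0, u 1)) u :=
    ((ha.differentiable (by simp)).comp (by fun_prop)) u
  rw [← h1.lineDeriv_eq_fderiv, lineDeriv]
  have h2 : HasDerivAt (fun t : ℝ ↦ u 1 + t) 1 0 := by
    simpa using (hasDerivAt_id (0 : ℝ)).const_add _
  have h3 := HasDerivAt.comp (0 : ℝ) (h₂ := fun y ↦ a (u 0, y)) (by simpa using h) h2
  simpa [Function.comp_def] using h3.deriv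

/-- The Poincaré lemma with compact supports on a square: a compactly supported function with
integral zero is the curl of a compactly supported one-form. -/
theorem exists_curl_eq (c : Plane) {r : ℝ} (hr : 0 < r) {κ : Plane → ℝ} (hκ : ContDiff ℝ ∞ κ)
    (hκc : HasCompactSupport κ) (hκs : tsupport κ ⊆ square c r) (hκ0 : ∫ v, κ v = 0) :
    ∃ β : Plane → Plane →L[ℝ] ℝ, ContDiff ℝ ∞ β ∧ HasCompactSupport β ∧
      tsupport β ⊆ square c r ∧ ∀ u, κ u = curl β u := by
  obtain ⟨χ₁, hχ₁, hs₁, hi₁⟩ := exists_bump (c 0) (r / 2) (by positivity)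
  obtain ⟨χ₂, hχ₂, hs₂, hi₂⟩ := exists_bump (c 1) (r / 2) (by positivity)
  obtain ⟨r', hr', hr'r, hK⟩ := exists_lt_of_isCompact_subset_square hr hκc hκs
  have hIcc (x y : ℝ) : x ∈ Icc (y - r') (y + r') ↔ |x - y| ≤ r' := by
    rw [abs_le, mem_Icc]
    constructor <;> rintro ⟨h1, h2⟩ <;> constructor <;> linarith
  obtain ⟨a, b, ha, hb, has, hbs, h⟩ := exists_divergence
    (f := fun z : ℝ × ℝ ↦ κ (!₂[z.1, z.2])) (l₁ := c 0 - r') (m₁ := c 0 + r') (l₂ := c 1 - r')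
    (m₂ := c 1 + r') (hκ.comp (by
      rw [contDiff_euclidean]
      intro i
      fin_cases i
      · exact contDiff_fst
      · exact contDiff_snd))
    (fun x y hxy ↦ by
      refine image_eq_zero_of_notMem_tsupport fun hmem ↦ hxy ?_
      rw [hIcc, hIcc]
      simpa using hK _ hmem) hχ₁ hχ₂
    (fun x hx ↦ hs₁ x (by rw [hIcc] at hx; linarith [not_le.1 hx]))
    (fun x hx ↦ hs₂ x (by rw [hIcc] at hx; linarith [not_le.1 hx])) hi₁ hi₂
  set A : Plane → ℝ := fun u ↦ a (u 0, u 1)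
  set B : Plane → ℝ := fun u ↦ b (u 0, u 1)
  have hA : ContDiff ℝ ∞ A := ha.comp (by fun_prop)
  have hB : ContDiff ℝ ∞ B := hb.comp (by fun_prop)
  set β : Plane → Plane →L[ℝ] ℝ := fun u ↦ A u • (EuclideanSpace.proj 1 : Plane →L[ℝ] ℝ)
    - B u • (EuclideanSpace.proj 0 : Plane →L[ℝ] ℝ) with hβ
  set C : Set Plane := {u | |u 0 - c 0| ≤ r' ∧ |u 1 - c 1| ≤ r'}
  have hCclosed : IsClosed C := by
    have h (i : Fin 2) : Continuous fun u : Plane ↦ |u i - c i| := by fun_prop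
    exact (isClosed_le (h 0) continuous_const).inter (isClosed_le (h 1) continuous_const)
  have hCcompact : IsCompact C := by
    refine Metric.isCompact_of_isClosed_isBounded hCclosed
      ((Metric.isBounded_closedBall (x := c) (r := 2 * r')).subset fun u hu ↦ ?_)
    rw [Metric.mem_closedBall, EuclideanSpace.dist_eq, Fin.sum_univ_two, Real.dist_eq,
      Real.dist_eq]
    refine Real.sqrt_le_iff.2 ⟨by linarith, ?_⟩
    nlinarith [hu.1, hu.2, abs_nonneg (u 0 - c 0), abs_nonneg (u 1 - c 1)]
  have hβ0 (u : Plane) (hu : u ∉ C) : β u = 0 := by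
    have h1 : A u = 0 := has _ _ (by rw [hIcc, hIcc]; exact hu)
    have h2 : B u = 0 := hbs _ _ (by rw [hIcc, hIcc]; exact hu)
    simp [hβ, h1, h2]
  refine ⟨β, (hA.smul contDiff_const).sub (hB.smul contDiff_const),
    HasCompactSupport.intro hCcompact hβ0, ?_, fun u ↦ ?_⟩
  · have h1 : tsupport β ⊆ C := closure_minimal
      (fun u hu ↦ by_contra fun h ↦ hu (hβ0 u h)) hCclosed
    exact h1.trans fun u hu ↦ ⟨hu.1.trans_lt hr'r, hu.2.trans_lt hr'r⟩
  · obtain ⟨a', b', h1, h2, h3⟩ := h (u 0) (u 1)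
    have hu : !₂[u 0, u 1] = u := by
      ext i
      fin_cases i <;> rfl
    have hfd : fderiv ℝ β u = (fderiv ℝ A u).smulRight (EuclideanSpace.proj 1 : Plane →L[ℝ] ℝ)
        - (fderiv ℝ B u).smulRight (EuclideanSpace.proj 0 : Plane →L[ℝ] ℝ) :=
      (((hA.differentiable (by simp) u).hasFDerivAt.smul_const _).sub
        ((hB.differentiable (by simp) u).hasFDerivAt.smul_const _)).fderiv
    have hcurl : curl β u = a' + b' := by
      rw [curl, hfd]
      simp [← fderiv_apply_stdVec_zero ha u h1, ← fderiv_apply_stdVec_one hb u h2, A, B]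
    rw [hu, ← integral_plane, hκ0] at h3
    rw [hcurl, h3]
    ring

end

section

/-! ### Two-forms with integral zero pull back to two-forms with integral zero -/

section SmoothForm

variable {N : Type*} [TopologicalSpace N] [ChartedSpace Plane N]

/-- A smooth two-form on a surface. -/
def IsSmoothForm (W : N → ℝ) : Prop :=
  ∀ e ∈ maximalAtlas (𝓡 2) ∞ N, ContDiffOn ℝ ∞ (rep₂ e W) e.target

/-- A smooth two-form that is positive on positive frames. -/
structure IsPositiveForm (o : SurfaceOrientation N) (η : N → ℝ) : Prop where
  smooth : IsSmoothForm η
  pos (e : OpenPartialHomeomorph N Plane) : IsPositiveChart o e → ∀ u ∈ e.target, 0 < rep₂ e η u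

theorem IsSmoothForm.isContForm {W : N → ℝ} (hW : IsSmoothForm W) : IsContForm W :=
  fun e he ↦ (hW e he).continuousOn

theorem IsSmoothForm.mul {ρ : N → ℝ} (hρ : ContMDiff (𝓡 2) 𝓘(ℝ, ℝ) ∞ ρ) {W : N → ℝ}
    (hW : IsSmoothForm W) : IsSmoothForm fun x ↦ ρ x * W x := fun e he ↦ by
  simp only [funext (rep₂_mul e ρ W)]
  exact ContDiffOn.mul (fun u hu ↦ (contDiffAt_comp_symm he hρ hu).contDiffWithinAt) (hW e he)

theorem IsSmoothForm.add_const_mul {W W' : N → ℝ} (hW : IsSmoothForm W) (hW' : IsSmoothForm W')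
    (c : ℝ) : IsSmoothForm fun x ↦ W x + c * W' x := fun e he ↦ by
  have h : rep₂ e (fun x ↦ W x + c * W' x) = fun u ↦ rep₂ e W u + c * rep₂ e W' u := by
    ext u
    simp only [rep₂]
    ring
  rw [h]
  exact (hW e he).add (contDiffOn_const.mul (hW' e he))

variable [CompactSpace N]

theorem extension_spec {e : OpenPartialHomeomorph N Plane} (he : e ∈ maximalAtlas (𝓡 2) ∞ N)
    {W : N → ℝ} (hW : IsSmoothForm W) (hs : tsupport W ⊆ e.source) :
    ContDiff ℝ ∞ (e.target.indicator (rep₂ e W)) ∧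
      HasCompactSupport (e.target.indicator (rep₂ e W)) ∧
      tsupport (e.target.indicator (rep₂ e W)) ⊆ e '' tsupport W := by
  have hK : IsCompact (tsupport W) := (isClosed_tsupport W).isCompact
  have hK' : IsCompact (e '' tsupport W) := hK.image_of_continuousOn (e.continuousOn.mono hs)
  have h0 (u : Plane) (hu : u ∉ e '' tsupport W) : e.target.indicator (rep₂ e W) u = 0 := by
    by_cases hut : u ∈ e.target
    · rw [indicator_of_mem hut, rep₂, image_eq_zero_of_notMem_tsupport (f := W), zero_mul]
      exact fun h ↦ hu ⟨_, h, e.right_inv hut⟩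
    · exact indicator_of_notMem hut _
  refine ⟨?_, HasCompactSupport.intro hK' h0, closure_minimal
    (fun u hu ↦ by_contra fun h ↦ hu (h0 u h)) hK'.isClosed⟩
  rw [contDiff_iff_contDiffAt]
  intro u
  by_cases hu : u ∈ e '' tsupport W
  · obtain ⟨x, hx, rfl⟩ := hu
    have ht := e.open_target.mem_nhds (e.map_source (hs hx))
    refine ((hW e he).contDiffAt ht).congr_of_eventuallyEq ?_
    filter_upwards [ht] with v hv
    exact indicator_of_mem hv _
  · refine (contDiffAt_const (c := (0 : ℝ))).congr_of_eventuallyEq ?_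
    filter_upwards [hK'.isClosed.isOpen_compl.mem_nhds hu] with v hv
    exact h0 v hv

variable [T2Space N]

/-- A one-form given in a chart, extended by zero to the surface. -/
def chartOneForm (e : OpenPartialHomeomorph N Plane) (β : Plane → Plane →L[ℝ] ℝ) :
    N → Plane →L[ℝ] ℝ :=
  e.source.indicator fun y ↦ (β (e y)).comp (mder e y)

omit [T2Space N] [CompactSpace N] in
theorem rep₁_chartOneForm {e : OpenPartialHomeomorph N Plane} (he : e ∈ maximalAtlas (𝓡 2) ∞ N)
    (β : Plane → Plane →L[ℝ] ℝ) {u : Plane} (hu : u ∈ e.target) :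
    rep₁ e (chartOneForm e β) u = β u := by
  rw [rep₁, chartOneForm, indicator_of_mem (e.map_target hu), ContinuousLinearMap.comp_assoc,
    mder_comp_mder_symm he hu, e.right_inv hu, ContinuousLinearMap.comp_id]

omit [CompactSpace N] in
theorem chartOneForm_eventually_eq_zero {e : OpenPartialHomeomorph N Plane}
    {β : Plane → Plane →L[ℝ] ℝ} (hc : HasCompactSupport β) (hs : tsupport β ⊆ e.target) {y : N}
    (hy : y ∉ e.source) : ∀ᶠ z in 𝓝 y, chartOneForm e β z = 0 := by
  have hK : IsCompact (e.symm '' tsupport β) :=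
    IsCompact.image_of_continuousOn hc (e.continuousOn_symm.mono hs)
  have hyK : y ∉ e.symm '' tsupport β := by
    rintro ⟨u, hu, rfl⟩
    exact hy (e.map_target (hs hu))
  filter_upwards [hK.isClosed.isOpen_compl.mem_nhds hyK] with z hz
  by_cases hze : z ∈ e.source
  · rw [chartOneForm, indicator_of_mem hze, image_eq_zero_of_notMem_tsupport (f := β),
      ContinuousLinearMap.zero_comp]
    exact fun h ↦ hz ⟨_, h, e.left_inv hze⟩
  · exact indicator_of_notMem hze _

omit [CompactSpace N] in
theorem isC1Form_chartOneForm [IsManifold (𝓡 2) ∞ N] {e : OpenPartialHomeomorph N Plane}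
    (he : e ∈ maximalAtlas (𝓡 2) ∞ N) {β : Plane → Plane →L[ℝ] ℝ} (hβ : ContDiff ℝ ∞ β)
    (hc : HasCompactSupport β) (hs : tsupport β ⊆ e.target) : IsC1Form (chartOneForm e β) := by
  refine isC1Form_of_local fun y ↦ ?_
  by_cases hy : y ∈ e.source
  · refine ⟨e, he, hy, ?_⟩
    refine (hβ.of_le (by norm_cast)).contDiffAt.congr_of_eventuallyEq ?_
    filter_upwards [e.open_target.mem_nhds (e.map_source hy)] with u hu
    exact rep₁_chartOneForm he β hu
  · exact ⟨chartAt Plane y, chart_mem_maximalAtlas y, mem_chart_source Plane y,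
      contDiffAt_const.congr_of_eventuallyEq (rep₁_eventuallyEq_zero
        (chartOneForm_eventually_eq_zero hc hs hy) (mem_chart_source Plane y))⟩

theorem surfaceIntegral_eq_integral_indicator [IsManifold (𝓡 2) ∞ N] {o : SurfaceOrientation N}
    {e : OpenPartialHomeomorph N Plane} (he : IsPositiveChart o e) {W : N → ℝ}
    (hW : IsContForm W) (hs : tsupport W ⊆ e.source) :
    surfaceIntegral o W = ∫ u, e.target.indicator (rep₂ e W) u := by
  rw [integral_indicator e.open_target.measurableSet]
  exact surfaceIntegral_eq_setIntegral he hW (isClosed_tsupport W).isCompact hs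
    fun x hx ↦ subset_tsupport _ hx

theorem surfaceIntegral_nonneg [IsManifold (𝓡 2) ∞ N] {o : SurfaceOrientation N} {η : N → ℝ}
    (hη : IsPositiveForm o η) {h : N → ℝ} (h0 : ∀ x, 0 ≤ h x) :
    0 ≤ surfaceIntegral o fun x ↦ h x * η x := by
  obtain ⟨-, -, h3, -⟩ := part_spec o
  refine Finset.sum_nonneg fun x _ ↦
    setIntegral_nonneg (posChart o x).open_target.measurableSet fun u hu ↦ ?_
  rw [rep₂_mul, rep₂_mul]
  exact mul_nonneg (h3 _ _)
    (mul_nonneg (h0 _) (hη.pos _ (isPositiveChart_posChart o x) u hu).le)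

theorem surfaceIntegral_pos [IsManifold (𝓡 2) ∞ N] {o : SurfaceOrientation N} {η : N → ℝ}
    (hη : IsPositiveForm o η) {e : OpenPartialHomeomorph N Plane} (he : IsPositiveChart o e)
    {h : N → ℝ} (hh : ContMDiff (𝓡 2) 𝓘(ℝ, ℝ) ∞ h) (hs : tsupport h ⊆ e.source)
    (h0 : ∀ x, 0 ≤ h x) {y : N} (hy : h y ≠ 0) :
    0 < surfaceIntegral o fun x ↦ h x * η x := by
  have hW := hη.smooth.mul hh
  have hs' : tsupport (fun x ↦ h x * η x) ⊆ e.source :=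
    (tsupport_mul_subset_left (f := h) (g := η)).trans hs
  obtain ⟨h1, h2, -⟩ := extension_spec he.mem hW hs'
  have hye : y ∈ e.source := hs (subset_tsupport _ hy)
  rw [surfaceIntegral_eq_integral_indicator he hW.isContForm hs']
  refine h1.continuous.integral_pos_of_hasCompactSupport_nonneg_nonzero h2 (fun u ↦ ?_)
    (x := e y) ?_
  · refine indicator_nonneg (fun u hu ↦ ?_) u
    rw [rep₂_mul]
    exact mul_nonneg (h0 _) (hη.pos e he u hu).le
  · rw [indicator_of_mem (e.map_source hye), rep₂_mul, e.left_inv hye]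
    exact mul_ne_zero hy (hη.pos e he _ (e.map_source hye)).ne'

omit [CompactSpace N] in
theorem exists_bump_function [IsManifold (𝓡 2) ∞ N] {V : Set N} (hV : IsOpen V) {y : N}
    (hy : y ∈ V) : ∃ h : N → ℝ, ContMDiff (𝓡 2) 𝓘(ℝ, ℝ) ∞ h ∧ tsupport h ⊆ V ∧
      (∀ x, 0 ≤ h x) ∧ (∀ x, h x ≤ 1) ∧ h y = 1 := by
  obtain ⟨f, -, hf⟩ := (SmoothBumpFunction.nhds_basis_tsupport (I := 𝓡 2) y).mem_iff.1
    (hV.mem_nhds hy)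
  exact ⟨f, f.contMDiff, hf, fun x ↦ f.nonneg, fun x ↦ f.le_one, f.eq_one⟩

end SmoothForm

theorem surfaceIntegral_add_const_mul {M : Type*} [TopologicalSpace M] [ChartedSpace Plane M]
    [IsManifold (𝓡 2) ∞ M] [T2Space M] [CompactSpace M] (o : SurfaceOrientation M) {W W' : M → ℝ}
    (hW : IsContForm W) (hW' : IsContForm W') (c : ℝ) :
    surfaceIntegral o (fun x ↦ W x + c * W' x)
      = surfaceIntegral o W + c * surfaceIntegral o W' := by
  have h := surfaceIntegral_sum o (Finset.univ : Finset (Fin 2))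
    (W := ![W, fun x ↦ c * W' x]) (fun i _ ↦ by
      fin_cases i
      · exact hW
      · exact hW'.mul continuous_const)
  simpa [Fin.sum_univ_two, surfaceIntegral_const_mul] using h

section Pullback

variable {M N : Type*} [TopologicalSpace M] [ChartedSpace Plane M] [IsManifold (𝓡 2) ∞ M]
  [T2Space M] [CompactSpace M]
  [TopologicalSpace N] [ChartedSpace Plane N] [IsManifold (𝓡 2) ∞ N]
  [T2Space N] [CompactSpace N] (o : SurfaceOrientation M) (o' : SurfaceOrientation N)
  {f : M → N} (hf : ContMDiff (𝓡 2) (𝓡 2) ∞ f)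
include hf

/-- Two-forms with integral zero that are supported in a coordinate square pull back to two-forms
with integral zero. -/
theorem surfaceIntegral_pullback₂_eq_zero {e : OpenPartialHomeomorph N Plane}
    (he : IsPositiveChart o' e) {c : Plane} {r : ℝ} (hr : 0 < r) (hre : square c r ⊆ e.target)
    {W : N → ℝ} (hW : IsSmoothForm W) (hs : tsupport W ⊆ e.source ∩ e ⁻¹' square c r)
    (h0 : surfaceIntegral o' W = 0) : surfaceIntegral o (pullback₂ f W) = 0 := by
  obtain ⟨h1, h2, h3⟩ := extension_spec he.mem hW (hs.trans inter_subset_left)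
  rw [surfaceIntegral_eq_integral_indicator he hW.isContForm (hs.trans inter_subset_left)] at h0
  obtain ⟨β, hβ, hβc, hβs, hβW⟩ := exists_curl_eq c hr h1 h2 (h3.trans (by
    rintro _ ⟨x, hx, rfl⟩
    exact (hs hx).2)) h0
  have hC := isC1Form_chartOneForm he.mem hβ hβc (hβs.trans hre)
  have hext : extd (chartOneForm e β) = W := by
    ext y
    by_cases hy : y ∈ e.source
    · refine eq_of_rep₂_eq he.mem hy ?_
      rw [rep₂_extd hC he.mem (e.map_source hy)]
      have hev : rep₁ e (chartOneForm e β) =ᶠ[𝓝 (e y)] β := by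
        filter_upwards [e.open_target.mem_nhds (e.map_source hy)] with u hu
        exact rep₁_chartOneForm he.mem β hu
      rw [curl_congr hev, ← hβW, indicator_of_mem (e.map_source hy)]
    · rw [extd_eq_zero_of_eventually (chartOneForm_eventually_eq_zero hβc (hβs.trans hre) hy)]
      exact (image_eq_zero_of_notMem_tsupport fun h ↦ hy (hs h).1).symm
  rw [← hext, ← extd_pullback₁ hf hC]
  exact surfaceIntegral_extd o (isC1Form_pullback₁ hf hC)

/-- Locally on the target, the integral of the pullback of a two-form is a constant multiple of the
integral of the two-form. -/
theorem exists_local_degree {η : N → ℝ} (hη : IsPositiveForm o' η) (y : N) :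
    ∃ (V : Set N) (d : ℝ), IsOpen V ∧ y ∈ V ∧ V ⊆ (posChart o' y).source ∧
      ∀ W, IsSmoothForm W → tsupport W ⊆ V →
        surfaceIntegral o (pullback₂ f W) = d * surfaceIntegral o' W := by
  have he := isPositiveChart_posChart o' y
  have hy := mem_posChart o' y
  set e := posChart o' y
  obtain ⟨r, hr, hre⟩ := exists_square_subset e.open_target (e.map_source hy)
  have hV : IsOpen (e.source ∩ e ⁻¹' square (e y) r) :=
    e.isOpen_inter_preimage (isOpen_square _ _)
  have hyV : y ∈ e.source ∩ e ⁻¹' square (e y) r := ⟨hy, mem_square hr⟩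
  obtain ⟨h, hh, hhs, hh0, -, hh1⟩ := exists_bump_function hV hyV
  set W₀ : N → ℝ := fun x ↦ h x * η x
  have hW₀ : IsSmoothForm W₀ := hη.smooth.mul hh
  have hW₀s : tsupport W₀ ⊆ e.source ∩ e ⁻¹' square (e y) r :=
    (tsupport_mul_subset_left (f := h) (g := η)).trans hhs
  have hpos : 0 < surfaceIntegral o' W₀ :=
    surfaceIntegral_pos hη he hh (hhs.trans inter_subset_left) hh0 (y := y) (by simp [hh1])
  refine ⟨_, surfaceIntegral o (pullback₂ f W₀) / surfaceIntegral o' W₀, hV, hyV,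
    inter_subset_left, fun W hW hWs ↦ ?_⟩
  set t : ℝ := surfaceIntegral o' W / surfaceIntegral o' W₀ with ht
  have hzero := surfaceIntegral_pullback₂_eq_zero o o' hf he hr hre
    (hW.add_const_mul hW₀ (-t)) (closure_minimal (fun x hx ↦ ?_)
      ((isClosed_tsupport W).union (isClosed_tsupport W₀)) |>.trans (union_subset hWs hW₀s))
    (by
      rw [surfaceIntegral_add_const_mul o' hW.isContForm hW₀.isContForm, ht]
      field_simp
      ring)
  · have hpb : pullback₂ f (fun x ↦ W x + -t * W₀ x)
        = fun x ↦ pullback₂ f W x + -t * pullback₂ f W₀ x := by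
      ext x
      simp only [pullback₂]
      ring
    rw [hpb, surfaceIntegral_add_const_mul o (isContForm_pullback₂ hf hW.isContForm)
      (isContForm_pullback₂ hf hW₀.isContForm)] at hzero
    rw [div_mul_eq_mul_div, mul_div_assoc, ← ht]
    linarith
  · by_contra hn
    rw [mem_union, not_or] at hn
    refine hx ?_
    change W x + -t * W₀ x = 0
    rw [image_eq_zero_of_notMem_tsupport hn.1, image_eq_zero_of_notMem_tsupport hn.2]
    ring

/-- If one positive two-form on a connected surface pulls back to a two-form with integral zero,
then so does every two-form with small support. -/
theorem exists_nhds_surfaceIntegral_pullback₂_eq_zero [ConnectedSpace N] {η : N → ℝ}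
    (hη : IsPositiveForm o' η) (h0 : surfaceIntegral o (pullback₂ f η) = 0) (y : N) :
    ∃ V : Set N, IsOpen V ∧ y ∈ V ∧
      ∀ W, IsSmoothForm W → tsupport W ⊆ V → surfaceIntegral o (pullback₂ f W) = 0 := by
  choose V d hV hyV hVe hd using exists_local_degree o o' hf hη
  have hconst (y z : N) (hz : z ∈ V y) : d z = d y := by
    obtain ⟨h, hh, hhs, hh0, -, hh1⟩ :=
      exists_bump_function ((hV y).inter (hV z)) (⟨hz, hyV z⟩ : z ∈ V y ∩ V z)
    have hW := hη.smooth.mul hh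
    have hWs : tsupport (fun x ↦ h x * η x) ⊆ V y ∩ V z :=
      (tsupport_mul_subset_left (f := h) (g := η)).trans hhs
    have hpos := surfaceIntegral_pos hη (isPositiveChart_posChart o' z) hh
      ((hhs.trans inter_subset_right).trans (hVe z)) hh0 (y := z) (by simp [hh1])
    have e1 := hd y _ hW (hWs.trans inter_subset_left)
    have e2 := hd z _ hW (hWs.trans inter_subset_right)
    exact mul_right_cancel₀ hpos.ne' (e2.symm.trans e1)
  have hloc : IsLocallyConstant d := (IsLocallyConstant.iff_exists_open d).2 fun y ↦
    ⟨V y, hV y, hyV y, fun z hz ↦ hconst y z hz⟩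
  have hd0 (z : N) : d z = d y := hloc.apply_eq_of_preconnectedSpace z y
  obtain ⟨s, ρ, hρ, hρs, -, hρ1⟩ := exists_finite_partition V hV hyV
  have hWi (i : N) : IsSmoothForm fun x ↦ ρ i x * η x := hη.smooth.mul (hρ i)
  have hsum : η = fun x ↦ ∑ i ∈ s, ρ i x * η x := by
    ext x
    rw [← Finset.sum_mul, hρ1, one_mul]
  have hpsum : pullback₂ f η = fun x ↦ ∑ i ∈ s, pullback₂ f (fun x ↦ ρ i x * η x) x := by
    ext x
    simp only [pullback₂]
    rw [← Finset.sum_mul, ← Finset.sum_mul, hρ1, one_mul]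
  have htotal : surfaceIntegral o (pullback₂ f η) = d y * surfaceIntegral o' η := by
    conv_rhs => rw [hsum]
    rw [hpsum, surfaceIntegral_sum o s fun i _ ↦ isContForm_pullback₂ hf (hWi i).isContForm,
      surfaceIntegral_sum o' s fun i _ ↦ (hWi i).isContForm, Finset.mul_sum]
    refine Finset.sum_congr rfl fun i _ ↦ ?_
    rw [hd i _ (hWi i) ((tsupport_mul_subset_left (f := ρ i) (g := η)).trans (hρs i)), hd0]
  have harea : 0 < surfaceIntegral o' η := by
    obtain ⟨h, hh, hhs, hh0, hh2, hh1⟩ := exists_bump_function (hV y) (hyV y)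
    have hpos := surfaceIntegral_pos hη (isPositiveChart_posChart o' y) hh
      (hhs.trans (hVe y)) hh0 (y := y) (by simp [hh1])
    have hnonneg := surfaceIntegral_nonneg hη (h := fun x ↦ 1 - h x)
      fun x ↦ sub_nonneg.2 (hh2 x)
    have hsplit : (fun x ↦ (1 - h x) * η x) = fun x ↦ η x + -1 * (h x * η x) := by
      ext x
      ring
    rw [hsplit, surfaceIntegral_add_const_mul o' hη.smooth.isContForm
      (hη.smooth.mul hh).isContForm] at hnonneg
    linarith
  have hdy : d y = 0 := by
    rw [h0] at htotal
    exact (mul_eq_zero.1 htotal.symm).resolve_right harea.ne'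
  refine ⟨V y, hV y, hyV y, fun W hW hWs ↦ ?_⟩
  rw [hd y W hW hWs, hdy, zero_mul]

end Pullback

end

section

/-! ### Counting the points over a regular value -/

theorem orientationSign_eq (o : Orientation ℝ Plane (Fin 2)) (v w : Plane) :
    orientationSign o v w
      = SignType.sign (v 0 * w 1 - w 0 * v 1) * orientationSign o (stdVec 0) (stdVec 1) := by
  set L : Plane →L[ℝ] Plane := (EuclideanSpace.proj 0 : Plane →L[ℝ] ℝ).smulRight v
    + (EuclideanSpace.proj 1 : Plane →L[ℝ] ℝ).smulRight w
  have h0 : L (stdVec 0) = v := by simp [L]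
  have h1 : L (stdVec 1) = w := by simp [L]
  have hd : L.det = v 0 * w 1 - w 0 * v 1 := by rw [det_eq, h0, h1]
  rw [← hd, ← orientationSign_comp, h0, h1]

theorem surjective_iff_det_ne_zero (L : Plane →L[ℝ] Plane) :
    Function.Surjective L ↔ L.det ≠ 0 := by
  constructor
  · intro h hd
    have := LinearMap.range_lt_top_of_det_eq_zero (f := (L : Plane →ₗ[ℝ] Plane)) hd
    exact this.ne (LinearMap.range_eq_top.2 h)
  · intro h
    exact (L.toContinuousLinearEquivOfDetNeZero h).surjective

section

variable {M N : Type*} [TopologicalSpace M] [ChartedSpace Plane M]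
  [TopologicalSpace N] [ChartedSpace Plane N] {o : SurfaceOrientation M}
  {o' : SurfaceOrientation N} {f : M → N}

theorem localDegree_eq_one_iff (x : M) :
    localDegree o o' f x = 1 ↔
      stdSign o' (f x) * SignType.sign (mder f x).det * stdSign o x = 1 := by
  have h1 (v w : Plane) : orientationSign (V := Plane) (o'.orient (f x)) (mder f x v) (mder f x w)
      = SignType.sign (mder f x).det *
        (SignType.sign (v 0 * w 1 - w 0 * v 1) * stdSign o' (f x)) :=
    (orientationSign_comp (o'.orient (f x)) (mder f x) v w).trans
      (congrArg (SignType.sign (mder f x).det * ·) (orientationSign_eq (o'.orient (f x)) v w))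
  have h2 (v w : Plane) : orientationSign (V := Plane) (o.orient x) v w
      = SignType.sign (v 0 * w 1 - w 0 * v 1) * stdSign o x :=
    orientationSign_eq (o.orient x) v w
  have h3 : (∀ v w : TangentSpace (𝓡 2) x,
      orientationSign (o'.orient (f x)) (mfderiv (𝓡 2) (𝓡 2) f x v) (mfderiv (𝓡 2) (𝓡 2) f x w)
        = orientationSign (o.orient x) v w) ↔
      stdSign o' (f x) * SignType.sign (mder f x).det * stdSign o x = 1 := by
    constructor
    · intro h
      have h4 := ((h1 _ _).symm.trans (h (stdVec 0) (stdVec 1))).trans (h2 _ _)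
      simp only [PiLp.single_apply] at h4
      norm_num at h4
      rw [mul_comm (stdSign o' (f x)), h4, signType_mul_self (stdSign_ne_zero _ _)]
    · intro h v w
      refine (h1 v w).trans (Eq.trans ?_ (h2 v w).symm)
      have h5 : SignType.sign (mder f x).det * stdSign o' (f x) = stdSign o x := by
        calc _ = stdSign o' (f x) * SignType.sign (mder f x).det
              * (stdSign o x * stdSign o x) := by
              rw [signType_mul_self (stdSign_ne_zero _ _), mul_one, mul_comm]
          _ = _ := by rw [← mul_assoc, h, one_mul]
      rw [mul_left_comm, h5]
  unfold localDegree
  split_ifs with h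
  · exact iff_of_true rfl (h3.1 h)
  · exact iff_of_false (by norm_num) fun h' ↦ h (h3.2 h')

theorem localDegree_mul_det_pos {e : OpenPartialHomeomorph M Plane} (he : IsPositiveChart o e)
    {e' : OpenPartialHomeomorph N Plane} (he' : IsPositiveChart o' e')
    (hf : ContMDiff (𝓡 2) (𝓡 2) ∞ f) {x : M} (hx : x ∈ e.source) (hx' : f x ∈ e'.source)
    (h0 : (mder f x).det ≠ 0) :
    0 < (localDegree o o' f x : ℝ) * (fderiv ℝ (inCharts e e' f) (e x)).det := by
  have hxx := e.left_inv hx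
  have h := he.sign_det_fderiv he' hf (e.map_source hx) (by rwa [hxx])
  rw [hxx] at h
  have hiff := localDegree_eq_one_iff (o := o) (o' := o') (f := f) x
  rw [← h, sign_eq_one_iff] at hiff
  have hne : (fderiv ℝ (inCharts e e' f) (e x)).det ≠ 0 := by
    rw [← sign_ne_zero, h]
    exact mul_ne_zero (mul_ne_zero (stdSign_ne_zero _ _) (sign_ne_zero.2 h0))
      (stdSign_ne_zero _ _)
  rcases hne.lt_or_gt with hlt | hgt
  · have h1 : localDegree o o' f x = -1 := by
      have h2 : localDegree o o' f x ≠ 1 := fun h' ↦ (hiff.1 h').not_gt hlt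
      unfold localDegree at h2 ⊢
      split_ifs at h2 ⊢ with h3
      · exact absurd rfl h2
      · rfl
    rw [h1]
    push_cast
    linarith
  · rw [hiff.2 hgt]
    push_cast
    linarith

theorem abs_localDegree (x : M) : |(localDegree o o' f x : ℝ)| = 1 := by
  unfold localDegree
  split_ifs <;> simp

/-- Near a point at which the differential is invertible, a map is injective and open, and its
Jacobian determinant in positive charts has the sign that is the local degree. -/
theorem exists_nhds_injOn {e : OpenPartialHomeomorph M Plane} (he : IsPositiveChart o e)
    {e' : OpenPartialHomeomorph N Plane} (he' : IsPositiveChart o' e')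
    (hf : ContMDiff (𝓡 2) (𝓡 2) ∞ f) {x : M} (hx : x ∈ e.source) (hx' : f x ∈ e'.source)
    (h0 : (mder f x).det ≠ 0) {G : Set M} (hG : IsOpen G) (hxG : x ∈ G) :
    ∃ U ⊆ G, IsOpen U ∧ x ∈ U ∧ U ⊆ e.source ∧ MapsTo f U e'.source ∧ InjOn f U ∧
      IsOpen (f '' U) ∧
      ∀ z ∈ U, 0 < (localDegree o o' f x : ℝ) * (fderiv ℝ (inCharts e e' f) (e z)).det := by
  set T := inCharts e e' f with hT
  have hu : e x ∈ e.target := e.map_source hx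
  have hu' : f (e.symm (e x)) ∈ e'.source := by rwa [e.left_inv hx]
  have hTc : ContDiffAt ℝ ∞ T (e x) := contDiffAt_inCharts he.mem he'.mem hf hu hu'
  have hpos := localDegree_mul_det_pos he he' hf hx hx' h0
  have hdet : (fderiv ℝ T (e x)).det ≠ 0 := right_ne_zero_of_mul hpos.ne'
  have hstrict : HasStrictFDerivAt T
      (((fderiv ℝ T (e x)).toContinuousLinearEquivOfDetNeZero hdet : Plane ≃L[ℝ] Plane) :
        Plane →L[ℝ] Plane) (e x) := hTc.hasStrictFDerivAt (by simp)
  set Q := hstrict.toOpenPartialHomeomorph T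
  have hQ : (Q : Plane → Plane) = T := hstrict.toOpenPartialHomeomorph_coe
  have hxQ : e x ∈ Q.source := hstrict.mem_toOpenPartialHomeomorph_source
  have hev : ∀ᶠ v in 𝓝 (e x), 0 < (localDegree o o' f x : ℝ) * (fderiv ℝ T v).det := by
    have hc : ContinuousAt (fun v ↦ (localDegree o o' f x : ℝ) * (fderiv ℝ T v).det) (e x) :=
      continuousAt_const.mul (continuous_det.continuousAt.comp (hTc.continuousAt_fderiv (by simp)))
    exact hc.eventually (lt_mem_nhds hpos)
  obtain ⟨O, hO, hOopen, hxO⟩ := eventually_nhds_iff.1 (hev.and (Q.open_source.mem_nhds hxQ))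
  have hUo : IsOpen ((e.source ∩ e ⁻¹' O) ∩ (G ∩ f ⁻¹' e'.source)) :=
    (e.isOpen_inter_preimage hOopen).inter (hG.inter (e'.open_source.preimage hf.continuous))
  set U := (e.source ∩ e ⁻¹' O) ∩ (G ∩ f ⁻¹' e'.source)
  have hUe : U ⊆ e.source := fun z hz ↦ hz.1.1
  have hfz (z : M) (hz : z ∈ U) : f z = e'.symm (T (e z)) := by
    change f z = e'.symm (e' (f (e.symm (e z))))
    rw [e.left_inv (hUe hz), e'.left_inv hz.2.2]
  have hTz (z : M) (hz : z ∈ U) : T (e z) = e' (f z) := by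
    change e' (f (e.symm (e z))) = _
    rw [e.left_inv (hUe hz)]
  refine ⟨U, fun z hz ↦ hz.2.1, hUo, ⟨⟨hx, hxO⟩, hxG, hx'⟩, hUe, fun z hz ↦ hz.2.2, ?_, ?_,
    fun z hz ↦ (hO _ hz.1.2).1⟩
  · intro z hz w hw hzw
    have h1 : T (e z) = T (e w) := by rw [hTz z hz, hTz w hw, hzw]
    rw [← hQ] at h1
    exact e.injOn (hUe hz) (hUe hw) (Q.injOn (hO _ hz.1.2).2 (hO _ hw.1.2).2 h1)
  · have h1 : f '' U = e'.symm '' (T '' (e '' U)) := by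
      rw [image_image, image_image]
      exact image_congr hfz
    have h2 : IsOpen (e '' U) := e.isOpen_image_of_subset_source hUo hUe
    have h3 : IsOpen (T '' (e '' U)) := by
      rw [← hQ]
      refine Q.isOpen_image_of_subset_source h2 ?_
      rintro _ ⟨z, hz, rfl⟩
      exact (hO _ hz.1.2).2
    rw [h1]
    refine e'.symm.isOpen_image_of_subset_source h3 ?_
    rintro _ ⟨_, ⟨z, hz, rfl⟩, rfl⟩
    rw [hTz z hz]
    exact e'.map_source hz.2.2

theorem finite_fiber_of_isRegularValue [CompactSpace M] [T2Space N] (o : SurfaceOrientation M)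
    (o' : SurfaceOrientation N) (hf : ContMDiff (𝓡 2) (𝓡 2) ∞ f) {y : N} (hy : IsRegularValue f y) : (f ⁻¹' {y}).Finite := by
  have hcl : IsCompact (f ⁻¹' {y}) := (isClosed_singleton.preimage hf.continuous).isCompact
  have h (x : M) (hx : x ∈ f ⁻¹' {y}) : ∃ U ∈ 𝓝 x, InjOn f U := by
    have hd : (mder f x).det ≠ 0 := (surjective_iff_det_ne_zero _).1 (hy x hx)
    obtain ⟨U, -, hU, hxU, -, -, hinj, -⟩ := exists_nhds_injOn (isPositiveChart_posChart o x)
      (isPositiveChart_posChart o' (f x)) hf (mem_posChart o x) (mem_posChart o' (f x)) hd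
      isOpen_univ (mem_univ x)
    exact ⟨U, hU.mem_nhds hxU, hinj⟩
  choose! U hU hinj using h
  obtain ⟨t, ht, hcover⟩ := hcl.elim_nhds_subcover U hU
  refine t.finite_toSet.subset fun z hz ↦ ?_
  obtain ⟨x, hxt, hzx⟩ := mem_iUnion₂.1 (hcover hz)
  have hxf := ht x hxt
  have : z = x := hinj x hxf hzx (mem_of_mem_nhds (hU x hxf))
    ((hz : f z = y).trans (hxf : f x = y).symm)
  rwa [this]

/-- Sard's theorem in equal dimensions: a smooth map from a compact surface has a regular value. -/
theorem exists_isRegularValue [CompactSpace M] [Nonempty N] (o : SurfaceOrientation M)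
    (o' : SurfaceOrientation N) (hf : ContMDiff (𝓡 2) (𝓡 2) ∞ f) : ∃ y, IsRegularValue f y := by
  obtain ⟨y₀⟩ := ‹Nonempty N›
  have he' := isPositiveChart_posChart o' y₀
  have hy₀ := mem_posChart o' y₀
  set e' := posChart o' y₀
  obtain ⟨t, -, ht⟩ := isCompact_univ.elim_nhds_subcover (fun x ↦ (posChart o x).source)
    fun x _ ↦ (posChart o x).open_source.mem_nhds (mem_posChart o x)
  set C : M → Set Plane := fun x ↦ {u | u ∈ (posChart o x).target ∧
    f ((posChart o x).symm u) ∈ e'.source ∧ (fderiv ℝ (inCharts (posChart o x) e' f) u).det = 0}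
  have hnull (x : M) : volume (inCharts (posChart o x) e' f '' C x) = 0 := by
    refine addHaar_image_eq_zero_of_det_fderivWithin_eq_zero volume
      (f' := fderiv ℝ (inCharts (posChart o x) e' f)) (fun u hu ↦ ?_) fun u hu ↦ hu.2.2
    exact ((contDiffAt_inCharts (isPositiveChart_posChart o x).mem he'.mem hf hu.1
      hu.2.1).differentiableAt (by simp)).hasFDerivAt.hasFDerivWithinAt
  by_contra hn
  push Not at hn
  have hsub : e'.target ⊆ ⋃ x ∈ t, inCharts (posChart o x) e' f '' C x := by
    intro v hv
    have hv' := hn (e'.symm v)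
    unfold IsRegularValue at hv'
    push Not at hv'
    obtain ⟨z, hz, hzs⟩ := hv'
    obtain ⟨x, hx, hzx⟩ := mem_iUnion₂.1 (ht (mem_univ z))
    have hd : (mder f z).det = 0 := by
      by_contra hne
      exact hzs ((surjective_iff_det_ne_zero _).2 hne)
    have hzz := (posChart o x).left_inv hzx
    have hzs' : f ((posChart o x).symm (posChart o x z)) ∈ e'.source := by
      rw [hzz, hz]
      exact e'.map_target hv
    refine mem_iUnion₂.2 ⟨x, hx, posChart o x z, ⟨(posChart o x).map_source hzx, hzs', ?_⟩, ?_⟩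
    · rw [fderiv_inCharts (isPositiveChart_posChart o x).mem he'.mem hf
        ((posChart o x).map_source hzx) hzs', hzz, det_comp, det_comp, hd, zero_mul, mul_zero]
    · change e' (f ((posChart o x).symm (posChart o x z))) = v
      rw [hzz, hz, e'.right_inv hv]
  have h0 : volume e'.target = 0 := measure_mono_null hsub
    ((measure_biUnion_null_iff t.countable_toSet).2 fun x _ ↦ hnull x)
  exact (e'.open_target.measure_pos volume ⟨_, e'.map_source hy₀⟩).ne' h0

variable [IsManifold (𝓡 2) ∞ M] [T2Space M] [CompactSpace M]
  [IsManifold (𝓡 2) ∞ N] [T2Space N] [CompactSpace N]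

/-- The part of the pullback of a two-form that lies on an open set on which the map is injective
contributes the integral of the two-form, up to sign. -/
theorem surfaceIntegral_indicator_pullback₂ {e : OpenPartialHomeomorph M Plane}
    (he : IsPositiveChart o e) {e' : OpenPartialHomeomorph N Plane} (he' : IsPositiveChart o' e')
    (hf : ContMDiff (𝓡 2) (𝓡 2) ∞ f) {U : Set M} (hU : IsOpen U) (hUe : U ⊆ e.source)
    (hUf : MapsTo f U e'.source) (hinj : InjOn f U) {s : ℝ} (hs : |s| = 1)
    (hdet : ∀ z ∈ U, 0 < s * (fderiv ℝ (inCharts e e' f) (e z)).det)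
    {W : N → ℝ} (hW : IsContForm W) (hWs : tsupport W ⊆ f '' U)
    (hWU : IsContForm (U.indicator (pullback₂ f W))) {K : Set M} (hK : IsCompact K)
    (hKe : K ⊆ e.source) (hKW : ∀ x, U.indicator (pullback₂ f W) x ≠ 0 → x ∈ K) :
    surfaceIntegral o (U.indicator (pullback₂ f W)) = s * surfaceIntegral o' W := by
  set T := inCharts e e' f
  have heU : IsOpen (e '' U) := e.isOpen_image_of_subset_source hU hUe
  have hsub : e '' U ⊆ e.target := by
    rintro _ ⟨z, hz, rfl⟩
    exact e.map_source (hUe hz)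
  have hTz (z : M) (hz : z ∈ U) : T (e z) = e' (f z) := by
    change e' (f (e.symm (e z))) = _
    rw [e.left_inv (hUe hz)]
  have hmem (u : Plane) (hu : u ∈ e '' U) : e.symm u ∈ U ∧ e (e.symm u) = u := by
    obtain ⟨z, hz, rfl⟩ := hu
    rw [e.left_inv (hUe hz)]
    exact ⟨hz, rfl⟩
  have hWe' : tsupport W ⊆ e'.source := hWs.trans (by
    rintro _ ⟨z, hz, rfl⟩
    exact hUf hz)
  have himage : T '' (e '' U) ⊆ e'.target := by
    rintro _ ⟨_, ⟨z, hz, rfl⟩, rfl⟩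
    rw [hTz z hz]
    exact e'.map_source (hUf hz)
  have hTinj : InjOn T (e '' U) := by
    rintro _ ⟨z, hz, rfl⟩ _ ⟨w, hw, rfl⟩ h
    rw [hTz z hz, hTz w hw] at h
    rw [hinj hz hw (e'.injOn (hUf hz) (hUf hw) h)]
  have h1 : ∫ u in e'.target, rep₂ e' W u = ∫ u in T '' (e '' U), rep₂ e' W u := by
    refine setIntegral_eq_of_subset_of_forall_sdiff_eq_zero e'.open_target.measurableSet himage
      fun v hv ↦ ?_
    by_contra h
    obtain ⟨z, hz, hzv⟩ := hWs (subset_tsupport _ (left_ne_zero_of_mul h))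
    refine hv.2 ⟨e z, ⟨z, hz, rfl⟩, ?_⟩
    rw [hTz z hz, hzv, e'.right_inv hv.1]
  have h2 : ∫ u in e.target, rep₂ e (U.indicator (pullback₂ f W)) u
      = ∫ u in e '' U, rep₂ e (U.indicator (pullback₂ f W)) u := by
    refine setIntegral_eq_of_subset_of_forall_sdiff_eq_zero e.open_target.measurableSet hsub
      fun v hv ↦ ?_
    by_contra h
    have h3 := mem_of_indicator_ne_zero (left_ne_zero_of_mul h)
    exact hv.2 ⟨_, h3, e.right_inv hv.1⟩
  rw [surfaceIntegral_eq_setIntegral he hWU hK hKe hKW,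
    surfaceIntegral_eq_setIntegral he' hW (isClosed_tsupport W).isCompact hWe'
      (fun x hx ↦ subset_tsupport _ hx), h1, h2,
    integral_image_eq_integral_abs_det_fderiv_smul _ heU.measurableSet (f' := fderiv ℝ T) _ hTinj,
    ← integral_const_mul]
  · refine setIntegral_congr_fun heU.measurableSet fun u hu ↦ ?_
    obtain ⟨hz, hzu⟩ := hmem u hu
    have hd := hdet _ hz
    rw [hzu] at hd
    have habs : |(fderiv ℝ T u).det| = s * (fderiv ℝ T u).det := by
      rw [← abs_of_pos hd, abs_mul, hs, one_mul]
    have hss : s * s = 1 := by rw [← abs_mul_abs_self, hs, one_mul]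
    have hrep : rep₂ e (U.indicator (pullback₂ f W)) u = rep₂ e (pullback₂ f W) u := by
      rw [rep₂, indicator_of_mem hz, rep₂]
    simp only [smul_eq_mul]
    rw [hrep, rep₂_pullback₂ he.mem he'.mem hf W (hsub hu) (hUf hz), habs, ← mul_assoc,
      ← mul_assoc, hss, one_mul]
  · intro u hu
    exact ((contDiffAt_inCharts he.mem he'.mem hf (hsub hu) (hUf (hmem u hu).1)).differentiableAt
      (by simp)).hasFDerivAt.hasFDerivWithinAt

/-- Over a regular value, the points counted with signs add up to zero, provided that the two-forms
supported near that value pull back to two-forms with integral zero. -/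
theorem sum_localDegree_eq_zero (hf : ContMDiff (𝓡 2) (𝓡 2) ∞ f) {η : N → ℝ}
    (hη : IsPositiveForm o' η) {y : N} (hy : IsRegularValue f y) {V : Set N} (hV : IsOpen V)
    (hyV : y ∈ V) (h0 : ∀ W, IsSmoothForm W → tsupport W ⊆ V →
      surfaceIntegral o (pullback₂ f W) = 0) :
    ∑ᶠ x ∈ f ⁻¹' {y}, localDegree o o' f x = 0 := by
  classical
  have hfin := finite_fiber_of_isRegularValue o o' hf hy
  obtain ⟨G, hG, hdisj⟩ := hfin.t2_separation
  have he' := isPositiveChart_posChart o' y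
  set e' := posChart o' y
  have h (x : M) (hx : x ∈ f ⁻¹' {y}) := exists_nhds_injOn (isPositiveChart_posChart o x) he' hf
    (mem_posChart o x) ((hx : f x = y) ▸ mem_posChart o' y)
    ((surjective_iff_det_ne_zero _).1 (hy x hx)) (hG x).2 (hG x).1
  choose! U hUG hU hxU hUe hUf hinj hopen hdet using h
  set s := hfin.toFinset
  have hs (x : M) : x ∈ s ↔ f x = y := by simp [s]
  -- a neighbourhood of `y` whose preimage is contained in the union of the sets `U x`
  set B : Set M := ⋃ x ∈ s, U x
  have hB : IsOpen B := isOpen_biUnion fun x hx ↦ hU x ((hs x).1 hx)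
  have hfB : IsClosed (f '' Bᶜ) := (hB.isClosed_compl.isCompact.image hf.continuous).isClosed
  set V' : Set N := V ∩ (f '' Bᶜ)ᶜ ∩ ⋂ x ∈ s, f '' U x
  have hV' : IsOpen V' := (hV.inter hfB.isOpen_compl).inter
    (isOpen_biInter_finset fun x hx ↦ hopen x ((hs x).1 hx))
  have hyV' : y ∈ V' := by
    refine ⟨⟨hyV, ?_⟩, mem_iInter₂.2 fun x hx ↦ ⟨x, hxU x ((hs x).1 hx), (hs x).1 hx⟩⟩
    rintro ⟨x, hx, hxy⟩
    exact hx (mem_iUnion₂.2 ⟨x, (hs x).2 hxy, hxU x hxy⟩)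
  obtain ⟨ρ, hρ, hρs, hρ0, -, hρ1⟩ :=
    exists_bump_function (hV'.inter e'.open_source) (⟨hyV', mem_posChart o' y⟩ : y ∈ V' ∩ e'.source)
  set W : N → ℝ := fun x ↦ ρ x * η x
  have hW : IsSmoothForm W := hη.smooth.mul hρ
  have hWs : tsupport W ⊆ V' :=
    ((tsupport_mul_subset_left (f := ρ) (g := η)).trans hρs).trans inter_subset_left
  have hWpos : 0 < surfaceIntegral o' W :=
    surfaceIntegral_pos hη he' hρ (hρs.trans inter_subset_right) hρ0 (y := y) (by simp [hρ1])
  have hzero := h0 W hW (hWs.trans fun z hz ↦ hz.1.1)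
  have hpc := isContForm_pullback₂ hf hW.isContForm
  set P := pullback₂ f W
  have hP0 (z : M) (hz : f z ∉ tsupport W) : P z = 0 := by
    simp only [P, pullback₂]
    rw [image_eq_zero_of_notMem_tsupport hz, zero_mul]
  have hcov (z : M) (hz : f z ∈ tsupport W) : ∃ x ∈ s, z ∈ U x := by
    by_contra hn
    push Not at hn
    refine (hWs hz).1.2 ⟨z, fun hzB ↦ ?_, rfl⟩
    obtain ⟨x, hx, hzx⟩ := mem_iUnion₂.1 hzB
    exact hn x hx hzx
  have hUdisj (x x' : M) (hx : x ∈ s) (hx' : x' ∈ s) (z : M) (hz : z ∈ U x) (hz' : z ∈ U x') :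
      x = x' := by
    by_contra hne
    exact (Set.disjoint_left.1 (hdisj ((hs x).1 hx) ((hs x').1 hx') hne))
      (hUG x ((hs x).1 hx) hz) (hUG x' ((hs x').1 hx') hz')
  have hsum : P = fun z ↦ ∑ x ∈ s, (U x).indicator P z := by
    ext z
    by_cases hz : f z ∈ tsupport W
    · obtain ⟨x, hx, hzx⟩ := hcov z hz
      rw [Finset.sum_eq_single_of_mem x hx, indicator_of_mem hzx]
      intro x' hx' hne
      exact indicator_of_notMem (fun hz' ↦ hne (hUdisj x' x hx' hx z hz' hzx)) _
    · rw [hP0 z hz]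
      exact (Finset.sum_eq_zero fun x _ ↦ indicator_apply_eq_zero.2 fun _ ↦ hP0 z hz).symm
  have hclosed (x : M) (hx : x ∈ s) : IsClosed (f ⁻¹' tsupport W ∩ U x) := by
    have : f ⁻¹' tsupport W ∩ U x = f ⁻¹' tsupport W ∩ (⋃ x' ∈ s \ {x}, U x')ᶜ := by
      ext z
      refine and_congr_right fun hz ↦ ⟨fun hzx hzn ↦ ?_, fun hzn ↦ ?_⟩
      · obtain ⟨x', hx', hzx'⟩ := mem_iUnion₂.1 hzn
        rw [Finset.mem_sdiff, Finset.mem_singleton] at hx'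
        exact hx'.2 (hUdisj x' x hx'.1 hx z hzx' hzx)
      · obtain ⟨x', hx', hzx'⟩ := hcov z hz
        by_cases hxx : x' = x
        · rwa [← hxx]
        · exact absurd (mem_iUnion₂.2 ⟨x', by simp [hx', hxx], hzx'⟩) hzn
    rw [this]
    refine ((isClosed_tsupport W).preimage hf.continuous).inter (IsOpen.isClosed_compl ?_)
    exact isOpen_biUnion fun x' hx' ↦ hU x' ((hs x').1 (Finset.mem_sdiff.1 hx').1)
  have hPx (x : M) (z : M) (hz : (U x).indicator P z ≠ 0) : z ∈ f ⁻¹' tsupport W ∩ U x :=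
    ⟨by_contra fun hn ↦ hz (indicator_apply_eq_zero.2 fun _ ↦ hP0 z hn), mem_of_indicator_ne_zero hz⟩
  have hcont (x : M) (hx : x ∈ s) : IsContForm ((U x).indicator P) := by
    refine isContForm_of_local fun z ↦ ?_
    have hc := chart_mem_maximalAtlas (I := 𝓡 2) (n := ∞) z
    have hzc := mem_chart_source Plane z
    refine ⟨chartAt Plane z, hc, hzc, ?_⟩
    set c := chartAt Plane z
    have htc := c.continuousAt_symm (c.map_source hzc)
    rw [ContinuousAt, c.left_inv hzc] at htc
    by_cases hz : z ∈ U x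
    · refine ((hpc c hc).continuousAt (c.open_target.mem_nhds (c.map_source hzc))).congr ?_
      filter_upwards [htc.eventually ((hU x ((hs x).1 hx)).mem_nhds hz)] with v hv
      rw [rep₂, rep₂, indicator_of_mem hv]
    · refine (continuousAt_const (y := (0 : ℝ))).congr ?_
      have hz' : z ∈ (f ⁻¹' tsupport W ∩ U x)ᶜ := fun h ↦ hz h.2
      filter_upwards [htc.eventually ((hclosed x hx).isOpen_compl.mem_nhds hz')] with v hv
      have : (U x).indicator P (c.symm v) = 0 := by_contra fun h ↦ hv (hPx x _ h)
      rw [rep₂, this, zero_mul]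
  rw [hsum, surfaceIntegral_sum o s hcont] at hzero
  have hterm (x : M) (hx : x ∈ s) : surfaceIntegral o ((U x).indicator P)
      = (localDegree o o' f x : ℝ) * surfaceIntegral o' W := by
    have hx' := (hs x).1 hx
    exact surfaceIntegral_indicator_pullback₂ (isPositiveChart_posChart o x) he' hf (hU x hx')
      (hUe x hx') (hUf x hx') (hinj x hx') (abs_localDegree x) (hdet x hx') hW.isContForm
      (hWs.trans fun z hz ↦ mem_iInter₂.1 hz.2 x hx) (hcont x hx) (hclosed x hx).isCompact
      (fun z hz ↦ hUe x hx' hz.2) (hPx x)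
  rw [Finset.sum_congr rfl hterm, ← Finset.sum_mul] at hzero
  have hz := (mul_eq_zero.1 hzero).resolve_right hWpos.ne'
  rw [finsum_mem_eq_finite_toFinset_sum _ hfin]
  exact_mod_cast hz

/-- A map to a connected surface has degree zero if some positive two-form pulls back to a two-form
with integral zero. -/
theorem hasDegree_zero [ConnectedSpace N] (o : SurfaceOrientation M) (o' : SurfaceOrientation N)
    (hf : ContMDiff (𝓡 2) (𝓡 2) ∞ f) {η : N → ℝ} (hη : IsPositiveForm o' η)
    (h0 : surfaceIntegral o (pullback₂ f η) = 0) : HasDegree o o' f 0 where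
  exists_regularValue := exists_isRegularValue o o' hf
  finite_fiber y hy := finite_fiber_of_isRegularValue o o' hf hy
  count_eq y hy := by
    obtain ⟨V, hV, hyV, hV0⟩ := exists_nhds_surfaceIntegral_pullback₂_eq_zero o o' hf hη h0 y
    exact sum_localDegree_eq_zero hf hη hy hV hyV hV0

end

end

section

/-! ### The metric in a chart and its Christoffel symbols -/

theorem mder_symm_apply_ne_zero {M : Type*} [TopologicalSpace M] [ChartedSpace Plane M]
    {e : OpenPartialHomeomorph M Plane} (he : e ∈ maximalAtlas (𝓡 2) ∞ M) {u : Plane}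
    (hu : u ∈ e.target) {v : Plane} (hv : v ≠ 0) : mder e.symm u v ≠ 0 := fun h ↦ by
  have h2 := congrArg (fun L : Plane →L[ℝ] Plane ↦ L v) (mder_comp_mder_symm he hu)
  simp only [ContinuousLinearMap.comp_apply, h, map_zero, ContinuousLinearMap.id_apply] at h2
  exact hv h2.symm

theorem contDiffOn_partialDeriv {f : Plane → ℝ} {U : Set Plane} (hU : IsOpen U)
    (hf : ContDiffOn ℝ ∞ f U) (i : Fin 2) : ContDiffOn ℝ ∞ (partialDeriv i f) U :=
  (hf.fderiv_of_isOpen hU (by simp)).clm_apply contDiffOn_const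

variable {M : Type*} [TopologicalSpace M] [ChartedSpace Plane M] [IsManifold (𝓡 2) ∞ M]

theorem contMDiffOn_coordVector {e : OpenPartialHomeomorph M Plane}
    (he : e ∈ maximalAtlas (𝓡 2) ∞ M) (i : Fin 2) :
    ContMDiffOn (𝓡 2) (𝓡 2).tangent ∞
      (fun u : Plane ↦ (⟨e.symm u, coordVector e u i⟩ : TangentBundle (𝓡 2) M)) e.target := by
  have h1 := (contMDiffOn_symm_of_mem_maximalAtlas he).contMDiffOn_tangentMapWithin (m := ∞)
    (by simp) e.open_target.uniqueMDiffOn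
  have h2 : ContMDiff (𝓡 2) (𝓡 2).tangent ∞
      (fun u : Plane ↦ (⟨u, stdVec i⟩ : TangentBundle (𝓡 2) Plane)) :=
    contMDiff_vectorSpace_iff_contDiff.2 contDiff_const
  refine (h1.comp h2.contMDiffOn (fun u hu ↦ hu)).congr fun u hu ↦ ?_
  simp only [Function.comp, tangentMapWithin]
  rw [mfderivWithin_of_isOpen e.open_target hu]
  rfl

theorem contDiffOn_metricMatrix (g : SurfaceMetric M) {e : OpenPartialHomeomorph M Plane}
    (he : e ∈ maximalAtlas (𝓡 2) ∞ M) (i j : Fin 2) :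
    ContDiffOn ℝ ∞ (fun u ↦ metricMatrix g e u i j) e.target := by
  rw [← contMDiffOn_iff_contDiffOn]
  have h1 := g.contMDiff.comp_contMDiffOn (contMDiffOn_symm_of_mem_maximalAtlas he)
  have h := ContMDiffOn.clm_bundle_apply₂ (F₃ := ℝ) (E₃ := Bundle.Trivial M ℝ) h1
    (contMDiffOn_coordVector he i) (contMDiffOn_coordVector he j)
  intro u hu
  have h2 := h u hu
  simp only [Bundle.contMDiffWithinAt_totalSpace] at h2
  exact h2.2

/-- The inner product of a Riemannian metric at a point, as a bilinear form on the model plane. -/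
def innerAt (g : SurfaceMetric M) (x : M) : Plane →L[ℝ] Plane →L[ℝ] ℝ := g.inner x

theorem innerAt_symm (g : SurfaceMetric M) (x : M) (v w : Plane) :
    innerAt g x v w = innerAt g x w v :=
  g.symm x v w

theorem innerAt_pos (g : SurfaceMetric M) (x : M) {v : Plane} (hv : v ≠ 0) :
    0 < innerAt g x v v :=
  g.pos x v hv

theorem metricMatrix_apply (g : SurfaceMetric M) (e : OpenPartialHomeomorph M Plane) (u : Plane)
    (i j : Fin 2) : metricMatrix g e u i j
      = innerAt g (e.symm u) (mder e.symm u (stdVec i)) (mder e.symm u (stdVec j)) :=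
  rfl

theorem metricMatrix_symm (g : SurfaceMetric M) (e : OpenPartialHomeomorph M Plane) (u : Plane)
    (i j : Fin 2) : metricMatrix g e u i j = metricMatrix g e u j i :=
  innerAt_symm g _ _ _

theorem innerAt_mder (g : SurfaceMetric M) (e : OpenPartialHomeomorph M Plane) (u v w : Plane) :
    innerAt g (e.symm u) (mder e.symm u v) (mder e.symm u w)
      = v 0 * w 0 * metricMatrix g e u 0 0 + (v 0 * w 1 + v 1 * w 0) * metricMatrix g e u 0 1
        + v 1 * w 1 * metricMatrix g e u 1 1 := by
  have h := metricMatrix_symm g e u 1 0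
  rw [eq_add_stdVec v, eq_add_stdVec w]
  simp only [map_add, map_smul, add_apply, smul_apply, smul_eq_mul, metricMatrix_apply] at h ⊢
  rw [h]
  simp
  ring

theorem inv_metricMatrix (g : SurfaceMetric M) (e : OpenPartialHomeomorph M Plane) (u : Plane) :
    (metricMatrix g e u)⁻¹ = (metricMatrix g e u 0 0 * metricMatrix g e u 1 1
      - metricMatrix g e u 0 1 ^ 2)⁻¹ •
        !![metricMatrix g e u 1 1, -metricMatrix g e u 0 1;
          -metricMatrix g e u 0 1, metricMatrix g e u 0 0] := by
  rw [Matrix.inv_def, Matrix.adjugate_fin_two, Matrix.det_fin_two, Ring.inverse_eq_inv',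
    metricMatrix_symm g e u 1 0, sq]

theorem partialDeriv_metricMatrix_symm (g : SurfaceMetric M)
    (e : OpenPartialHomeomorph M Plane) (l i j : Fin 2) (u : Plane) :
    partialDeriv l (fun u' ↦ metricMatrix g e u' i j) u
      = partialDeriv l (fun u' ↦ metricMatrix g e u' j i) u := by
  simp only [fun u' ↦ metricMatrix_symm g e u' i j]

theorem christoffel_symm (g : SurfaceMetric M) (e : OpenPartialHomeomorph M Plane) (k i j : Fin 2)
    (u : Plane) :
    christoffel g e k i j u = christoffel g e k j i u := by
  unfold christoffel
  congr 1
  refine Finset.sum_congr rfl fun l _ ↦ ?_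
  rw [partialDeriv_metricMatrix_symm g e l i j]
  ring

section Positivity

variable (g : SurfaceMetric M) {e : OpenPartialHomeomorph M Plane}
  (he : e ∈ maximalAtlas (𝓡 2) ∞ M) {u : Plane} (hu : u ∈ e.target)
include he hu

theorem metricMatrix_diag_pos (i : Fin 2) : 0 < metricMatrix g e u i i :=
  innerAt_pos g _ (mder_symm_apply_ne_zero he hu (by simp))

theorem metricMatrix_det_pos : 0 < metricMatrix g e u 0 0 * metricMatrix g e u 1 1
    - metricMatrix g e u 0 1 ^ 2 := by
  have h1 := metricMatrix_diag_pos g he hu 1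
  set v : Plane := metricMatrix g e u 1 1 • stdVec 0 - metricMatrix g e u 0 1 • stdVec 1 with hv
  have hv0 : v 0 = metricMatrix g e u 1 1 := by simp [hv]
  have hv1 : v 1 = -metricMatrix g e u 0 1 := by simp [hv]
  have hne : v ≠ 0 := fun h ↦ by
    rw [h] at hv0
    exact h1.ne hv0
  have h := innerAt_pos g (e.symm u) (mder_symm_apply_ne_zero he hu hne)
  rw [innerAt_mder, hv0, hv1] at h
  refine pos_of_mul_pos_right (a := metricMatrix g e u 1 1) ?_ h1.le
  linarith

end Positivity

section Christoffel

variable (g : SurfaceMetric M) {e : OpenPartialHomeomorph M Plane}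
  (he : e ∈ maximalAtlas (𝓡 2) ∞ M)
include he

theorem contDiffOn_christoffel (k i j : Fin 2) :
    ContDiffOn ℝ ∞ (christoffel g e k i j) e.target := by
  have hm (i j : Fin 2) := contDiffOn_metricMatrix g he i j
  have hp (l i j : Fin 2) := contDiffOn_partialDeriv e.open_target (hm i j) l
  have hD : ContDiffOn ℝ ∞ (fun u ↦ (metricMatrix g e u 0 0 * metricMatrix g e u 1 1
      - metricMatrix g e u 0 1 ^ 2)⁻¹) e.target :=
    (((hm 0 0).mul (hm 1 1)).sub ((hm 0 1).pow 2)).inv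
      fun u hu ↦ (metricMatrix_det_pos g he hu).ne'
  have hinv (k l : Fin 2) : ContDiffOn ℝ ∞ (fun u ↦ (metricMatrix g e u)⁻¹ k l) e.target := by
    simp only [inv_metricMatrix, Matrix.smul_apply, smul_eq_mul]
    refine hD.mul ?_
    fin_cases k <;> fin_cases l
    · exact hm 1 1
    · exact (hm 0 1).neg
    · exact (hm 0 1).neg
    · exact hm 0 0
  unfold christoffel
  exact contDiffOn_const.mul (ContDiffOn.sum fun l _ ↦
    (hinv k l).mul (((hp i j l).add (hp j i l)).sub (hp l i j)))

/-- Lowering the upper index of a Christoffel symbol. -/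
theorem sum_metricMatrix_mul_christoffel {u : Plane} (hu : u ∈ e.target) (m i j : Fin 2) :
    metricMatrix g e u m 0 * christoffel g e 0 i j u
      + metricMatrix g e u m 1 * christoffel g e 1 i j u
      = (1 / 2) * (partialDeriv i (fun u' ↦ metricMatrix g e u' j m) u
        + partialDeriv j (fun u' ↦ metricMatrix g e u' i m) u
        - partialDeriv m (fun u' ↦ metricMatrix g e u' i j) u) := by
  have hD := (metricMatrix_det_pos g he hu).ne'
  simp only [christoffel, inv_metricMatrix, Fin.sum_univ_two, Matrix.smul_apply, smul_eq_mul]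
  have hs := metricMatrix_symm g e u 1 0
  fin_cases m <;> simp [hs] <;> field_simp <;> ring

/-- The Levi-Civita connection is compatible with the metric. -/
theorem partialDeriv_metricMatrix {u : Plane} (hu : u ∈ e.target) (i j m : Fin 2) :
    partialDeriv i (fun u' ↦ metricMatrix g e u' j m) u
      = metricMatrix g e u m 0 * christoffel g e 0 i j u
        + metricMatrix g e u m 1 * christoffel g e 1 i j u
        + (metricMatrix g e u j 0 * christoffel g e 0 i m u
        + metricMatrix g e u j 1 * christoffel g e 1 i m u) := by
  rw [sum_metricMatrix_mul_christoffel g he hu, sum_metricMatrix_mul_christoffel g he hu,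
    partialDeriv_metricMatrix_symm g e i m j]
  ring

end Christoffel

end

section

/-! ### The structure equations of an orthonormal coframe -/

section Components

variable {F : Type*} [NormedAddCommGroup F] [NormedSpace ℝ F]

/-- The one-form `a₀ du₀ + a₁ du₁` at a point. -/
def ofComponents (a₀ a₁ : F) : Plane →L[ℝ] F :=
  (EuclideanSpace.proj 0 : Plane →L[ℝ] ℝ).smulRight a₀
    + (EuclideanSpace.proj 1 : Plane →L[ℝ] ℝ).smulRight a₁

@[simp]
theorem ofComponents_apply (a₀ a₁ : F) (v : Plane) :
    ofComponents a₀ a₁ v = v 0 • a₀ + v 1 • a₁ := by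
  simp [ofComponents]

theorem curl_ofComponents {a₀ a₁ : Plane → F} {u : Plane} (h₀ : DifferentiableAt ℝ a₀ u)
    (h₁ : DifferentiableAt ℝ a₁ u) :
    curl (fun u ↦ ofComponents (a₀ u) (a₁ u)) u
      = fderiv ℝ a₁ u (stdVec 0) - fderiv ℝ a₀ u (stdVec 1) := by
  set P : Fin 2 → F →L[ℝ] Plane →L[ℝ] F :=
    fun i ↦ ContinuousLinearMap.smulRightL ℝ Plane F (EuclideanSpace.proj i)
  have hP (i : Fin 2) {a : Plane → F} (ha : DifferentiableAt ℝ a u) :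
      HasFDerivAt (fun u ↦ P i (a u)) ((P i).comp (fderiv ℝ a u)) u :=
    (P i).hasFDerivAt.comp u ha.hasFDerivAt
  have h : HasFDerivAt (fun u ↦ ofComponents (a₀ u) (a₁ u)) _ u := (hP 0 h₀).add (hP 1 h₁)
  rw [curl, h.fderiv]
  simp [P]

theorem contDiffOn_ofComponents {a₀ a₁ : Plane → F} {U : Set Plane} {n : WithTop ℕ∞}
    (h₀ : ContDiffOn ℝ n a₀ U) (h₁ : ContDiffOn ℝ n a₁ U) :
    ContDiffOn ℝ n (fun u ↦ ofComponents (a₀ u) (a₁ u)) U :=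
  ((ContinuousLinearMap.smulRightL ℝ Plane F
      (EuclideanSpace.proj 0)).contDiff.comp_contDiffOn h₀).add
    ((ContinuousLinearMap.smulRightL ℝ Plane F
      (EuclideanSpace.proj 1)).contDiff.comp_contDiffOn h₁)

end Components

section PartialDeriv

variable {f f' : Plane → ℝ} {u : Plane} (i : Fin 2)

theorem partialDeriv_mul (hf : DifferentiableAt ℝ f u) (hf' : DifferentiableAt ℝ f' u) :
    partialDeriv i (fun u ↦ f u * f' u) u
      = partialDeriv i f u * f' u + f u * partialDeriv i f' u := by
  simp only [partialDeriv]
  rw [fderiv_fun_mul hf hf']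
  simp
  ring

theorem partialDeriv_add (hf : DifferentiableAt ℝ f u) (hf' : DifferentiableAt ℝ f' u) :
    partialDeriv i (fun u ↦ f u + f' u) u = partialDeriv i f u + partialDeriv i f' u := by
  simp only [partialDeriv]
  rw [fderiv_fun_add hf hf']
  simp

theorem partialDeriv_sub (hf : DifferentiableAt ℝ f u) (hf' : DifferentiableAt ℝ f' u) :
    partialDeriv i (fun u ↦ f u - f' u) u = partialDeriv i f u - partialDeriv i f' u := by
  simp only [partialDeriv]
  rw [fderiv_fun_sub hf hf']
  simp

theorem partialDeriv_const_mul (c : ℝ) (hf : DifferentiableAt ℝ f u) :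
    partialDeriv i (fun u ↦ c * f u) u = c * partialDeriv i f u := by
  simp only [partialDeriv]
  rw [fderiv_const_mul hf]
  simp

omit i in
theorem hasFDerivAt_div (hf : DifferentiableAt ℝ f u) (hf' : DifferentiableAt ℝ f' u)
    (h : f' u ≠ 0) : HasFDerivAt (fun u ↦ f u / f' u)
      ((f' u ^ 2)⁻¹ • (f' u • fderiv ℝ f u - f u • fderiv ℝ f' u)) u := by
  have h1 := hf.hasFDerivAt.mul ((hasDerivAt_inv h).comp_hasFDerivAt u hf'.hasFDerivAt)
  refine h1.congr_fderiv ?_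
  ext v
  simp
  field_simp
  ring

theorem partialDeriv_div (hf : DifferentiableAt ℝ f u) (hf' : DifferentiableAt ℝ f' u)
    (h : f' u ≠ 0) : partialDeriv i (fun u ↦ f u / f' u) u
      = (partialDeriv i f u * f' u - f u * partialDeriv i f' u) / f' u ^ 2 := by
  simp only [partialDeriv]
  rw [(hasFDerivAt_div hf hf' h).fderiv]
  simp
  ring

theorem partialDeriv_sqrt (hf : DifferentiableAt ℝ f u) (h : f u ≠ 0) :
    partialDeriv i (fun u ↦ √(f u)) u = partialDeriv i f u / (2 * √(f u)) := by
  simp only [partialDeriv]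
  rw [fderiv_sqrt hf h]
  simp
  ring

theorem partialDeriv_comm {U : Set Plane} (hU : IsOpen U) (hu : u ∈ U) (hf : ContDiffOn ℝ ∞ f U) :
    partialDeriv 0 (partialDeriv 1 f) u = partialDeriv 1 (partialDeriv 0 f) u := by
  have hc : ContDiffAt ℝ ∞ f u := hf.contDiffAt (hU.mem_nhds hu)
  have hd : DifferentiableAt ℝ (fderiv ℝ f) u :=
    (hc.fderiv_right (m := 1) (by norm_cast)).differentiableAt (by norm_num)
  have hs : IsSymmSndFDerivAt ℝ f u := hc.isSymmSndFDerivAt (by simp; norm_cast)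
  have h (i j : Fin 2) : partialDeriv i (partialDeriv j f) u
      = fderiv ℝ (fderiv ℝ f) u (stdVec i) (stdVec j) := by
    have : HasFDerivAt (partialDeriv j f) _ u :=
      hd.hasFDerivAt.clm_apply (hasFDerivAt_const (stdVec j) u)
    rw [partialDeriv, this.fderiv]
    simp
  rw [h, h, hs]

end PartialDeriv

variable {M : Type*} [TopologicalSpace M] [ChartedSpace Plane M] [IsManifold (𝓡 2) ∞ M]

/-- The area density `√(det (g_ij))` of a metric in a chart. -/
def areaDensity (g : SurfaceMetric M) (e : OpenPartialHomeomorph M Plane) (u : Plane) : ℝ :=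
  √(metricMatrix g e u 0 0 * metricMatrix g e u 1 1 - metricMatrix g e u 0 1 ^ 2)

/-- The complex-valued one-form `ε¹ + i ε²` of the positive orthonormal coframe that is adapted
to the second coordinate vector field: it takes the positive real value `√g₁₁` on `∂₁`. -/
def coframe (g : SurfaceMetric M) (e : OpenPartialHomeomorph M Plane) (u : Plane) :
    Plane →L[ℝ] ℂ :=
  ofComponents
    (((metricMatrix g e u 0 1 / √(metricMatrix g e u 1 1) : ℝ) : ℂ)
      - ((areaDensity g e u / √(metricMatrix g e u 1 1) : ℝ) : ℂ) * Complex.I)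
    ((√(metricMatrix g e u 1 1) : ℝ) : ℂ)

/-- The connection form of the coframe `coframe g e`. Its value on `∂ᵢ` is the speed of rotation of
the unit vector `∂₁ / √g₁₁`, hence a multiple of the component `Γ⁰ᵢ₁` of `∇ᵢ ∂₁` along `∂₀`. -/
def connForm (g : SurfaceMetric M) (e : OpenPartialHomeomorph M Plane) (u : Plane) :
    Plane →L[ℝ] ℝ :=
  ofComponents (-(areaDensity g e u / metricMatrix g e u 1 1 * christoffel g e 0 0 1 u))
    (-(areaDensity g e u / metricMatrix g e u 1 1 * christoffel g e 0 1 1 u))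

section Structure

variable (g : SurfaceMetric M) {e : OpenPartialHomeomorph M Plane}
  (he : e ∈ maximalAtlas (𝓡 2) ∞ M)
include he

theorem contDiffOn_areaDensity : ContDiffOn ℝ ∞ (areaDensity g e) e.target :=
  (((contDiffOn_metricMatrix g he 0 0).mul (contDiffOn_metricMatrix g he 1 1)).sub
    ((contDiffOn_metricMatrix g he 0 1).pow 2)).sqrt fun _ hu ↦ (metricMatrix_det_pos g he hu).ne'

theorem contDiffOn_sqrt_metricMatrix :
    ContDiffOn ℝ ∞ (fun u ↦ √(metricMatrix g e u 1 1)) e.target :=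
  (contDiffOn_metricMatrix g he 1 1).sqrt fun _ hu ↦ (metricMatrix_diag_pos g he hu 1).ne'

theorem contDiffOn_coframe : ContDiffOn ℝ ∞ (coframe g e) e.target := by
  have h (f : Plane → ℝ) (hf : ContDiffOn ℝ ∞ f e.target) :
      ContDiffOn ℝ ∞ (fun u ↦ (f u : ℂ)) e.target := Complex.ofRealCLM.contDiff.comp_contDiffOn hf
  have hr := contDiffOn_sqrt_metricMatrix g he
  have h0 : ∀ u ∈ e.target, √(metricMatrix g e u 1 1) ≠ 0 :=
    fun u hu ↦ (Real.sqrt_pos.2 (metricMatrix_diag_pos g he hu 1)).ne'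
  exact contDiffOn_ofComponents
    ((h _ ((contDiffOn_metricMatrix g he 0 1).div hr h0)).sub
      ((h _ ((contDiffOn_areaDensity g he).div hr h0)).mul contDiffOn_const)) (h _ hr)

theorem contDiffOn_connForm : ContDiffOn ℝ ∞ (connForm g e) e.target := by
  have h := (contDiffOn_areaDensity g he).div (contDiffOn_metricMatrix g he 1 1)
    fun u hu ↦ (metricMatrix_diag_pos g he hu 1).ne'
  exact contDiffOn_ofComponents (h.mul (contDiffOn_christoffel g he 0 0 1)).neg
    (h.mul (contDiffOn_christoffel g he 0 1 1)).neg

variable {u : Plane} (hu : u ∈ e.target)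
include hu

theorem areaDensity_pos : 0 < areaDensity g e u :=
  Real.sqrt_pos.2 (metricMatrix_det_pos g he hu)

theorem areaDensity_sq : areaDensity g e u ^ 2
    = metricMatrix g e u 0 0 * metricMatrix g e u 1 1 - metricMatrix g e u 0 1 ^ 2 :=
  Real.sq_sqrt (metricMatrix_det_pos g he hu).le

theorem differentiableAt_metricMatrix (i j : Fin 2) :
    DifferentiableAt ℝ (fun u ↦ metricMatrix g e u i j) u :=
  ((contDiffOn_metricMatrix g he i j).contDiffAt (e.open_target.mem_nhds hu)).differentiableAt
    (by simp)

theorem differentiableAt_areaDensity : DifferentiableAt ℝ (areaDensity g e) u :=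
  ((contDiffOn_areaDensity g he).contDiffAt (e.open_target.mem_nhds hu)).differentiableAt (by simp)

theorem differentiableAt_christoffel (k i j : Fin 2) :
    DifferentiableAt ℝ (christoffel g e k i j) u :=
  ((contDiffOn_christoffel g he k i j).contDiffAt (e.open_target.mem_nhds hu)).differentiableAt
    (by simp)

theorem partialDeriv_metricMatrix_one_one (i : Fin 2) :
    partialDeriv i (fun u ↦ metricMatrix g e u 1 1) u
      = 2 * (christoffel g e 0 i 1 u * metricMatrix g e u 0 1
        + christoffel g e 1 i 1 u * metricMatrix g e u 1 1) := by
  rw [partialDeriv_metricMatrix g he hu, metricMatrix_symm g e u 1 0]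
  ring

/-- The logarithmic derivative of the area density is the trace of the connection. -/
theorem partialDeriv_areaDensity (i : Fin 2) :
    partialDeriv i (areaDensity g e) u
      = areaDensity g e u * (christoffel g e 0 i 0 u + christoffel g e 1 i 1 u) := by
  have hm := differentiableAt_metricMatrix g he hu
  have hs := areaDensity_pos g he hu
  have hsq := areaDensity_sq g he hu
  have hfun : areaDensity g e = fun u ↦ √(metricMatrix g e u 0 0 * metricMatrix g e u 1 1
      - metricMatrix g e u 0 1 * metricMatrix g e u 0 1) := by
    ext u
    rw [areaDensity, sq]
  have h1 := partialDeriv_sqrt i (((hm 0 0).mul (hm 1 1)).sub ((hm 0 1).mul (hm 0 1)))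
    (by have := metricMatrix_det_pos g he hu; simp only [Pi.mul_apply, Pi.sub_apply]; nlinarith)
  have h2 := partialDeriv_sub i ((hm 0 0).mul (hm 1 1)) ((hm 0 1).mul (hm 0 1))
  have h3 := partialDeriv_mul i (hm 0 0) (hm 1 1)
  have h4 := partialDeriv_mul i (hm 0 1) (hm 0 1)
  have h5 : √(metricMatrix g e u 0 0 * metricMatrix g e u 1 1
      - metricMatrix g e u 0 1 * metricMatrix g e u 0 1) = areaDensity g e u := by
    rw [areaDensity, sq]
  have h6 : partialDeriv i (areaDensity g e) u
      = (partialDeriv i (fun u ↦ metricMatrix g e u 0 0) u * metricMatrix g e u 1 1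
        + metricMatrix g e u 0 0 * partialDeriv i (fun u ↦ metricMatrix g e u 1 1) u
        - (partialDeriv i (fun u ↦ metricMatrix g e u 0 1) u * metricMatrix g e u 0 1
          + metricMatrix g e u 0 1 * partialDeriv i (fun u ↦ metricMatrix g e u 0 1) u))
        / (2 * areaDensity g e u) := by
    rw [← h3, ← h4, ← h5]
    refine Eq.trans ?_ (h1.trans (congrArg (· / _) h2))
    rw [hfun]
    rfl
  rw [h6, div_eq_iff (by positivity), partialDeriv_metricMatrix_one_one g he hu,
    partialDeriv_metricMatrix g he hu i 0 0, partialDeriv_metricMatrix g he hu i 0 1,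
    metricMatrix_symm g e u 1 0]
  linear_combination (-2 * (christoffel g e 0 i 0 u + christoffel g e 1 i 1 u)) * hsq

/-- The first structure equation `dε = -i θ ∧ ε`. -/
theorem curl_coframe :
    curl (coframe g e) u = -Complex.I * (connForm g e u (stdVec 0) * coframe g e u (stdVec 1)
      - connForm g e u (stdVec 1) * coframe g e u (stdVec 0)) := by
  have hm := differentiableAt_metricMatrix g he hu
  have hda := differentiableAt_areaDensity g he hu
  have hG := metricMatrix_diag_pos g he hu 1
  have hr : 0 < √(metricMatrix g e u 1 1) := Real.sqrt_pos.2 hG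
  have hrsq : √(metricMatrix g e u 1 1) ^ 2 = metricMatrix g e u 1 1 := Real.sq_sqrt hG.le
  have hssq := areaDensity_sq g he hu
  have hdr : DifferentiableAt ℝ (fun u ↦ √(metricMatrix g e u 1 1)) u := (hm 1 1).sqrt hG.ne'
  have hp : DifferentiableAt ℝ
      (fun u ↦ metricMatrix g e u 0 1 / √(metricMatrix g e u 1 1)) u :=
    (hasFDerivAt_div (hm 0 1) hdr hr.ne').differentiableAt
  have hq : DifferentiableAt ℝ
      (fun u ↦ areaDensity g e u / √(metricMatrix g e u 1 1)) u :=
    (hasFDerivAt_div hda hdr hr.ne').differentiableAt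
  have hp' := partialDeriv_div 1 (hm 0 1) hdr hr.ne'
  have hq' := partialDeriv_div 1 hda hdr hr.ne'
  have hsqrt (i : Fin 2) := partialDeriv_sqrt i (hm 1 1) hG.ne'
  rw [hsqrt, partialDeriv_metricMatrix_one_one g he hu, partialDeriv_metricMatrix g he hu,
    metricMatrix_symm g e u 1 0] at hp'
  rw [hsqrt, partialDeriv_metricMatrix_one_one g he hu, partialDeriv_areaDensity g he hu] at hq'
  have hr0 := hsqrt 0
  rw [partialDeriv_metricMatrix_one_one g he hu] at hr0
  have hcast {f : Plane → ℝ} (hf : DifferentiableAt ℝ f u) : HasFDerivAt (fun u ↦ (f u : ℂ))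
      (Complex.ofRealCLM.comp (fderiv ℝ f u)) u :=
    Complex.ofRealCLM.hasFDerivAt.comp u hf.hasFDerivAt
  have h1 := hcast hdr
  have h0 := (hcast hp).sub ((hcast hq).mul_const Complex.I)
  have hcurl : curl (coframe g e) u
      = ((partialDeriv 0 (fun u ↦ √(metricMatrix g e u 1 1)) u : ℝ) : ℂ)
        - (((partialDeriv 1 (fun u ↦ metricMatrix g e u 0 1 / √(metricMatrix g e u 1 1)) u : ℝ) : ℂ)
          - ((partialDeriv 1 (fun u ↦ areaDensity g e u / √(metricMatrix g e u 1 1)) u : ℝ) : ℂ)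
            * Complex.I) := by
    refine (curl_ofComponents h0.differentiableAt h1.differentiableAt).trans ?_
    have e1 := h1.fderiv
    have e0 := h0.fderiv
    rw [e1]
    refine congrArg₂ (· - ·) rfl ((congrArg (fun L ↦ L (stdVec 1)) e0).trans ?_)
    simp [partialDeriv, mul_comm]
  have hΓ := christoffel_symm g e 1 1 0 u
  have hΓ' := christoffel_symm g e 0 1 0 u
  have hsplit {R P Q θ₀ θ₁ p q r : ℝ} (hre : R - P = θ₁ * q) (him : Q = θ₁ * p - θ₀ * r) :
      (R : ℂ) - (P - Q * Complex.I)
        = -Complex.I * (θ₀ * (r : ℂ) - θ₁ * ((p : ℂ) - q * Complex.I)) := by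
    apply Complex.ext
    · simpa using hre
    · simpa using him
  have hθ (i : Fin 2) : connForm g e u (stdVec i)
      = -(areaDensity g e u / metricMatrix g e u 1 1 * christoffel g e 0 i 1 u) := by
    fin_cases i <;> simp [connForm]
  have hε₀ : coframe g e u (stdVec 0)
      = ((metricMatrix g e u 0 1 / √(metricMatrix g e u 1 1) : ℝ) : ℂ)
      - ((areaDensity g e u / √(metricMatrix g e u 1 1) : ℝ) : ℂ) * Complex.I := by
    simp [coframe]
  have hε₁ : coframe g e u (stdVec 1) = ((√(metricMatrix g e u 1 1) : ℝ) : ℂ) := by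
    simp [coframe]
  rw [hcurl, hε₀, hε₁]
  refine hsplit ?_ ?_
  · rw [hr0, hp', hθ, hΓ, hΓ']
    field_simp
    rw [hrsq]
    linear_combination (metricMatrix g e u 1 1 * christoffel g e 0 1 1 u) * hssq
  · rw [hq', hθ, hθ, hΓ']
    field_simp
    rw [hrsq]
    ring

/-- The vector `R(∂₀, ∂₁) ∂₁` is orthogonal to `∂₁`: this is the symmetry of the second derivatives
of `g₁₁`, because the connection is compatible with the metric. -/
theorem sum_riemannCoeff_eq_zero :
    riemannCoeff g e 0 0 1 1 u * metricMatrix g e u 0 1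
      + riemannCoeff g e 1 0 1 1 u * metricMatrix g e u 1 1 = 0 := by
  have hm := differentiableAt_metricMatrix g he hu
  have hΓ := differentiableAt_christoffel g he hu
  have hcomm := partialDeriv_comm e.open_target hu (contDiffOn_metricMatrix g he 1 1)
  have h (i j : Fin 2) : partialDeriv j (partialDeriv i (fun u ↦ metricMatrix g e u 1 1)) u
      = 2 * ((partialDeriv j (christoffel g e 0 i 1) u * metricMatrix g e u 0 1
          + christoffel g e 0 i 1 u * partialDeriv j (fun u ↦ metricMatrix g e u 0 1) u)
        + (partialDeriv j (christoffel g e 1 i 1) u * metricMatrix g e u 1 1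
          + christoffel g e 1 i 1 u * partialDeriv j (fun u ↦ metricMatrix g e u 1 1) u)) := by
    have hev : partialDeriv i (fun u ↦ metricMatrix g e u 1 1) =ᶠ[𝓝 u] fun u ↦
        2 * (christoffel g e 0 i 1 u * metricMatrix g e u 0 1
        + christoffel g e 1 i 1 u * metricMatrix g e u 1 1) := by
      filter_upwards [e.open_target.mem_nhds hu] with v hv
      exact partialDeriv_metricMatrix_one_one g he hv i
    rw [partialDeriv, hev.fderiv_eq]
    refine (partialDeriv_const_mul j 2 (((hΓ 0 i 1).mul (hm 0 1)).add
      ((hΓ 1 i 1).mul (hm 1 1)))).trans ?_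
    congr 1
    refine (partialDeriv_add j ((hΓ 0 i 1).mul (hm 0 1)) ((hΓ 1 i 1).mul (hm 1 1))).trans ?_
    exact congrArg₂ (· + ·) (partialDeriv_mul j (hΓ 0 i 1) (hm 0 1))
      (partialDeriv_mul j (hΓ 1 i 1) (hm 1 1))
  rw [h, h] at hcomm
  simp only [partialDeriv_metricMatrix g he hu, metricMatrix_symm g e u 1 0] at hcomm
  simp only [riemannCoeff, Fin.sum_univ_two]
  rw [christoffel_symm g e 0 1 0, christoffel_symm g e 1 1 0] at *
  linear_combination (1 / 2) * hcomm

/-- The second structure equation `dθ = -K dA`. -/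
theorem curl_connForm :
    curl (connForm g e) u = -(gaussCurvature g e u * areaDensity g e u) := by
  have hm := differentiableAt_metricMatrix g he hu
  have hda := differentiableAt_areaDensity g he hu
  have hΓ := differentiableAt_christoffel g he hu
  have hG := metricMatrix_diag_pos g he hu 1
  have hD := metricMatrix_det_pos g he hu
  have hdiv := (hasFDerivAt_div hda (hm 1 1) hG.ne').differentiableAt
  have hzero := sum_riemannCoeff_eq_zero g he hu
  have hmul (i j : Fin 2) := (partialDeriv_mul i hdiv (hΓ 0 j 1)).trans
    (congrArg (· * _ + _) (partialDeriv_div i hda (hm 1 1) hG.ne'))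
  have hcurl : curl (connForm g e) u
      = -partialDeriv 0 (fun u ↦ areaDensity g e u / metricMatrix g e u 1 1
          * christoffel g e 0 1 1 u) u
        + partialDeriv 1 (fun u ↦ areaDensity g e u / metricMatrix g e u 1 1
          * christoffel g e 0 0 1 u) u := by
    refine (curl_ofComponents (hdiv.mul (hΓ 0 0 1)).neg (hdiv.mul (hΓ 0 1 1)).neg).trans ?_
    rw [fderiv_neg, fderiv_neg]
    simp [partialDeriv]
    rfl
  have hR : riemannCoeff g e 0 0 1 1 u = gaussCurvature g e u * metricMatrix g e u 1 1 := by
    rw [gaussCurvature, Matrix.det_fin_two, metricMatrix_symm g e u 1 0, Fin.sum_univ_two,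
      metricMatrix_symm g e u 1 0, div_mul_eq_mul_div, eq_div_iff (by rw [← sq]; exact hD.ne')]
    linear_combination (-metricMatrix g e u 0 1) * hzero
  have h0 := hmul 0 1
  have h1 := hmul 1 0
  have hk : gaussCurvature g e u = riemannCoeff g e 0 0 1 1 u / metricMatrix g e u 1 1 := by
    rw [hR, mul_div_cancel_right₀ _ hG.ne']
  refine hcurl.trans ?_
  rw [hk]
  refine (congrArg₂ (fun a b ↦ -a + b) h0 h1).trans ?_
  simp only [partialDeriv_areaDensity g he hu, partialDeriv_metricMatrix_one_one g he hu,
    riemannCoeff, Fin.sum_univ_two]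
  rw [christoffel_symm g e 0 1 0]
  field_simp
  ring

end Structure

end

section

/-! ### The area form as a two-form -/

theorem contDiffAt_det_fderiv {T : Plane → Plane} {u : Plane} (hT : ContDiffAt ℝ ∞ T u) :
    ContDiffAt ℝ ∞ (fun v ↦ (fderiv ℝ T v).det) u := by
  have h1 : ContDiffAt ℝ ∞ (fderiv ℝ T) u := hT.fderiv_right (by simp)
  have h2 (i j : Fin 2) : ContDiffAt ℝ ∞ (fun v ↦ fderiv ℝ T v (stdVec i) j) u :=
    (EuclideanSpace.proj (𝕜 := ℝ) j).contDiff.contDiffAt.comp u (h1.clm_apply contDiffAt_const)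
  simp only [det_eq]
  exact ((h2 0 0).mul (h2 1 1)).sub ((h2 _ _).mul (h2 _ _))

section Area

variable {M : Type*} [TopologicalSpace M] [ChartedSpace Plane M] [IsManifold (𝓡 2) ∞ M]

/-- The area form, encoded by its values on the standard basis of the model plane. -/
def areaTwo (g : SurfaceMetric M) (o : SurfaceOrientation M) (x : M) : ℝ :=
  areaForm g o x (stdVec 0 : Plane) (stdVec 1 : Plane)

/-- The area form is an alternating form: the sign of the determinant comes from the orientation and
its absolute value from the square root of the Gram determinant. -/
theorem areaForm_comp (g : SurfaceMetric M) (o : SurfaceOrientation M) (x : M)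
    (L : Plane →L[ℝ] Plane) :
    areaForm g o x (L (stdVec 0)) (L (stdVec 1)) = areaTwo g o x * L.det := by
  have h1 := orientationSign_comp (o.orient x) L (stdVec 0) (stdVec 1)
  have h2 : innerAt g x (L (stdVec 0)) (L (stdVec 0)) * innerAt g x (L (stdVec 1)) (L (stdVec 1))
      - innerAt g x (L (stdVec 0)) (L (stdVec 1)) ^ 2
      = L.det ^ 2 * (innerAt g x (stdVec 0) (stdVec 0) * innerAt g x (stdVec 1) (stdVec 1)
        - innerAt g x (stdVec 0) (stdVec 1) ^ 2) := by
    have hs := innerAt_symm g x (stdVec 1) (stdVec 0)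
    rw [det_eq, eq_add_stdVec (L (stdVec 0)), eq_add_stdVec (L (stdVec 1))]
    simp only [map_add, map_smul, add_apply, smul_apply, smul_eq_mul, hs]
    simp
    ring
  have h3 : areaForm g o x (L (stdVec 0)) (L (stdVec 1))
      = ((SignType.sign L.det * stdSign o x : SignType) : ℝ)
        * √(L.det ^ 2 * (innerAt g x (stdVec 0) (stdVec 0) * innerAt g x (stdVec 1) (stdVec 1)
        - innerAt g x (stdVec 0) (stdVec 1) ^ 2)) := by
    rw [← h2]
    exact congrArg (fun s : SignType ↦ (s : ℝ) * _) h1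
  rw [h3, Real.sqrt_mul (sq_nonneg _), Real.sqrt_sq_eq_abs, SignType.coe_mul]
  have h4 : areaTwo g o x = (stdSign o x : ℝ)
      * √(innerAt g x (stdVec 0) (stdVec 0) * innerAt g x (stdVec 1) (stdVec 1)
        - innerAt g x (stdVec 0) (stdVec 1) ^ 2) := rfl
  rw [h4]
  linear_combination ((stdSign o x : ℝ)
      * √(innerAt g x (stdVec 0) (stdVec 0) * innerAt g x (stdVec 1) (stdVec 1)
        - innerAt g x (stdVec 0) (stdVec 1) ^ 2)) * sign_mul_abs L.det

theorem IsPositiveChart.rep₂_areaTwo {o : SurfaceOrientation M}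
    {e : OpenPartialHomeomorph M Plane} (he : IsPositiveChart o e) (g : SurfaceMetric M)
    {u : Plane} (hu : u ∈ e.target) : rep₂ e (areaTwo g o) u = areaDensity g e u := by
  rw [rep₂, ← areaForm_comp]
  have h := (orientationSign_comp (o.orient (e.symm u)) (mder e.symm u) (stdVec 0)
    (stdVec 1)).trans (he.sign_eq u hu)
  refine (congrArg (fun s : SignType ↦ (s : ℝ) * areaDensity g e u) h).trans ?_
  simp

theorem isPositiveForm_areaTwo (g : SurfaceMetric M) (o : SurfaceOrientation M) :
    IsPositiveForm o (areaTwo g o) where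
  smooth e he u hu := by
    have he' := isPositiveChart_posChart o (e.symm u)
    have hu' := mem_posChart o (e.symm u)
    set e' := posChart o (e.symm u)
    have hT := contDiffAt_inCharts he he'.mem contMDiff_id hu hu'
    have hm : inCharts e e' id u ∈ e'.target := e'.map_source hu'
    have hev : rep₂ e (areaTwo g o) =ᶠ[𝓝 u] fun v ↦
        (fderiv ℝ (inCharts e e' id) v).det * areaDensity g e' (inCharts e e' id v) := by
      filter_upwards [eventually_mem_charts contMDiff_id hu hu'] with v hv
      have hv' : inCharts e e' id v ∈ e'.target := e'.map_source hv.2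
      rw [rep₂_transition he he'.mem _ hv.1 hv.2, he'.rep₂_areaTwo g hv']
    refine (ContDiffAt.congr_of_eventuallyEq ?_ hev).contDiffWithinAt
    exact (contDiffAt_det_fderiv hT).mul (((contDiffOn_areaDensity g he'.mem).contDiffAt
      (e'.open_target.mem_nhds hm)).comp u hT)
  pos e he u hu := by
    rw [he.rep₂_areaTwo g hu]
    exact areaDensity_pos g he.mem hu

end Area

/-! ### Change of the orthonormal coframe -/

section LogDeriv

/-- The one-form `Im (dp / p)`, the differential of the argument of `p`. -/
def imLogDeriv (p : Plane → ℂ) (u : Plane) : Plane →L[ℝ] ℝ :=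
  Complex.imCLM.comp ((p u)⁻¹ • fderiv ℝ p u)

theorem imLogDeriv_apply (p : Plane → ℂ) (u v : Plane) :
    imLogDeriv p u v = ((p u)⁻¹ * fderiv ℝ p u v).im := by
  simp [imLogDeriv]

theorem imLogDeriv_congr {p q : Plane → ℂ} {u : Plane} (h : p =ᶠ[𝓝 u] q) :
    imLogDeriv p u = imLogDeriv q u := by
  rw [imLogDeriv, imLogDeriv, h.fderiv_eq, h.eq_of_nhds]

theorem imLogDeriv_mul {p q : Plane → ℂ} {u : Plane} (hp : DifferentiableAt ℝ p u)
    (hq : DifferentiableAt ℝ q u) (hp0 : p u ≠ 0) (hq0 : q u ≠ 0) :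
    imLogDeriv (fun u ↦ p u * q u) u = imLogDeriv p u + imLogDeriv q u := by
  ext v
  rw [add_apply, imLogDeriv_apply, imLogDeriv_apply, imLogDeriv_apply, fderiv_fun_mul hp hq,
    ← Complex.add_im]
  congr 1
  simp only [add_apply, smul_apply, smul_eq_mul]
  field_simp
  ring

theorem imLogDeriv_comp {p : Plane → ℂ} {T : Plane → Plane} {u : Plane}
    (hp : DifferentiableAt ℝ p (T u)) (hT : DifferentiableAt ℝ T u) :
    imLogDeriv (fun u ↦ p (T u)) u = pull T (imLogDeriv p) u := by
  have h : fderiv ℝ (fun u ↦ p (T u)) u = (fderiv ℝ p (T u)).comp (fderiv ℝ T u) :=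
    fderiv_comp u hp hT
  rw [imLogDeriv, h]
  rfl

theorem imLogDeriv_ofReal {f : Plane → ℝ} {u : Plane} (hf : DifferentiableAt ℝ f u) :
    imLogDeriv (fun u ↦ (f u : ℂ)) u = 0 := by
  have h : HasFDerivAt (fun u ↦ (f u : ℂ)) (Complex.ofRealCLM.comp (fderiv ℝ f u)) u :=
    Complex.ofRealCLM.hasFDerivAt.comp u hf.hasFDerivAt
  ext v
  rw [imLogDeriv_apply, h.fderiv]
  simp [← Complex.ofReal_inv, ← Complex.ofReal_mul]

theorem contDiffAt_imLogDeriv {p : Plane → ℂ} {u : Plane} (hp : ContDiffAt ℝ ∞ p u)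
    (h0 : p u ≠ 0) : ContDiffAt ℝ ∞ (imLogDeriv p) u :=
  contDiffAt_const.clm_comp ((hp.inv h0).smul (hp.fderiv_right (by simp)))

theorem curl_imLogDeriv {p : Plane → ℂ} {u : Plane} (hp : ContDiffAt ℝ ∞ p u) (h0 : p u ≠ 0) :
    curl (imLogDeriv p) u = 0 := by
  have hp1 : DifferentiableAt ℝ p u := hp.differentiableAt (by simp)
  have hp2 : DifferentiableAt ℝ (fderiv ℝ p) u :=
    (hp.fderiv_right (m := ∞) (by simp)).differentiableAt (by simp)
  have hsymm : IsSymmSndFDerivAt ℝ p u := hp.isSymmSndFDerivAt (by simp; norm_cast)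
  have hi := (hasDerivAt_inv h0).comp_hasFDerivAt_of_eq u (hp1.hasFDerivAt) rfl
  have hd : HasFDerivAt (imLogDeriv p) _ u :=
    (hasFDerivAt_const Complex.imCLM u).clm_comp (hi.smul hp2.hasFDerivAt)
  have hs := hsymm (stdVec 0) (stdVec 1)
  rw [curl, hd.fderiv]
  simp [hs]
  ring

end LogDeriv

section Gauge

/-- The value of `α ∧ β` on the standard basis, for a real and a complex one-form at a point. -/
def wedge (α : Plane →L[ℝ] ℝ) (β : Plane →L[ℝ] ℂ) : ℂ :=
  α (stdVec 0) * β (stdVec 1) - α (stdVec 1) * β (stdVec 0)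

theorem wedge_comp (α : Plane →L[ℝ] ℝ) (β : Plane →L[ℝ] ℂ) (L : Plane →L[ℝ] Plane) :
    wedge (α.comp L) (β.comp L) = L.det * wedge α β := by
  simp only [wedge, ContinuousLinearMap.comp_apply, det_eq]
  rw [eq_add_stdVec (L (stdVec 0)), eq_add_stdVec (L (stdVec 1))]
  simp only [map_add, map_smul, smul_eq_mul, Complex.real_smul]
  simp
  ring

/-- The connection form of a coframe changes by the differential of the argument of the
unit complex function by which the coframe is multiplied. -/
theorem eq_sub_imLogDeriv {ε ε' : Plane → Plane →L[ℝ] ℂ} {θ θ' : Plane → Plane →L[ℝ] ℝ}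
    {z : Plane → ℂ} {u : Plane} (hε : DifferentiableAt ℝ ε u) (hz : DifferentiableAt ℝ z u)
    (h : ε' =ᶠ[𝓝 u] fun v ↦ z v • ε v) (hz1 : ∀ᶠ v in 𝓝 u, ‖z v‖ = 1)
    (hθ : curl ε u = -Complex.I * wedge (θ u) (ε u))
    (hθ' : curl ε' u = -Complex.I * wedge (θ' u) (ε' u))
    (hind : (starRingEnd ℂ (ε u (stdVec 0)) * ε u (stdVec 1)).im ≠ 0) :
    θ' u = θ u - imLogDeriv z u := by
  have hzu : ‖z u‖ = 1 := hz1.self_of_nhds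
  have hz0 : z u ≠ 0 := fun h0 ↦ by simp [h0] at hzu
  -- the logarithmic derivative of a function with values in the unit circle is imaginary
  have him (v : Plane) : fderiv ℝ z u v = z u * (imLogDeriv z u v * Complex.I) := by
    have hc : HasFDerivAt (fun v ↦ ‖z v‖ ^ 2) _ u := hz.hasFDerivAt.norm_sq
    have hc' : (fun v ↦ ‖z v‖ ^ 2) =ᶠ[𝓝 u] fun _ ↦ 1 := by
      filter_upwards [hz1] with v hv
      rw [hv, one_pow]
    have hc0 : fderiv ℝ (fun v ↦ ‖z v‖ ^ 2) u = 0 := hc'.fderiv_eq.trans (by simp)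
    have h0 := congrArg (fun L ↦ L v) (hc.fderiv.symm.trans hc0)
    simp only [ContinuousLinearMap.comp_apply, smul_apply, zero_apply, innerSL_apply_apply,
      Complex.inner] at h0
    have hre : ((z u)⁻¹ * fderiv ℝ z u v).re = 0 := by
      rw [Complex.inv_def, Complex.normSq_eq_norm_sq, hzu]
      simp [mul_comm] at h0 ⊢
      linarith
    have h1 : (z u)⁻¹ * fderiv ℝ z u v = (imLogDeriv z u v : ℝ) * Complex.I := by
      rw [imLogDeriv_apply]
      apply Complex.ext <;> simp [hre]
    rw [← h1, mul_inv_cancel_left₀ hz0]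
  have hcurl : curl ε' u = z u * curl ε u + (fderiv ℝ z u (stdVec 0) * ε u (stdVec 1)
      - fderiv ℝ z u (stdVec 1) * ε u (stdVec 0)) := by
    have hd : HasFDerivAt (fun v ↦ z v • ε v) _ u := hz.hasFDerivAt.smul hε.hasFDerivAt
    rw [curl_congr h, curl, curl, hd.fderiv]
    simp
    ring
  rw [hθ', hθ, h.eq_of_nhds, him, him] at hcurl
  set s : Fin 2 → ℝ := fun i ↦ θ' u (stdVec i) - θ u (stdVec i) + imLogDeriv z u (stdVec i)
    with hs
  have hlin : (s 0 : ℂ) * ε u (stdVec 1) = s 1 * ε u (stdVec 0) := by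
    simp only [wedge, smul_apply, smul_eq_mul] at hcurl
    refine mul_left_cancel₀ (mul_ne_zero hz0 Complex.I_ne_zero) ?_
    simp only [hs, Complex.ofReal_sub, Complex.ofReal_add]
    linear_combination -hcurl
  have hre := congrArg Complex.re hlin
  have him' := congrArg Complex.im hlin
  simp only [Complex.re_ofReal_mul, Complex.im_ofReal_mul] at hre him'
  simp only [Complex.mul_im, Complex.conj_re, Complex.conj_im] at hind
  have h0 : s 0 = 0 := by
    refine (mul_eq_zero.1 ?_).resolve_right hind
    linear_combination (ε u (stdVec 0)).re * him' - (ε u (stdVec 0)).im * hre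
  have h1 : s 1 = 0 := by
    refine (mul_eq_zero.1 ?_).resolve_right hind
    linear_combination (ε u (stdVec 1)).re * him' - (ε u (stdVec 1)).im * hre
  simp only [hs] at h0 h1
  have h2 (w : Plane) : θ' u w = (θ u - imLogDeriv z u) w := by
    rw [eq_add_stdVec w, map_add, map_add, map_smul, map_smul, map_smul, map_smul, sub_apply,
      sub_apply]
    simp only [smul_eq_mul]
    linear_combination w 0 * h0 + w 1 * h1
  exact ContinuousLinearMap.ext h2

/-- The coefficient of the area form, and the inner product, are the imaginary and the real part of
the Hermitian form that an orthonormal coframe induces. -/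
theorem conj_coframe_mul_coframe {M : Type*} [TopologicalSpace M] [ChartedSpace Plane M]
    [IsManifold (𝓡 2) ∞ M] (g : SurfaceMetric M) {e : OpenPartialHomeomorph M Plane}
    (he : e ∈ maximalAtlas (𝓡 2) ∞ M) {u : Plane} (hu : u ∈ e.target) (v w : Plane) :
    starRingEnd ℂ (coframe g e u v) * coframe g e u w
      = (innerAt g (e.symm u) (mder e.symm u v) (mder e.symm u w) : ℝ)
        + (areaDensity g e u * (v 0 * w 1 - v 1 * w 0) : ℝ) * Complex.I := by
  have hG := metricMatrix_diag_pos g he hu 1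
  have hr : 0 < √(metricMatrix g e u 1 1) := Real.sqrt_pos.2 hG
  have hrsq : √(metricMatrix g e u 1 1) ^ 2 = metricMatrix g e u 1 1 := Real.sq_sqrt hG.le
  have hssq := areaDensity_sq g he hu
  rw [innerAt_mder]
  apply Complex.ext
  · simp [coframe]
    field_simp
    rw [hrsq]
    linear_combination (v 0 * w 0) * hssq
  · simp [coframe]
    field_simp
    rw [hrsq]
    ring

section Transition

variable {M : Type*} [TopologicalSpace M] [ChartedSpace Plane M] [IsManifold (𝓡 2) ∞ M]
  (g : SurfaceMetric M) {o : SurfaceOrientation M} {e e' : OpenPartialHomeomorph M Plane}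

/-- The coframes of two positive charts induce the same Hermitian form. -/
theorem conj_pull_coframe_mul (he : IsPositiveChart o e) (he' : IsPositiveChart o e') {u : Plane}
    (hu : u ∈ e.target) (hu' : e.symm u ∈ e'.source) (v w : Plane) :
    starRingEnd ℂ (pull (inCharts e e' id) (coframe g e') u v)
        * pull (inCharts e e' id) (coframe g e') u w
      = starRingEnd ℂ (coframe g e u v) * coframe g e u w := by
  have hT : inCharts e e' id u ∈ e'.target := e'.map_source hu'
  have hx : e'.symm (inCharts e e' id u) = e.symm u := e'.left_inv hu'
  have hA := mder_symm_comp_fderiv_inCharts he.mem he'.mem contMDiff_id hu hu'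
  rw [mder_id, ContinuousLinearMap.id_comp] at hA
  have hA' (v : Plane) : mder e'.symm (inCharts e e' id u) (fderiv ℝ (inCharts e e' id) u v)
      = mder e.symm u v := congrArg (fun L : Plane →L[ℝ] Plane ↦ L v) hA
  have hs := rep₂_transition he.mem he'.mem (areaTwo g o) hu hu'
  rw [he.rep₂_areaTwo g hu, he'.rep₂_areaTwo g hT] at hs
  simp only [pull, ContinuousLinearMap.comp_apply]
  rw [conj_coframe_mul_coframe g he'.mem hT, conj_coframe_mul_coframe g he.mem hu, hA', hA', hx, hs,
    det_eq]
  congr 3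
  rw [eq_add_stdVec v, eq_add_stdVec w]
  simp
  ring

/-- The unit complex function by which the coframe of `e` has to be multiplied to obtain the coframe
of `e'`. -/
def gauge (g : SurfaceMetric M) (e e' : OpenPartialHomeomorph M Plane) (u : Plane) : ℂ :=
  pull (inCharts e e' id) (coframe g e') u (stdVec 1) / coframe g e u (stdVec 1)

theorem coframe_stdVec_one_ne_zero (he : e ∈ maximalAtlas (𝓡 2) ∞ M) {u : Plane}
    (hu : u ∈ e.target) : coframe g e u (stdVec 1) ≠ 0 := by
  simpa [coframe] using (Real.sqrt_pos.2 (metricMatrix_diag_pos g he hu 1)).ne'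

theorem norm_gauge (he : IsPositiveChart o e) (he' : IsPositiveChart o e') {u : Plane}
    (hu : u ∈ e.target) (hu' : e.symm u ∈ e'.source) : ‖gauge g e e' u‖ = 1 := by
  have h := conj_pull_coframe_mul g he he' hu hu' (stdVec 1) (stdVec 1)
  rw [← Complex.normSq_eq_conj_mul_self, ← Complex.normSq_eq_conj_mul_self,
    Complex.normSq_eq_norm_sq, Complex.normSq_eq_norm_sq] at h
  have h2 := (pow_left_inj₀ (norm_nonneg _) (norm_nonneg _) two_ne_zero).1 (Complex.ofReal_inj.1 h)
  rw [gauge, norm_div, h2, div_self]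
  exact norm_ne_zero_iff.2 (coframe_stdVec_one_ne_zero g he.mem hu)

theorem gauge_ne_zero (he : IsPositiveChart o e) (he' : IsPositiveChart o e') {u : Plane}
    (hu : u ∈ e.target) (hu' : e.symm u ∈ e'.source) : gauge g e e' u ≠ 0 := fun h ↦ by
  have := norm_gauge g he he' hu hu'
  simp [h] at this

theorem pull_coframe (he : IsPositiveChart o e) (he' : IsPositiveChart o e') {u : Plane}
    (hu : u ∈ e.target) (hu' : e.symm u ∈ e'.source) :
    pull (inCharts e e' id) (coframe g e') u = gauge g e e' u • coframe g e u := by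
  ext v
  have h1 := conj_pull_coframe_mul g he he' hu hu' (stdVec 1) (stdVec 1)
  have hv := conj_pull_coframe_mul g he he' hu hu' (stdVec 1) v
  have hne := coframe_stdVec_one_ne_zero g he.mem hu
  have hne' : pull (inCharts e e' id) (coframe g e') u (stdVec 1) ≠ 0 :=
    left_ne_zero_of_mul (b := (coframe g e u (stdVec 1))⁻¹) (gauge_ne_zero g he he' hu hu')
  rw [smul_apply, smul_eq_mul, gauge, div_mul_eq_mul_div, eq_div_iff hne]
  have hc : starRingEnd ℂ (pull (inCharts e e' id) (coframe g e') u (stdVec 1)) ≠ 0 :=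
    (map_ne_zero _).2 hne'
  have hc' : starRingEnd ℂ (coframe g e u (stdVec 1)) ≠ 0 := (map_ne_zero _).2 hne
  refine mul_left_cancel₀ (mul_ne_zero hc hc') ?_
  linear_combination (starRingEnd ℂ (coframe g e u (stdVec 1)) * coframe g e u (stdVec 1)) * hv
    - (starRingEnd ℂ (coframe g e u (stdVec 1)) * coframe g e u v) * h1

theorem contDiffAt_gauge (he : e ∈ maximalAtlas (𝓡 2) ∞ M) (he' : e' ∈ maximalAtlas (𝓡 2) ∞ M)
    {u : Plane} (hu : u ∈ e.target) (hu' : e.symm u ∈ e'.source) :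
    ContDiffAt ℝ ∞ (gauge g e e') u := by
  have hT : inCharts e e' id u ∈ e'.target := e'.map_source hu'
  have h1 := (contDiffOn_coframe g he).contDiffAt (e.open_target.mem_nhds hu)
  have h2 := contDiffAt_pull (contDiffAt_inCharts he he' contMDiff_id hu hu')
    ((contDiffOn_coframe g he').contDiffAt (e'.open_target.mem_nhds hT)) (by simp)
  have h3 := (h2.clm_apply (contDiffAt_const (c := stdVec 1))).mul
    ((h1.clm_apply (contDiffAt_const (c := stdVec 1))).inv (coframe_stdVec_one_ne_zero g he hu))
  refine h3.congr_of_eventuallyEq (.of_forall fun v ↦ ?_)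
  exact div_eq_mul_inv _ _

theorem pull_connForm (he : IsPositiveChart o e) (he' : IsPositiveChart o e') {u : Plane}
    (hu : u ∈ e.target) (hu' : e.symm u ∈ e'.source) :
    pull (inCharts e e' id) (connForm g e') u
      = connForm g e u - imLogDeriv (gauge g e e') u := by
  have hT : inCharts e e' id u ∈ e'.target := e'.map_source hu'
  have hev := eventually_mem_charts contMDiff_id hu hu'
  have hd := ((contDiffOn_coframe g he.mem).contDiffAt
    (e.open_target.mem_nhds hu)).differentiableAt (by simp)
  have hd' := ((contDiffOn_coframe g he'.mem).contDiffAt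
    (e'.open_target.mem_nhds hT)).differentiableAt (by simp)
  refine eq_sub_imLogDeriv hd
    ((contDiffAt_gauge g he.mem he'.mem hu hu').differentiableAt (by simp))
    (hev.mono fun v hv ↦ pull_coframe g he he' hv.1 hv.2)
    (hev.mono fun v hv ↦ norm_gauge g he he' hv.1 hv.2) (curl_coframe g he.mem hu) ?_ ?_
  · rw [curl_pull ((contDiffAt_inCharts he.mem he'.mem contMDiff_id hu hu').of_le (by norm_cast))
      hd', curl_coframe g he'.mem hT, pull, pull, wedge_comp, Complex.real_smul]
    simp only [wedge]
    ring
  · rw [conj_coframe_mul_coframe g he.mem hu]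
    simpa using (areaDensity_pos g he.mem hu).ne'

end Transition

end Gauge

end

section

/-! ### The trace of the connection along a Lagrangian immersion -/

section Comp

variable {M N P : Type*} [TopologicalSpace M] [ChartedSpace Plane M] [TopologicalSpace N]
  [ChartedSpace Plane N] [TopologicalSpace P] [ChartedSpace Plane P]
  {F : Type*} [NormedAddCommGroup F] [NormedSpace ℝ F]

omit [ChartedSpace Plane M] [ChartedSpace Plane N] [ChartedSpace Plane P] in
theorem inCharts_comp {e : OpenPartialHomeomorph M Plane} {e' : OpenPartialHomeomorph N Plane}
    {e'' : OpenPartialHomeomorph P Plane} {f : M → N} {h : N → P} {u : Plane}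
    (hu' : f (e.symm u) ∈ e'.source) :
    inCharts e e'' (h ∘ f) u = inCharts e' e'' h (inCharts e e' f u) :=
  congrArg (fun x ↦ e'' (h x)) (e'.left_inv hu').symm

theorem pull_inCharts_comp {e : OpenPartialHomeomorph M Plane}
    {e' : OpenPartialHomeomorph N Plane} {e'' : OpenPartialHomeomorph P Plane}
    (he : e ∈ maximalAtlas (𝓡 2) ∞ M) (he' : e' ∈ maximalAtlas (𝓡 2) ∞ N)
    (he'' : e'' ∈ maximalAtlas (𝓡 2) ∞ P) {f : M → N} {h : N → P}
    (hf : ContMDiff (𝓡 2) (𝓡 2) ∞ f) (hh : ContMDiff (𝓡 2) (𝓡 2) ∞ h)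
    (a : Plane → Plane →L[ℝ] F) {u : Plane} (hu : u ∈ e.target) (hu' : f (e.symm u) ∈ e'.source)
    (hu'' : h (f (e.symm u)) ∈ e''.source) :
    pull (inCharts e e'' (h ∘ f)) a u = pull (inCharts e e' f) (pull (inCharts e' e'' h) a) u := by
  have hx' : h (e'.symm (inCharts e e' f u)) ∈ e''.source := by
    rwa [show e'.symm (inCharts e e' f u) = f (e.symm u) from e'.left_inv hu']
  have hev : inCharts e e'' (h ∘ f) =ᶠ[𝓝 u] inCharts e' e'' h ∘ inCharts e e' f := by
    filter_upwards [eventually_mem_charts hf hu hu'] with v hv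
    exact inCharts_comp hv.2
  have h1 : DifferentiableAt ℝ (inCharts e' e'' h) (inCharts e e' f u) :=
    (contDiffAt_inCharts he' he'' hh (e'.map_source hu') hx').differentiableAt (by simp)
  have h2 : DifferentiableAt ℝ (inCharts e e' f) u :=
    (contDiffAt_inCharts he he' hf hu hu').differentiableAt (by simp)
  rw [pull, hev.fderiv_eq, fderiv_comp u h1 h2, hev.eq_of_nhds]
  rfl

end Comp

/-- The complex determinant of a pair of complex-valued one-forms on the plane. -/
def pairDet (a b : Plane → Plane →L[ℝ] ℂ) (u : Plane) : ℂ :=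
  a u (stdVec 0) * b u (stdVec 1) - a u (stdVec 1) * b u (stdVec 0)

theorem pairDet_pull (a b : Plane → Plane →L[ℝ] ℂ) (T : Plane → Plane) (u : Plane) :
    pairDet (pull T a) (pull T b) u = ((fderiv ℝ T u).det : ℂ) * pairDet a b (T u) := by
  simp only [pairDet, pull, ContinuousLinearMap.comp_apply, det_eq]
  rw [eq_add_stdVec (fderiv ℝ T u (stdVec 0)), eq_add_stdVec (fderiv ℝ T u (stdVec 1))]
  simp only [map_add, map_smul, Complex.real_smul]
  simp
  ring

/-- A Lagrangian plane in `ℂ²` is totally real. -/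
theorem pairDet_ne_zero {a b : Plane → Plane →L[ℝ] ℂ} {u : Plane}
    (hinj : ∀ v, a u v = 0 → b u v = 0 → v = 0)
    (hlag : (starRingEnd ℂ (a u (stdVec 0)) * a u (stdVec 1)).im
      + (starRingEnd ℂ (b u (stdVec 0)) * b u (stdVec 1)).im = 0) : pairDet a b u ≠ 0 := by
  intro h
  rw [pairDet] at h
  set a₀ := a u (stdVec 0)
  set a₁ := a u (stdVec 1)
  set b₀ := b u (stdVec 0)
  set b₁ := b u (stdVec 1)
  -- `n • (a₁, b₁) = r • (a₀, b₀)`, where `r` is real by the Lagrangian condition `hlag`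
  set n : ℝ := Complex.normSq a₀ + Complex.normSq b₀
  set r : ℝ := (starRingEnd ℂ a₀ * a₁ + starRingEnd ℂ b₀ * b₁).re
  have hr : (r : ℂ) = starRingEnd ℂ a₀ * a₁ + starRingEnd ℂ b₀ * b₁ := by
    apply Complex.ext
    · rfl
    · rw [Complex.add_im, hlag, Complex.ofReal_im]
  have hn : (n : ℂ) = starRingEnd ℂ a₀ * a₀ + starRingEnd ℂ b₀ * b₀ := by
    rw [Complex.ofReal_add, Complex.normSq_eq_conj_mul_self, Complex.normSq_eq_conj_mul_self]
  have hv (L : Plane →L[ℝ] ℂ) : L (n • stdVec 1 - r • stdVec 0)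
      = (n : ℂ) * L (stdVec 1) - r * L (stdVec 0) := by
    rw [map_sub, map_smul, map_smul, Complex.real_smul, Complex.real_smul]
  have h0 : n • stdVec 1 - r • stdVec 0 = 0 := by
    refine hinj _ ?_ ?_
    · rw [hv, hr, hn]
      linear_combination (-starRingEnd ℂ b₀) * h
    · rw [hv, hr, hn]
      linear_combination (starRingEnd ℂ a₀) * h
  have hn0 : n = 0 := by simpa using congrArg (fun v : Plane ↦ v 1) h0
  have ha : a₀ = 0 := by
    have := Complex.normSq_nonneg a₀
    have := Complex.normSq_nonneg b₀
    exact Complex.normSq_eq_zero.1 (by linarith)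
  have hb : b₀ = 0 := by
    have := Complex.normSq_nonneg a₀
    have := Complex.normSq_nonneg b₀
    exact Complex.normSq_eq_zero.1 (by linarith)
  have := congrArg (fun v : Plane ↦ v 0) (hinj _ ha hb)
  simp at this

section Component

variable {S M : Type*} [TopologicalSpace S] [ChartedSpace Plane S]
  [TopologicalSpace M] [ChartedSpace Plane M] [IsManifold (𝓡 2) ∞ M]

/-- The coframe of `e₁`, pulled back by `f` and written in the chart `e`. -/
def pullCoframe (g : SurfaceMetric M) (f : S → M) (e : OpenPartialHomeomorph S Plane)
    (e₁ : OpenPartialHomeomorph M Plane) : Plane → Plane →L[ℝ] ℂ :=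
  pull (inCharts e e₁ f) (coframe g e₁)

/-- The connection form of `e₁`, pulled back by `f` and written in the chart `e`. -/
def pullConnForm (g : SurfaceMetric M) (f : S → M) (e : OpenPartialHomeomorph S Plane)
    (e₁ : OpenPartialHomeomorph M Plane) : Plane → Plane →L[ℝ] ℝ :=
  pull (inCharts e e₁ f) (connForm g e₁)

variable (g : SurfaceMetric M) {o : SurfaceOrientation M} {f : S → M}
  (hf : ContMDiff (𝓡 2) (𝓡 2) ∞ f) {e e' : OpenPartialHomeomorph S Plane}
  (he : e ∈ maximalAtlas (𝓡 2) ∞ S) {e₁ e₁' : OpenPartialHomeomorph M Plane} {u : Plane}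
  (hu : u ∈ e.target)
include hf he hu

theorem contDiffAt_pullCoframe (he₁ : e₁ ∈ maximalAtlas (𝓡 2) ∞ M)
    (hu₁ : f (e.symm u) ∈ e₁.source) : ContDiffAt ℝ ∞ (pullCoframe g f e e₁) u :=
  contDiffAt_pull (contDiffAt_inCharts he he₁ hf hu hu₁) ((contDiffOn_coframe g he₁).contDiffAt
    (e₁.open_target.mem_nhds (e₁.map_source hu₁))) (by simp)

theorem contDiffAt_pullConnForm (he₁ : e₁ ∈ maximalAtlas (𝓡 2) ∞ M)
    (hu₁ : f (e.symm u) ∈ e₁.source) : ContDiffAt ℝ ∞ (pullConnForm g f e e₁) u :=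
  contDiffAt_pull (contDiffAt_inCharts he he₁ hf hu hu₁) ((contDiffOn_connForm g he₁).contDiffAt
    (e₁.open_target.mem_nhds (e₁.map_source hu₁))) (by simp)

theorem curl_pullConnForm (he₁ : IsPositiveChart o e₁) (hu₁ : f (e.symm u) ∈ e₁.source) {c : ℝ}
    (hg : HasConstantGaussCurvature g c) :
    curl (pullConnForm g f e e₁) u = -(c * rep₂ e (pullback₂ f (areaTwo g o)) u) := by
  have ht : inCharts e e₁ f u ∈ e₁.target := e₁.map_source hu₁
  rw [pullConnForm, curl_pull ((contDiffAt_inCharts he he₁.mem hf hu hu₁).of_le (by norm_cast))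
    (((contDiffOn_connForm g he₁.mem).contDiffAt (e₁.open_target.mem_nhds ht)).differentiableAt
      (by simp)), curl_connForm g he₁.mem ht, hg e₁ he₁.mem _ ht,
    rep₂_pullback₂ he he₁.mem hf _ hu hu₁, he₁.rep₂_areaTwo g ht, smul_eq_mul]
  ring

/-- The real and the imaginary part of the Hermitian form that the pulled back coframe induces are
the pulled back metric and the pulled back area form. -/
theorem conj_pullCoframe_mul (he₁ : IsPositiveChart o e₁) (hu₁ : f (e.symm u) ∈ e₁.source)
    (v w : Plane) :
    starRingEnd ℂ (pullCoframe g f e e₁ u v) * pullCoframe g f e e₁ u w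
      = (innerAt g (f (e.symm u)) (mder f (e.symm u) (mder e.symm u v))
          (mder f (e.symm u) (mder e.symm u w)) : ℝ)
        + (rep₂ e (pullback₂ f (areaTwo g o)) u * (v 0 * w 1 - v 1 * w 0) : ℝ) * Complex.I := by
  have ht : inCharts e e₁ f u ∈ e₁.target := e₁.map_source hu₁
  have hx : e₁.symm (inCharts e e₁ f u) = f (e.symm u) := e₁.left_inv hu₁
  have hA (v : Plane) : mder e₁.symm (inCharts e e₁ f u) (fderiv ℝ (inCharts e e₁ f) u v)
      = mder f (e.symm u) (mder e.symm u v) := congrArg (fun L : Plane →L[ℝ] Plane ↦ L v)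
    (mder_symm_comp_fderiv_inCharts he he₁.mem hf hu hu₁)
  rw [rep₂_pullback₂ he he₁.mem hf _ hu hu₁, he₁.rep₂_areaTwo g ht]
  simp only [pullCoframe, pull, ContinuousLinearMap.comp_apply]
  rw [conj_coframe_mul_coframe g he₁.mem ht, hA, hA, hx, det_eq]
  congr 3
  rw [eq_add_stdVec v, eq_add_stdVec w]
  simp
  ring

theorem pullCoframe_gauge (he₁ : IsPositiveChart o e₁) (he₁' : IsPositiveChart o e₁')
    (hu₁ : f (e.symm u) ∈ e₁.source) (hu₁' : f (e.symm u) ∈ e₁'.source) :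
    pullCoframe g f e e₁' u = gauge g e₁ e₁' (inCharts e e₁ f u) • pullCoframe g f e e₁ u := by
  have ht : inCharts e e₁ f u ∈ e₁.target := e₁.map_source hu₁
  have hx : e₁.symm (inCharts e e₁ f u) = f (e.symm u) := e₁.left_inv hu₁
  have h := pull_inCharts_comp he he₁.mem he₁'.mem hf contMDiff_id (coframe g e₁') hu hu₁ hu₁'
  refine h.trans ?_
  rw [pull, pull_coframe g he₁ he₁' ht (by rwa [hx]), ContinuousLinearMap.smul_comp]
  rfl

theorem pullConnForm_gauge (he₁ : IsPositiveChart o e₁) (he₁' : IsPositiveChart o e₁')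
    (hu₁ : f (e.symm u) ∈ e₁.source) (hu₁' : f (e.symm u) ∈ e₁'.source) :
    pullConnForm g f e e₁' u = pullConnForm g f e e₁ u
      - imLogDeriv (fun v ↦ gauge g e₁ e₁' (inCharts e e₁ f v)) u := by
  have ht : inCharts e e₁ f u ∈ e₁.target := e₁.map_source hu₁
  have hx : e₁.symm (inCharts e e₁ f u) = f (e.symm u) := e₁.left_inv hu₁
  have h := pull_inCharts_comp he he₁.mem he₁'.mem hf contMDiff_id (connForm g e₁') hu hu₁ hu₁'
  refine h.trans ?_
  rw [imLogDeriv_comp (T := inCharts e e₁ f)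
    ((contDiffAt_gauge g he₁.mem he₁'.mem ht (by rwa [hx])).differentiableAt (by simp))
    ((contDiffAt_inCharts he he₁.mem hf hu hu₁).differentiableAt (by simp)), pull,
    pull_connForm g he₁ he₁' ht (by rwa [hx]), ContinuousLinearMap.sub_comp]
  rfl

theorem pullCoframe_transition (he' : e' ∈ maximalAtlas (𝓡 2) ∞ S)
    (he₁ : e₁ ∈ maximalAtlas (𝓡 2) ∞ M) (hu' : e.symm u ∈ e'.source)
    (hu₁ : f (e.symm u) ∈ e₁.source) :
    pullCoframe g f e e₁ u = pull (inCharts e e' id) (pullCoframe g f e' e₁) u :=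
  pull_inCharts_comp he he' he₁ contMDiff_id hf (coframe g e₁) hu hu' hu₁

theorem pullConnForm_transition (he' : e' ∈ maximalAtlas (𝓡 2) ∞ S)
    (he₁ : e₁ ∈ maximalAtlas (𝓡 2) ∞ M) (hu' : e.symm u ∈ e'.source)
    (hu₁ : f (e.symm u) ∈ e₁.source) :
    pullConnForm g f e e₁ u = pull (inCharts e e' id) (pullConnForm g f e' e₁) u :=
  pull_inCharts_comp he he' he₁ contMDiff_id hf (connForm g e₁) hu hu' hu₁

theorem contDiffAt_gauge_inCharts (he₁ : e₁ ∈ maximalAtlas (𝓡 2) ∞ M)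
    (he₁' : e₁' ∈ maximalAtlas (𝓡 2) ∞ M) (hu₁ : f (e.symm u) ∈ e₁.source)
    (hu₁' : f (e.symm u) ∈ e₁'.source) :
    ContDiffAt ℝ ∞ (fun v ↦ gauge g e₁ e₁' (inCharts e e₁ f v)) u := by
  have hx : e₁.symm (inCharts e e₁ f u) ∈ e₁'.source := by
    rwa [show e₁.symm (inCharts e e₁ f u) = f (e.symm u) from e₁.left_inv hu₁]
  exact (contDiffAt_gauge g he₁ he₁' (e₁.map_source hu₁) hx).comp u
    (contDiffAt_inCharts he he₁ hf hu hu₁)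

end Component

end

section

/-! ### A primitive of the pulled back area form -/

variable {S M₁ M₂ : Type*} [TopologicalSpace S] [ChartedSpace Plane S]
  [TopologicalSpace M₁] [ChartedSpace Plane M₁] [IsManifold (𝓡 2) ∞ M₁]
  [TopologicalSpace M₂] [ChartedSpace Plane M₂] [IsManifold (𝓡 2) ∞ M₂]
  {g₁ : SurfaceMetric M₁} {g₂ : SurfaceMetric M₂}
  {o₁ : SurfaceOrientation M₁} {o₂ : SurfaceOrientation M₂} {Φ : S → M₁ × M₂}
  (hΦ : IsLagrangianImmersion g₁ o₁ g₂ o₂ Φ)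

section Immersion

include hΦ

theorem contMDiff_fst_comp : ContMDiff (𝓡 2) (𝓡 2) ∞ fun x ↦ (Φ x).1 :=
  contMDiff_fst.comp hΦ.contMDiff

theorem contMDiff_snd_comp : ContMDiff (𝓡 2) (𝓡 2) ∞ fun x ↦ (Φ x).2 :=
  contMDiff_snd.comp hΦ.contMDiff

theorem mfderiv_fst_mfderiv (x : S) (v : Plane) :
    mfderiv ((𝓡 2).prod (𝓡 2)) (𝓡 2) Prod.fst (Φ x)
      (mfderiv (𝓡 2) ((𝓡 2).prod (𝓡 2)) Φ x v) = mder (fun x ↦ (Φ x).1) x v :=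
  congrArg (fun L : Plane →L[ℝ] Plane ↦ L v)
    (mfderiv_comp x mdifferentiableAt_fst (hΦ.contMDiff.mdifferentiableAt (by simp))).symm

theorem mfderiv_snd_mfderiv (x : S) (v : Plane) :
    mfderiv ((𝓡 2).prod (𝓡 2)) (𝓡 2) Prod.snd (Φ x)
      (mfderiv (𝓡 2) ((𝓡 2).prod (𝓡 2)) Φ x v) = mder (fun x ↦ (Φ x).2) x v :=
  congrArg (fun L : Plane →L[ℝ] Plane ↦ L v)
    (mfderiv_comp x mdifferentiableAt_snd (hΦ.contMDiff.mdifferentiableAt (by simp))).symm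

theorem eq_zero_of_mder_eq_zero {x : S} {v : Plane} (h₁ : mder (fun x ↦ (Φ x).1) x v = 0)
    (h₂ : mder (fun x ↦ (Φ x).2) x v = 0) : v = 0 := by
  refine hΦ.injective_mfderiv x (Eq.trans (Prod.ext ?_ ?_) (map_zero _).symm)
  · rw [← mfderiv_fst_mfderiv hΦ, mfderiv_fst] at h₁
    exact h₁
  · rw [← mfderiv_snd_mfderiv hΦ, mfderiv_snd] at h₂
    exact h₂

theorem pullback₂_areaTwo_add (x : S) :
    pullback₂ (fun x ↦ (Φ x).1) (areaTwo g₁ o₁) x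
      + pullback₂ (fun x ↦ (Φ x).2) (areaTwo g₂ o₂) x = 0 := by
  have h := hΦ.pullback_eq_zero x (stdVec 0 : Plane) (stdVec 1 : Plane)
  rw [productKahlerForm] at h
  rw [pullback₂, pullback₂, ← areaForm_comp, ← areaForm_comp, ← mfderiv_fst_mfderiv hΦ,
    ← mfderiv_fst_mfderiv hΦ, ← mfderiv_snd_mfderiv hΦ, ← mfderiv_snd_mfderiv hΦ]
  exact h

end Immersion

/-- The determinant of the differential of `Φ`, as a complex-linear map from the complexified
tangent planes of `S`, with respect to the coordinates of `e` and the coframes of `e₁` and `e₂`. -/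
def complexDet (g₁ : SurfaceMetric M₁) (g₂ : SurfaceMetric M₂) (Φ : S → M₁ × M₂)
    (e : OpenPartialHomeomorph S Plane) (e₁ : OpenPartialHomeomorph M₁ Plane)
    (e₂ : OpenPartialHomeomorph M₂ Plane) : Plane → ℂ :=
  pairDet (pullCoframe g₁ (fun x ↦ (Φ x).1) e e₁) (pullCoframe g₂ (fun x ↦ (Φ x).2) e e₂)

/-- The imaginary part of the trace of the connection form of `Φ^* T(M₁ × M₂)` in the frame that
`Φ` induces from the coordinate frame of `e`, written in the chart `e`. -/
def traceForm (g₁ : SurfaceMetric M₁) (g₂ : SurfaceMetric M₂) (Φ : S → M₁ × M₂)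
    (e : OpenPartialHomeomorph S Plane) (e₁ : OpenPartialHomeomorph M₁ Plane)
    (e₂ : OpenPartialHomeomorph M₂ Plane) (u : Plane) : Plane →L[ℝ] ℝ :=
  imLogDeriv (complexDet g₁ g₂ Φ e e₁ e₂) u + pullConnForm g₁ (fun x ↦ (Φ x).1) e e₁ u
    + pullConnForm g₂ (fun x ↦ (Φ x).2) e e₂ u

section Chart

variable {e e' : OpenPartialHomeomorph S Plane} (he : e ∈ maximalAtlas (𝓡 2) ∞ S)
  {e₁ e₁' : OpenPartialHomeomorph M₁ Plane} {e₂ e₂' : OpenPartialHomeomorph M₂ Plane}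
  (he₁ : IsPositiveChart o₁ e₁) (he₂ : IsPositiveChart o₂ e₂) {u : Plane} (hu : u ∈ e.target)
  (hu₁ : (Φ (e.symm u)).1 ∈ e₁.source) (hu₂ : (Φ (e.symm u)).2 ∈ e₂.source)
include hΦ he he₁ he₂ hu hu₁ hu₂

theorem complexDet_ne_zero : complexDet g₁ g₂ Φ e e₁ e₂ u ≠ 0 := by
  have h₁ := conj_pullCoframe_mul g₁ (contMDiff_fst_comp hΦ) he hu he₁ hu₁
  have h₂ := conj_pullCoframe_mul g₂ (contMDiff_snd_comp hΦ) he hu he₂ hu₂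
  refine pairDet_ne_zero (fun v hv₁ hv₂ ↦ ?_) ?_
  · have h₁' := congrArg Complex.re (h₁ v v)
    have h₂' := congrArg Complex.re (h₂ v v)
    simp only [hv₁, mul_zero, Complex.zero_re, Complex.add_re, Complex.ofReal_re,
      Complex.re_ofReal_mul, Complex.I_re, add_zero] at h₁'
    simp only [hv₂, mul_zero, Complex.zero_re, Complex.add_re, Complex.ofReal_re,
      Complex.re_ofReal_mul, Complex.I_re, add_zero] at h₂'
    by_contra hv
    refine mder_symm_apply_ne_zero he hu hv (eq_zero_of_mder_eq_zero hΦ (x := e.symm u) ?_ ?_)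
    · by_contra h0
      exact (innerAt_pos g₁ _ h0).ne h₁'
    · by_contra h0
      exact (innerAt_pos g₂ _ h0).ne h₂'
  · have h := pullback₂_areaTwo_add hΦ (e.symm u)
    rw [h₁, h₂]
    simp only [Complex.add_im, Complex.ofReal_im, Complex.im_ofReal_mul, Complex.I_im, rep₂]
    simp
    linear_combination (mder e.symm u).det * h

theorem contDiffAt_complexDet : ContDiffAt ℝ ∞ (complexDet g₁ g₂ Φ e e₁ e₂) u := by
  have h₁ := contDiffAt_pullCoframe g₁ (contMDiff_fst_comp hΦ) he hu he₁.mem hu₁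
  have h₂ := contDiffAt_pullCoframe g₂ (contMDiff_snd_comp hΦ) he hu he₂.mem hu₂
  exact ((h₁.clm_apply contDiffAt_const).mul (h₂.clm_apply contDiffAt_const)).sub
    ((h₁.clm_apply contDiffAt_const).mul (h₂.clm_apply contDiffAt_const))

theorem contDiffAt_traceForm : ContDiffAt ℝ ∞ (traceForm g₁ g₂ Φ e e₁ e₂) u :=
  ((contDiffAt_imLogDeriv (contDiffAt_complexDet hΦ he he₁ he₂ hu hu₁ hu₂)
    (complexDet_ne_zero hΦ he he₁ he₂ hu hu₁ hu₂)).add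
      (contDiffAt_pullConnForm g₁ (contMDiff_fst_comp hΦ) he hu he₁.mem hu₁)).add
    (contDiffAt_pullConnForm g₂ (contMDiff_snd_comp hΦ) he hu he₂.mem hu₂)

/-- The exterior derivative of the trace form is minus the pulled back Ricci form
`c₁ ω₁ + c₂ ω₂`; the Lagrangian condition expresses `ψ^* ω₂` by `φ^* ω₁`. -/
theorem curl_traceForm {c₁ c₂ : ℝ} (hg₁ : HasConstantGaussCurvature g₁ c₁)
    (hg₂ : HasConstantGaussCurvature g₂ c₂) :
    curl (traceForm g₁ g₂ Φ e e₁ e₂) u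
      = -(c₁ - c₂) * rep₂ e (pullback₂ (fun x ↦ (Φ x).1) (areaTwo g₁ o₁)) u := by
  have hp := contDiffAt_complexDet hΦ he he₁ he₂ hu hu₁ hu₂
  have h0 := complexDet_ne_zero hΦ he he₁ he₂ hu hu₁ hu₂
  have d0 := (contDiffAt_imLogDeriv hp h0).differentiableAt (by simp)
  have d1 := (contDiffAt_pullConnForm g₁ (contMDiff_fst_comp hΦ) he hu he₁.mem
    hu₁).differentiableAt (by simp)
  have d2 := (contDiffAt_pullConnForm g₂ (contMDiff_snd_comp hΦ) he hu he₂.mem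
    hu₂).differentiableAt (by simp)
  refine (curl_add (d0.add d1) d2).trans ?_
  refine (congrArg (· + _) (curl_add d0 d1)).trans ?_
  rw [curl_imLogDeriv hp h0, curl_pullConnForm g₁ (contMDiff_fst_comp hΦ) he hu he₁ hu₁ hg₁,
    curl_pullConnForm g₂ (contMDiff_snd_comp hΦ) he hu he₂ hu₂ hg₂]
  simp only [rep₂]
  linear_combination (-c₂ * (mder e.symm u).det) * pullback₂_areaTwo_add hΦ (e.symm u)

/-- The trace form does not depend on the coframes. -/
theorem traceForm_congr (he₁' : IsPositiveChart o₁ e₁') (he₂' : IsPositiveChart o₂ e₂')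
    (hu₁' : (Φ (e.symm u)).1 ∈ e₁'.source) (hu₂' : (Φ (e.symm u)).2 ∈ e₂'.source) :
    traceForm g₁ g₂ Φ e e₁' e₂' u = traceForm g₁ g₂ Φ e e₁ e₂ u := by
  have hφ := contMDiff_fst_comp hΦ
  have hψ := contMDiff_snd_comp hΦ
  have hp := contDiffAt_complexDet hΦ he he₁ he₂ hu hu₁ hu₂
  have h0 := complexDet_ne_zero hΦ he he₁ he₂ hu hu₁ hu₂
  set φ : S → M₁ := fun x ↦ (Φ x).1
  set ψ : S → M₂ := fun x ↦ (Φ x).2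
  set z₁ : Plane → ℂ := fun v ↦ gauge g₁ e₁ e₁' (inCharts e e₁ φ v) with hz₁
  set z₂ : Plane → ℂ := fun v ↦ gauge g₂ e₂ e₂' (inCharts e e₂ ψ v) with hz₂
  have dz₁ : DifferentiableAt ℝ z₁ u := (contDiffAt_gauge_inCharts g₁ hφ he hu he₁.mem he₁'.mem
    hu₁ hu₁').differentiableAt (by simp)
  have dz₂ : DifferentiableAt ℝ z₂ u := (contDiffAt_gauge_inCharts g₂ hψ he hu he₂.mem he₂'.mem
    hu₂ hu₂').differentiableAt (by simp)
  have hz₁0 : z₁ u ≠ 0 := by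
    have hx : e₁.symm (inCharts e e₁ φ u) = φ (e.symm u) := e₁.left_inv hu₁
    exact gauge_ne_zero g₁ he₁ he₁' (e₁.map_source hu₁) (hx ▸ hu₁')
  have hz₂0 : z₂ u ≠ 0 := by
    have hx : e₂.symm (inCharts e e₂ ψ u) = ψ (e.symm u) := e₂.left_inv hu₂
    exact gauge_ne_zero g₂ he₂ he₂' (e₂.map_source hu₂) (hx ▸ hu₂')
  have hev : complexDet g₁ g₂ Φ e e₁' e₂'
      =ᶠ[𝓝 u] fun v ↦ z₁ v * z₂ v * complexDet g₁ g₂ Φ e e₁ e₂ v := by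
    filter_upwards [eventually_mem_charts hφ hu hu₁, eventually_mem_charts hφ hu hu₁',
      eventually_mem_charts hψ hu hu₂, eventually_mem_charts hψ hu hu₂'] with v h₁ h₁' h₂ h₂'
    simp only [complexDet, pairDet]
    rw [pullCoframe_gauge g₁ hφ he h₁.1 he₁ he₁' h₁.2 h₁'.2,
      pullCoframe_gauge g₂ hψ he h₁.1 he₂ he₂' h₂.2 h₂'.2]
    simp only [smul_apply, smul_eq_mul, hz₁, hz₂]
    ring
  rw [traceForm, traceForm, imLogDeriv_congr hev,
    imLogDeriv_mul (p := fun v ↦ z₁ v * z₂ v) (dz₁.mul dz₂) (hp.differentiableAt (by simp)) (mul_ne_zero hz₁0 hz₂0) h0,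
    imLogDeriv_mul dz₁ dz₂ hz₁0 hz₂0, pullConnForm_gauge g₁ hφ he hu he₁ he₁' hu₁ hu₁',
    pullConnForm_gauge g₂ hψ he hu he₂ he₂' hu₂ hu₂']
  abel

/-- The trace form transforms as a one-form: the complex determinant changes by a real factor. -/
theorem traceForm_transition (he' : e' ∈ maximalAtlas (𝓡 2) ∞ S) (hu' : e.symm u ∈ e'.source) :
    traceForm g₁ g₂ Φ e e₁ e₂ u = pull (inCharts e e' id) (traceForm g₁ g₂ Φ e' e₁ e₂) u := by
  have hφ := contMDiff_fst_comp hΦ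
  have hψ := contMDiff_snd_comp hΦ
  have hT := contDiffAt_inCharts he he' contMDiff_id hu hu'
  have ht : inCharts e e' id u ∈ e'.target := e'.map_source hu'
  have hx : e'.symm (inCharts e e' id u) = e.symm u := e'.left_inv hu'
  have hp := (contDiffAt_complexDet hΦ he' he₁ he₂ ht (hx.symm ▸ hu₁)
    (hx.symm ▸ hu₂)).differentiableAt (by simp)
  have h0 := complexDet_ne_zero hΦ he' he₁ he₂ ht (hx.symm ▸ hu₁) (hx.symm ▸ hu₂)
  have hd : DifferentiableAt ℝ (fun v ↦ (fderiv ℝ (inCharts e e' id) v).det) u :=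
    ((contDiffAt_det_fderiv hT)).differentiableAt (by simp)
  have hd0 : ((fderiv ℝ (inCharts e e' id) u).det : ℂ) ≠ 0 := by
    have h := congrArg ContinuousLinearMap.det
      (mder_symm_comp_fderiv_inCharts he he' contMDiff_id hu hu')
    rw [mder_id, ContinuousLinearMap.id_comp, det_comp] at h
    exact Complex.ofReal_ne_zero.2
      (right_ne_zero_of_mul (h.trans_ne (det_mder_symm_ne_zero he hu)))
  have hev : complexDet g₁ g₂ Φ e e₁ e₂ =ᶠ[𝓝 u] fun v ↦
      ((fderiv ℝ (inCharts e e' id) v).det : ℂ)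
        * complexDet g₁ g₂ Φ e' e₁ e₂ (inCharts e e' id v) := by
    filter_upwards [eventually_mem_charts hφ hu hu₁, eventually_mem_charts hψ hu hu₂,
      eventually_mem_charts contMDiff_id hu hu'] with v h₁ h₂ h'
    rw [complexDet, complexDet, ← pairDet_pull]
    simp only [pairDet]
    rw [pullCoframe_transition g₁ hφ he h₁.1 he' he₁.mem h'.2 h₁.2,
      pullCoframe_transition g₂ hψ he h₁.1 he' he₂.mem h'.2 h₂.2]
  rw [traceForm, imLogDeriv_congr hev,
    imLogDeriv_mul (p := fun v ↦ ((fderiv ℝ (inCharts e e' id) v).det : ℂ))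
      (q := fun v ↦ complexDet g₁ g₂ Φ e' e₁ e₂ (inCharts e e' id v))
      (Complex.ofRealCLM.differentiableAt.comp u hd) (hp.comp u (hT.differentiableAt (by simp))) hd0 h0,
    imLogDeriv_ofReal hd, imLogDeriv_comp hp (hT.differentiableAt (by simp)), zero_add,
    pullConnForm_transition g₁ hφ he hu he' he₁.mem hu' hu₁,
    pullConnForm_transition g₂ hψ he hu he' he₂.mem hu' hu₂]
  simp only [pull, traceForm, ContinuousLinearMap.add_comp]

end Chart

/-- The one-form on `S` that is given by the trace form in every chart. -/
def primitive (g₁ : SurfaceMetric M₁) (g₂ : SurfaceMetric M₂) (o₁ : SurfaceOrientation M₁)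
    (o₂ : SurfaceOrientation M₂) (Φ : S → M₁ × M₂) (x : S) : Plane →L[ℝ] ℝ :=
  (traceForm g₁ g₂ Φ (chartAt Plane x) (posChart o₁ (Φ x).1) (posChart o₂ (Φ x).2)
    (chartAt Plane x x)).comp (mder (chartAt Plane x) x)

variable [IsManifold (𝓡 2) ∞ S]
include hΦ

theorem rep₁_primitive {e : OpenPartialHomeomorph S Plane} (he : e ∈ maximalAtlas (𝓡 2) ∞ S)
    {e₁ : OpenPartialHomeomorph M₁ Plane} {e₂ : OpenPartialHomeomorph M₂ Plane}
    (he₁ : IsPositiveChart o₁ e₁) (he₂ : IsPositiveChart o₂ e₂) {u : Plane} (hu : u ∈ e.target)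
    (hu₁ : (Φ (e.symm u)).1 ∈ e₁.source) (hu₂ : (Φ (e.symm u)).2 ∈ e₂.source) :
    rep₁ e (primitive g₁ g₂ o₁ o₂ Φ) u = traceForm g₁ g₂ Φ e e₁ e₂ u := by
  have hx := mem_chart_source Plane (e.symm u)
  have hc : chartAt Plane (e.symm u) ∈ maximalAtlas (𝓡 2) ∞ S := chart_mem_maximalAtlas _
  have hT := fderiv_inCharts he hc contMDiff_id hu hx
  rw [mder_id, ContinuousLinearMap.id_comp] at hT
  rw [← traceForm_congr hΦ he he₁ he₂ hu hu₁ hu₂ (isPositiveChart_posChart o₁ _)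
      (isPositiveChart_posChart o₂ _) (mem_posChart o₁ _) (mem_posChart o₂ _),
    traceForm_transition hΦ he (isPositiveChart_posChart o₁ _) (isPositiveChart_posChart o₂ _) hu
      (mem_posChart o₁ _) (mem_posChart o₂ _) hc hx, pull, hT]
  rfl

theorem rep₁_primitive_eventuallyEq {e : OpenPartialHomeomorph S Plane}
    (he : e ∈ maximalAtlas (𝓡 2) ∞ S) {u : Plane} (hu : u ∈ e.target) :
    rep₁ e (primitive g₁ g₂ o₁ o₂ Φ) =ᶠ[𝓝 u] traceForm g₁ g₂ Φ e
      (posChart o₁ (Φ (e.symm u)).1) (posChart o₂ (Φ (e.symm u)).2) := by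
  filter_upwards [eventually_mem_charts (contMDiff_fst_comp hΦ) hu (mem_posChart o₁ _),
    eventually_mem_charts (contMDiff_snd_comp hΦ) hu (mem_posChart o₂ _)] with v h₁ h₂
  exact rep₁_primitive hΦ he (isPositiveChart_posChart o₁ _) (isPositiveChart_posChart o₂ _)
    h₁.1 h₁.2 h₂.2

theorem isC1Form_primitive : IsC1Form (primitive g₁ g₂ o₁ o₂ Φ) := fun e he u hu ↦
  ((contDiffAt_traceForm hΦ he (isPositiveChart_posChart o₁ _) (isPositiveChart_posChart o₂ _) hu
    (mem_posChart o₁ _) (mem_posChart o₂ _)).of_le (by norm_cast)).congr_of_eventuallyEq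
      (rep₁_primitive_eventuallyEq hΦ he hu)

theorem extd_primitive {c₁ c₂ : ℝ} (hg₁ : HasConstantGaussCurvature g₁ c₁)
    (hg₂ : HasConstantGaussCurvature g₂ c₂) :
    extd (primitive g₁ g₂ o₁ o₂ Φ)
      = fun x ↦ -(c₁ - c₂) * pullback₂ (fun x ↦ (Φ x).1) (areaTwo g₁ o₁) x := by
  ext x
  have he : chartAt Plane x ∈ maximalAtlas (𝓡 2) ∞ S := chart_mem_maximalAtlas x
  have hx := mem_chart_source Plane x
  have hu := (chartAt Plane x).map_source hx
  refine eq_of_rep₂_eq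
    (W' := fun x ↦ -(c₁ - c₂) * pullback₂ (fun x ↦ (Φ x).1) (areaTwo g₁ o₁) x) he hx ?_
  rw [rep₂_extd (isC1Form_primitive hΦ) he hu, curl_congr (rep₁_primitive_eventuallyEq hΦ he hu),
    curl_traceForm hΦ he (isPositiveChart_posChart o₁ _) (isPositiveChart_posChart o₂ _) hu
      (mem_posChart o₁ _) (mem_posChart o₂ _) hg₁ hg₂]
  simp only [rep₂]
  ring

theorem surfaceIntegral_pullback₂_fst [T2Space S] [CompactSpace S] (o : SurfaceOrientation S)
    {c₁ c₂ : ℝ} (hg₁ : HasConstantGaussCurvature g₁ c₁) (hg₂ : HasConstantGaussCurvature g₂ c₂)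
    (hc : c₁ ≠ c₂) :
    surfaceIntegral o (pullback₂ (fun x ↦ (Φ x).1) (areaTwo g₁ o₁)) = 0 := by
  have h := surfaceIntegral_extd o (isC1Form_primitive hΦ)
  rw [extd_primitive hΦ hg₁ hg₂, surfaceIntegral_const_mul] at h
  exact (mul_eq_zero.1 h).resolve_left (neg_ne_zero.2 (sub_ne_zero.2 hc))

theorem surfaceIntegral_pullback₂_snd [T2Space S] [CompactSpace S] (o : SurfaceOrientation S)
    {c₁ c₂ : ℝ} (hg₁ : HasConstantGaussCurvature g₁ c₁) (hg₂ : HasConstantGaussCurvature g₂ c₂)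
    (hc : c₁ ≠ c₂) :
    surfaceIntegral o (pullback₂ (fun x ↦ (Φ x).2) (areaTwo g₂ o₂)) = 0 := by
  have h : pullback₂ (fun x ↦ (Φ x).2) (areaTwo g₂ o₂)
      = fun x ↦ -1 * pullback₂ (fun x ↦ (Φ x).1) (areaTwo g₁ o₁) x := by
    ext x
    linear_combination pullback₂_areaTwo_add hΦ x
  rw [h, surfaceIntegral_const_mul, surfaceIntegral_pullback₂_fst hΦ o hg₁ hg₂ hc, mul_zero]

end

end LagrangianDegree

theorem proposition1
    {S M₁ M₂ : Type*}
    [TopologicalSpace S] [ChartedSpace Plane S] [IsManifold (𝓡 2) ∞ S]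
    [T2Space S] [CompactSpace S]
    [TopologicalSpace M₁] [ChartedSpace Plane M₁] [IsManifold (𝓡 2) ∞ M₁]
    [T2Space M₁] [CompactSpace M₁] [ConnectedSpace M₁]
    [TopologicalSpace M₂] [ChartedSpace Plane M₂] [IsManifold (𝓡 2) ∞ M₂]
    [T2Space M₂] [CompactSpace M₂] [ConnectedSpace M₂]
    (o : SurfaceOrientation S) (o₁ : SurfaceOrientation M₁) (o₂ : SurfaceOrientation M₂)
    (g₁ : SurfaceMetric M₁) (g₂ : SurfaceMetric M₂) (c₁ c₂ : ℝ)
    (hg₁ : HasConstantGaussCurvature g₁ c₁) (hg₂ : HasConstantGaussCurvature g₂ c₂)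
    (hc : c₁ ≠ c₂)
    (Φ : S → M₁ × M₂) (hΦ : IsLagrangianImmersion g₁ o₁ g₂ o₂ Φ) :
    HasDegree o o₁ (fun x ↦ (Φ x).1) 0 ∧ HasDegree o o₂ (fun x ↦ (Φ x).2) 0 := by
  have h₁ := LagrangianDegree.surfaceIntegral_pullback₂_fst hΦ o hg₁ hg₂ hc
  have h₂ := LagrangianDegree.surfaceIntegral_pullback₂_snd hΦ o hg₁ hg₂ hc
  exact ⟨LagrangianDegree.hasDegree_zero o o₁ (LagrangianDegree.contMDiff_fst_comp hΦ)
      (LagrangianDegree.isPositiveForm_areaTwo g₁ o₁) h₁,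
    LagrangianDegree.hasDegree_zero o o₂ (LagrangianDegree.contMDiff_snd_comp hΦ)
      (LagrangianDegree.isPositiveForm_areaTwo g₂ o₂) h₂⟩

end
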